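/- **Setting.** A thread over a finite data domain $D$ is an automaton with a finite state set, an initial state and transitions labelled by a write $!a$, a read $?a$ ($a\in D$) or $\varepsilon$. Threads share one memory cell: $!a$ stores $a$, $?a$ requires that the cell holds $a$, $\varepsilon$ leaves it unchanged. An instance of LCR (leader contributor reachability) consists of $D$, an initial value $a^0\in D$, a leader thread $P_L$, a contributor thread $P_C$ and a set $F_L$ of unsafe states of $P_L$; the question is whether for some $t\in\mathbb N$ the program consisting of $P_L$ and $t$ copies of $P_C$ can reach, from the initial configuration, a configuration with the leader in $F_L$. Let $\mathtt D=|D|$ and let $\mathtt L,\mathtt C$ be the numbers of states of $P_L$ and $P_C$. It is assumed that the leader does not depend on reading its own writes: whenever $q\xrightarrow{!a}q_1\xrightarrow{\varepsilon^*}q_2\xrightarrow{?a}q_3$ in $P_L$, then also $q\xrightarrow{!a}q_1'\xrightarrow{\varepsilon^*}q_3$ for some $q_1'$ (for instance because $P_L$ never reads $a$ directly after writing $a$). For a word $r=c_1\dots c_\ell$ over $D$ without repeated letters and $0\le i\le\ell$, let $P_L{\downarrow_i}$ be $P_L$ without the transitions that read a value outside $\{c_1,\dots,c_i\}$, and let $\mathrm{scc}(P_L{\downarrow_i})$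 be the set of its strongly connected components. Let $G(P_L,r)$ be the directed graph whose vertex set is the disjoint union of the sets $\mathrm{scc}(P_L{\downarrow_i})$, $0\le i\le\ell$, with an edge from $S$ to $S'\ne S$ in the same $\mathrm{scc}(P_L{\downarrow_i})$ if $P_L{\downarrow_i}$ has a transition from a state in $S$ to a state in $S'$, and an edge from $S\in\mathrm{scc}(P_L{\downarrow_{i-1}})$ to $S'\in\mathrm{scc}(P_L{\downarrow_i})$ if $P_L$ has a transition reading $c_i$ from a state in $S$ to a state in $S'$. The straight line depth $\mathtt d$ is the maximum over all $r$ of the number of vertices of a longest path in $G(P_L,r)$, and $\mathtt s=|\mathrm{scc}(P_L{\downarrow_0})|$, where no value can be read. An SCC-witness candidate is a word $B_0\,\bar c_1\,B_1\,\bar c_2\cdots\bar c_\ell\,B_\ell\,S$ with $r=c_1\dots c_\ell$ as above, $B_i\in(\mathrm{scc}(P_L{\downarrow_i}).(D\cup\{\bot\}))^{k_i}$, $k_0+\dots+k_\ell\le \mathtt d-1$ and $S\in\mathrm{scc}(P_L{\downarrow_\ell})$. Let $\mathit{Wit}_{SCC}$ be the number of SCC-witness candidates and $\mathit{Valid}_{SCC}=\mathtt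 L^2\cdot\mathtt D\cdot\mathtt C^2\cdot\mathtt d^2$. **Theorem.** LCR can be solved in time $O(\mathit{Wit}_{SCC}\cdot\mathit{Valid}_{SCC})$, and $$\mathit{Wit}_{SCC}\le(\mathtt s\cdot(\mathtt D+1))^{\mathtt d}\cdot\mathtt D^{\mathtt D}\cdot 2^{\mathtt D+\mathtt d}.$$ That is, there are one program for a random access machine (unit cost; addition and truncated subtraction, no multiplication; transition relations given as $0/1$ tables) and one constant $K$ such that on every instance as above the program halts after at most $K\cdot\mathit{Wit}_{SCC}\cdot\mathit{Valid}_{SCC}$ steps with the correct answer. -/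

import Mathlib

/-! ## Threads and leader contributor reachability -/

/-- The operations on a memory with data domain `D`: writing `!a` and reading `?a`. -/
inductive Op (D : Type) : Type
  | write (a : D) : Op D
  | read (a : D) : Op D

/-- A thread over the data domain `D` with states `Q`: an initial state and a transition relation
labelled by operations; the label `none` is the internal move `ε`. -/
structure Thread (D Q : Type) where
  init : Q
  trans : Set (Q × Option (Op D) × Q)

/-- `MemStep o a b`: a transition labelled `o` can be taken when the memory holds `a`, and the
memory then holds `b`. -/
inductive MemStep {D : Type} : Option (Op D) → D → D → Prop
  | eps (a : D) : MemStep none a a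
  | read (a : D) : MemStep (some (Op.read a)) a a
  | write (a b : D) : MemStep (some (Op.write b)) a b

/-- Configurations of the program with one leader and `t` copies of the contributor. -/
structure Config (D QL QC : Type) (t : ℕ) where
  leader : QL
  contributor : Fin t → QC
  memory : D

/-- One transition of the program with leader `PL` and `t` copies of the contributor `PC`. -/
inductive Step {D QL QC : Type} (PL : Thread D QL) (PC : Thread D QC) {t : ℕ} :
    Config D QL QC t → Config D QL QC t → Prop
  | leader (q q' : QL) (pc : Fin t → QC) (o : Option (Op D)) (a b : D) :
      (q, o, q') ∈ PL.trans → MemStep o a b → Step PL PC ⟨q, pc, a⟩ ⟨q', pc, b⟩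
  | contributor (q : QL) (pc : Fin t → QC) (i : Fin t) (x : QC) (o : Option (Op D)) (a b : D) :
      (pc i, o, x) ∈ PC.trans → MemStep o a b →
        Step PL PC ⟨q, pc, a⟩ ⟨q, Function.update pc i x, b⟩

/-- An instance of leader contributor reachability whose leader has `L` states, whose contributor
has `C` states and whose data domain has `D` values: a program and a set of unsafe leader states. -/
structure LCRInstance (L C D : ℕ) where
  leader : Thread (Fin D) (Fin L)
  contributor : Thread (Fin D) (Fin C)
  initValue : Fin D
  bad : Set (Fin L)

/-- The question of the problem: for some number `t` of contributors, is a configuration with an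
unsafe leader state reachable from the initial configuration? -/
def LCRInstance.Reachable {L C D : ℕ} (I : LCRInstance L C D) : Prop :=
  ∃ (t : ℕ) (c : Config (Fin D) (Fin L) (Fin C) t),
    Relation.ReflTransGen (Step I.leader I.contributor)
      ⟨I.leader.init, fun _ => I.contributor.init, I.initValue⟩ c ∧ c.leader ∈ I.bad

namespace Thread

variable {D Q : Type}

/-- `q'` is reachable from `q` by internal moves only. -/
def EpsReach (P : Thread D Q) (q q' : Q) : Prop :=
  Relation.ReflTransGen (fun x y => (x, none, y) ∈ P.trans) q q'

/-- The thread does not depend on reading its own writes: when it can write `a` and then, after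
internal moves only, read `a`, the read can be replaced by internal moves. In particular this holds
when no read of `a` can follow a write of `a` up to internal moves. -/
def OwnReadsReplaceable (P : Thread D Q) : Prop :=
  ∀ (a : D) (q q₁ q₂ q₃ : Q), (q, some (Op.write a), q₁) ∈ P.trans → P.EpsReach q₁ q₂ →
    (q₂, some (Op.read a), q₃) ∈ P.trans →
      ∃ q₁' : Q, (q, some (Op.write a), q₁') ∈ P.trans ∧ P.EpsReach q₁' q₃

/-! ## Strongly connected components, straight line depth, candidates -/

/-- The thread without the transitions that read a value outside `A`. -/
def restrict (P : Thread D Q) (A : Set D) : Thread D Q where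
  init := P.init
  trans := {e ∈ P.trans | ∀ a : D, e.2.1 = some (Op.read a) → a ∈ A}

/-- For a word `r = c₁ … c_ℓ`: the thread in which only `c₁, …, c_i` can be read. -/
def level (P : Thread D Q) (r : List D) (i : ℕ) : Thread D Q :=
  P.restrict {c | c ∈ r.take i}

/-- There is some transition from `q` to `q'`. -/
def Edge (P : Thread D Q) (q q' : Q) : Prop :=
  ∃ o : Option (Op D), (q, o, q') ∈ P.trans

/-- The strongly connected component of a state. -/
def sccOf (P : Thread D Q) (q : Q) : Set Q :=
  {q' | Relation.ReflTransGen P.Edge q q' ∧ Relation.ReflTransGen P.Edge q' q}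

/-- The set of all strongly connected components. -/
def scc (P : Thread D Q) : Set (Set Q) :=
  Set.range P.sccOf

/-- The vertices of the graph `G(P, r)`, the disjoint union over `i ∈ [0..ℓ]` of the sets of
components of `P.level r i`; the first entry is the index `i`. -/
def vertices (P : Thread D Q) (r : List D) : Set (ℕ × Set Q) :=
  {v | v.1 ≤ r.length ∧ v.2 ∈ (P.level r v.1).scc}

/-- The edges of the graph `G(P, r)`: a transition between two different components of the same
index, or a transition reading `c_{i+1}` from a component of index `i` to one of index `i + 1`. -/
def GraphEdge (P : Thread D Q) (r : List D) (v w : ℕ × Set Q) : Prop :=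
  (w.1 = v.1 ∧ v.2 ≠ w.2 ∧ ∃ q ∈ v.2, ∃ q' ∈ w.2, (P.level r v.1).Edge q q') ∨
  (w.1 = v.1 + 1 ∧ ∃ q ∈ v.2, ∃ q' ∈ w.2, ∃ c : D,
    r[v.1]? = some c ∧ (q, some (Op.read c), q') ∈ P.trans)

/-- The depth of `P` relative to `r`: the largest number of vertices on a path in `G(P, r)`. -/
noncomputable def depthOf (P : Thread D Q) (r : List D) : ℕ :=
  sSup {n | ∃ p : List (ℕ × Set Q), (∀ v ∈ p, v ∈ P.vertices r) ∧ p.Nodup ∧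
    p.IsChain (P.GraphEdge r) ∧ p.length = n}

/-- The straight line depth: the maximal depth relative to a word without repeated letters. -/
noncomputable def straightLineDepth (P : Thread D Q) : ℕ :=
  sSup {n | ∃ r : List D, r.Nodup ∧ n = P.depthOf r}

/-- The number of strongly connected components when no value can be read. -/
noncomputable def numSCC (P : Thread D Q) : ℕ :=
  (P.restrict ∅).scc.ncard

/-- The SCC-witness candidates: words `B₀ c̄₁ B₁ c̄₂ … c̄_ℓ B_ℓ S` with a word `r = c₁ … c_ℓ` without
repeated letters, blocks `B_i` consisting of `k_i` pairs of a component of `P.level r i` and an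
element of `D ∪ {⊥}` (here `none` is `⊥`), `k₀ + … + k_ℓ ≤ d - 1` for the straight line depth `d`,
and a component `S` of `P.level r ℓ`. Such a word is given as the triple `(r, [B₀, …, B_ℓ], S)`,
which it determines. -/
def sccCandidates (P : Thread D Q) : Set (List D × List (List (Set Q × Option D)) × Set Q) :=
  {w | w.1.Nodup ∧ w.2.1.length = w.1.length + 1 ∧
    (∀ (i : ℕ) (B : List (Set Q × Option D)), w.2.1[i]? = some B →
      ∀ x ∈ B, x.1 ∈ (P.level w.1 i).scc) ∧
    (w.2.1.map List.length).sum ≤ P.straightLineDepth - 1 ∧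
    w.2.2 ∈ (P.level w.1 w.1.length).scc}

/-- The number of SCC-witness candidates. -/
noncomputable def witSCC (P : Thread D Q) : ℕ :=
  P.sccCandidates.ncard

end Thread

/-- The bound for the test of a single candidate. -/
def validSCC (L D C d : ℕ) : ℕ :=
  L ^ 2 * D * C ^ 2 * d ^ 2

/-! ## Random access machines with unit cost -/

namespace RAM

/-- The state of the machine: registers, and arrays of unbounded length whose cells are accessed
through an index held in a register. -/
structure State where
  reg : ℕ → ℕ
  arr : ℕ → ℕ → ℕ

/-- Programs. A program mentions finitely many registers and arrays. There is no multiplication,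
so that a step lengthens a number by at most one bit. -/
inductive Prog : Type
  /-- `x := n` -/
  | const (x n : ℕ) : Prog
  /-- `x := y + z` -/
  | add (x y z : ℕ) : Prog
  /-- `x := y - z`, which is `0` if `y < z` -/
  | sub (x y z : ℕ) : Prog
  /-- `x := arr k [y]` -/
  | load (x k y : ℕ) : Prog
  /-- `arr k [y] := x` -/
  | store (k y x : ℕ) : Prog
  /-- first `p`, then `p'` -/
  | seq (p p' : Prog) : Prog
  /-- if register `x` is not zero then `p` else `p'` -/
  | cond (x : ℕ) (p p' : Prog) : Prog
  /-- while register `x` is not zero do `p` -/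
  | loop (x : ℕ) (p : Prog) : Prog

/-- Assignment to a register. -/
def State.setReg (σ : State) (x v : ℕ) : State :=
  { σ with reg := Function.update σ.reg x v }

/-- Assignment to a cell of an array. -/
def State.setArr (σ : State) (k i v : ℕ) : State :=
  { σ with arr := Function.update σ.arr k (Function.update (σ.arr k) i v) }

/-- `Run p σ σ' t`: started in `σ`, the program `p` halts in `σ'` after exactly `t` steps. Every
assignment and every test of a register is one step. -/
inductive Run : Prog → State → State → ℕ → Prop
  | const (σ : State) (x n : ℕ) : Run (.const x n) σ (σ.setReg x n) 1
  | add (σ : State) (x y z : ℕ) : Run (.add x y z) σ (σ.setReg x (σ.reg y + σ.reg z)) 1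
  | sub (σ : State) (x y z : ℕ) : Run (.sub x y z) σ (σ.setReg x (σ.reg y - σ.reg z)) 1
  | load (σ : State) (x k y : ℕ) : Run (.load x k y) σ (σ.setReg x (σ.arr k (σ.reg y))) 1
  | store (σ : State) (k y x : ℕ) : Run (.store k y x) σ (σ.setArr k (σ.reg y) (σ.reg x)) 1
  | seq {p p' : Prog} {σ σ' σ'' : State} {t t' : ℕ} :
      Run p σ σ' t → Run p' σ' σ'' t' → Run (.seq p p') σ σ'' (t + t')
  | condTrue {x : ℕ} {p p' : Prog} {σ σ' : State} {t : ℕ} :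
      σ.reg x ≠ 0 → Run p σ σ' t → Run (.cond x p p') σ σ' (t + 1)
  | condFalse {x : ℕ} {p p' : Prog} {σ σ' : State} {t : ℕ} :
      σ.reg x = 0 → Run p' σ σ' t → Run (.cond x p p') σ σ' (t + 1)
  | loopStop {x : ℕ} {p : Prog} {σ : State} : σ.reg x = 0 → Run (.loop x p) σ σ 1
  | loopStep {x : ℕ} {p : Prog} {σ σ' σ'' : State} {t t' : ℕ} :
      σ.reg x ≠ 0 → Run p σ σ' t → Run (.loop x p) σ' σ'' t' →
        Run (.loop x p) σ σ'' (t + t' + 1)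

end RAM

open Classical in
/-- `1` for a true proposition, `0` for a false one. -/
noncomputable def bit01 (p : Prop) : ℕ :=
  if p then 1 else 0

/-- The table of the internal moves of a thread with `n` states. -/
noncomputable def Thread.epsTable {D n : ℕ} (P : Thread (Fin D) (Fin n)) (i : ℕ) : ℕ :=
  bit01 (∃ q q' : Fin n, i = q * n + q' ∧ (q, none, q') ∈ P.trans)

/-- The table of the moves whose label is `op a` for a value `a`. -/
noncomputable def Thread.opTable {D n : ℕ} (P : Thread (Fin D) (Fin n)) (op : Fin D → Op (Fin D))
    (i : ℕ) : ℕ :=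
  bit01 (∃ (a : Fin D) (q q' : Fin n), i = (a * n + q) * n + q' ∧ (q, some (op a), q') ∈ P.trans)

/-- The input of the machine: registers `0` to `5` hold the sizes `L`, `C`, `D`, the initial value
and the initial states of leader and contributor; array `0` holds the set of unsafe states, arrays
`1` to `3` the internal moves, writes and reads of the leader, arrays `4` to `6` those of the
contributor. All other registers and cells are `0`. -/
noncomputable def LCRInstance.input {L C D : ℕ} (I : LCRInstance L C D) : RAM.State where
  reg := fun
    | 0 => L
    | 1 => C
    | 2 => D
    | 3 => I.initValue
    | 4 => I.leader.init
    | 5 => I.contributor.init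
    | _ => 0
  arr := fun
    | 0 => fun i => bit01 (∃ q : Fin L, i = q ∧ q ∈ I.bad)
    | 1 => I.leader.epsTable
    | 2 => I.leader.opTable Op.write
    | 3 => I.leader.opTable Op.read
    | 4 => I.contributor.epsTable
    | 5 => I.contributor.opTable Op.write
    | 6 => I.contributor.opTable Op.read
    | _ => fun _ => 0

/-!
Leader contributor reachability is decided by a search over *nodes* (`SearchNode`). A node records
the state in which the leader has just entered a strongly connected component, the value written on
the way (if contributors shall read it), and the set of contributor states that can be occupied by
arbitrarily many contributors. While the leader stays in a component, it can repeat the writes inside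
the component as often as desired, so that the contributors may read these values as well as all
values that they can write themselves. Hence the contributor states grow to a least saturated set
(`saturation`), and the values that contributors then provide determine the component of the leader.
A child of a node is obtained by a transition of the leader that leaves this component; the state it
enters is replaced by a representative of its component without reads.

The search is correct (`LCRInstance.reachable_iff`). Every node found is realized by runs with
arbitrarily many contributors (`SearchNode.Found.coverable`), because contributors can be copied.
Conversely, every run is covered by found nodes (`Covered.step`). Here it matters that the leader does
not depend on reading its own writes: a value that it has just written has to be readable for
contributors only, and otherwise the leader reads what contributors provide. The initial value is
treated like a value just written, except that the leader may read it, too.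

The search is small (`SearchNode.weight_roots`, `SearchNode.weight_children`). A chain of children
leaves one component after the other for good, and the same holds in the graph `G(P, r)` where `r`
lists the values in the order in which they are first needed. So a chain has at most `d` nodes, `d`
being the straight line depth. A node has at most `s * (D + 1)` children and there are at most `s`
roots, so there are at most `s * ∑ k < d, (s * (D + 1)) ^ k` nodes on all chains together. Already the
candidates whose word `r` is empty are that many (`Thread.geometric_sum_le_witSCC`).

A node is processed within `O(L² D C²)` steps (`RAM.processNode_spec`). The rounds of the saturation
are at most `min C D + 1`, as every round but the last adds a contributor state and a value. Each round
costs `O(L² D + D C + C²)`, and the matrices of the readable values are added to the adjacency matrix of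
the contributors once for every value (`RAM.roundBudget`). The nodes that still have to be processed
are kept in a stack; the weights of its nodes bound the number of nodes to come
(`RAM.searchLoop_spec`).

Programs are verified with a logic of total correctness (`RAM.Exec`) that keeps track of the time.
What a program does not change is read off its text (`RAM.Frame`). The constants in the time bounds are
generous.

For the upper bound on the number of candidates, `Thread.sccCandidates_finite_and_ncard_le` counts
words `r`, block lists, and last components.
-/

/-! ### Counting lists of blocks -/

/-- The lists of `m` blocks with at most `k` entries altogether, those of the `i`-th block in
`E i`. -/
def blockLists {α : Type} (E : ℕ → Set α) (m k : ℕ) : Set (List (List α)) :=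
  {Bs | Bs.length = m ∧ (∀ (i : ℕ) (B : List α), Bs[i]? = some B → ∀ x ∈ B, x ∈ E i) ∧
    (Bs.map List.length).sum ≤ k}

/-- Remove the first block if it is empty, and the first entry of the first block otherwise. -/
theorem blockLists_succ_subset {α : Type} (E : ℕ → Set α) (m k : ℕ) :
    blockLists E (m + 1) (k + 1) ⊆
      (List.cons [] '' blockLists (fun i => E (i + 1)) m (k + 1)) ∪
      ((fun p : α × List (List α) => (p.1 :: p.2.headD []) :: p.2.tail) ''
        (E 0 ×ˢ blockLists E (m + 1) k)) := by
  rintro Bs ⟨hl, hE, hs⟩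
  match Bs, hl with
  | [] :: Bs, hl =>
    left
    refine ⟨Bs, ⟨by simpa using hl, fun i B hB => hE (i + 1) B (by simpa using hB),
      by simpa using hs⟩, rfl⟩
  | (x :: B) :: Bs, hl =>
    right
    refine ⟨(x, B :: Bs), ⟨hE 0 (x :: B) rfl x (by simp), by simpa using hl, ?_, ?_⟩, rfl⟩
    · rintro (_ | i) B' hB' y hy
      · simp only [List.getElem?_cons_zero, Option.some.injEq] at hB'
        subst hB'
        exact hE 0 (x :: B) rfl y (by simp [hy])
      · exact hE (i + 1) B' (by simpa using hB') y hy
    · simp only [List.map_cons, List.length_cons, List.sum_cons] at hs ⊢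
      omega

theorem blockLists_succ_zero_subset {α : Type} (E : ℕ → Set α) (m : ℕ) :
    blockLists E (m + 1) 0 ⊆ List.cons [] '' blockLists (fun i => E (i + 1)) m 0 := by
  rintro Bs ⟨hl, hE, hs⟩
  match Bs, hl with
  | [] :: Bs, hl =>
    exact ⟨Bs, ⟨by simpa using hl, fun i B hB => hE (i + 1) B (by simpa using hB),
      by simpa using hs⟩, rfl⟩
  | (x :: B) :: Bs, hl => simp at hs

/-- A list of `m` blocks is determined by its at most `k` entries and by a sequence of at most `m + k`
bits which tells where the blocks end. The induction removes one bit after the other. -/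
theorem blockLists_finite_and_ncard_le {α : Type} (b m : ℕ) : ∀ (k : ℕ) (E : ℕ → Set α),
    1 ≤ b → (∀ i, (E i).Finite) → (∀ i, (E i).ncard ≤ b) →
    (blockLists E m k).Finite ∧ (blockLists E m k).ncard ≤ b ^ k * 2 ^ (m + k) := by
  induction m with
  | zero =>
    intro k E hb _ _
    have h : blockLists E 0 k ⊆ {[]} := fun Bs hBs => List.eq_nil_of_length_eq_zero hBs.1
    refine ⟨(Set.finite_singleton _).subset h, (Set.ncard_le_ncard h).trans ?_⟩
    rw [Set.ncard_singleton]
    exact Nat.one_le_iff_ne_zero.2 (by positivity)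
  | succ m ihm =>
    intro k
    induction k with
    | zero =>
      intro E hb hf hE
      obtain ⟨h1, h2⟩ := ihm 0 (fun i => E (i + 1)) hb (fun i => hf _) (fun i => hE _)
      have h := blockLists_succ_zero_subset E m
      refine ⟨(h1.image _).subset h, (Set.ncard_le_ncard h (h1.image _)).trans ?_⟩
      refine (Set.ncard_image_le h1).trans (h2.trans ?_)
      simp only [pow_zero, one_mul, add_zero]
      exact Nat.pow_le_pow_right (by norm_num) (by omega)
    | succ k ihk =>
      intro E hb hf hE
      obtain ⟨h1, h2⟩ := ihm (k + 1) (fun i => E (i + 1)) hb (fun i => hf _) (fun i => hE _)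
      obtain ⟨h3, h4⟩ := ihk E hb hf hE
      have h := blockLists_succ_subset E m k
      have hfin := (h1.image (List.cons [])).union (((hf 0).prod h3).image
        (fun p : α × List (List α) => (p.1 :: p.2.headD []) :: p.2.tail))
      refine ⟨hfin.subset h, (Set.ncard_le_ncard h hfin).trans ?_⟩
      refine (Set.ncard_union_le _ _).trans ?_
      have e1 := (Set.ncard_image_le (f := List.cons []) h1).trans h2
      have e2 := (Set.ncard_image_le
        (f := fun p : α × List (List α) => (p.1 :: p.2.headD []) :: p.2.tail)
        ((hf 0).prod h3))
      rw [Set.ncard_prod] at e2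
      have e3 := e2.trans (Nat.mul_le_mul (hE 0) h4)
      refine (Nat.add_le_add e1 e3).trans (le_of_eq ?_)
      rw [show m + 1 + (k + 1) = (m + 1 + k) + 1 by ring, show m + (k + 1) = m + 1 + k by ring,
        pow_succ, pow_succ]
      ring

theorem ncard_lists_length_le {α : Type} (E : Set α) (hE : E.Finite) (n : ℕ) :
    {B : List α | (∀ x ∈ B, x ∈ E) ∧ B.length ≤ n}.Finite ∧
    ∑ k ∈ Finset.range (n + 1), E.ncard ^ k ≤
      {B : List α | (∀ x ∈ B, x ∈ E) ∧ B.length ≤ n}.ncard := by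
  induction n with
  | zero =>
    have h : {B : List α | (∀ x ∈ B, x ∈ E) ∧ B.length ≤ 0} = {[]} := by
      ext B
      constructor
      · intro h
        exact List.eq_nil_of_length_eq_zero (Nat.le_zero.1 h.2)
      · rintro rfl
        simp
    rw [h]
    simp
  | succ n ih =>
    obtain ⟨h1, h2⟩ := ih
    have h : {B : List α | (∀ x ∈ B, x ∈ E) ∧ B.length ≤ n + 1} =
        {[]} ∪ (fun p : α × List α => p.1 :: p.2) ''
          (E ×ˢ {B : List α | (∀ x ∈ B, x ∈ E) ∧ B.length ≤ n}) := by
      ext B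
      cases B with
      | nil => simp
      | cons x B => simp; tauto
    have hfin := (hE.prod h1).image (fun p : α × List α => p.1 :: p.2)
    rw [h]
    refine ⟨(Set.finite_singleton _).union hfin, ?_⟩
    rw [Set.ncard_union_eq (by simp) (Set.finite_singleton _) hfin,
      Set.ncard_image_of_injective _ (fun p p' hp => by
        simp only [List.cons.injEq] at hp; exact Prod.ext hp.1 hp.2), Set.ncard_prod,
      Finset.sum_range_succ', Set.ncard_singleton]
    simp only [pow_zero, pow_succ]
    rw [← Finset.sum_mul, add_comm, mul_comm]
    exact Nat.add_le_add_left (Nat.mul_le_mul_left _ h2) _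

/-- There are `D + 1` possible lengths of a word without repeated letters. -/
theorem nodup_finite_and_ncard_le (D : ℕ) (hD : 1 ≤ D) :
    {r : List (Fin D) | r.Nodup}.Finite ∧
      {r : List (Fin D) | r.Nodup}.ncard ≤ (D + 1) * D ^ D := by
  have h : {r : List (Fin D) | r.Nodup} ⊆
      ⋃ l ∈ Finset.range (D + 1), {r : List (Fin D) | r.length = l} := by
    intro r hr
    have := List.Nodup.length_le_card hr
    simp only [Fintype.card_fin] at this
    simp only [Set.mem_iUnion, Finset.mem_range, Set.mem_ofPred_eq]
    exact ⟨r.length, by omega, rfl⟩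
  have hf : ∀ l, {r : List (Fin D) | r.length = l}.Finite := fun l => List.finite_length_eq _ l
  have hfin : (⋃ l ∈ Finset.range (D + 1), {r : List (Fin D) | r.length = l}).Finite :=
    Set.Finite.biUnion (Finset.finite_toSet _) (fun l _ => hf l)
  refine ⟨hfin.subset h, (Set.ncard_le_ncard h hfin).trans ?_⟩
  refine (Finset.set_ncard_biUnion_le _ _).trans ?_
  have : ∀ l ∈ Finset.range (D + 1), {r : List (Fin D) | r.length = l}.ncard ≤ D ^ D := by
    intro l hl
    have : {r : List (Fin D) | r.length = l}.ncard = D ^ l := by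
      have := card_vector (α := Fin D) l
      rw [Fintype.card_fin] at this
      rw [← this, ← Nat.card_eq_fintype_card]
      rfl
    rw [this]
    exact Nat.pow_le_pow_right hD (by simp at hl; omega)
  refine (Finset.sum_le_card_nsmul _ _ _ this).trans (by simp)

/-! ### Strongly connected components -/

namespace Thread

variable {D Q : Type}

theorem edge_restrict_mono (P : Thread D Q) {A B : Set D} (h : A ⊆ B) {q q' : Q}
    (he : (P.restrict A).Edge q q') : (P.restrict B).Edge q q' := by
  obtain ⟨o, h1, h2⟩ := he
  exact ⟨o, h1, fun a ha => h (h2 a ha)⟩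

theorem reach_restrict_mono (P : Thread D Q) {A B : Set D} (h : A ⊆ B) {q q' : Q}
    (he : Relation.ReflTransGen (P.restrict A).Edge q q') :
    Relation.ReflTransGen (P.restrict B).Edge q q' :=
  Relation.ReflTransGen.mono (fun _ _ => P.edge_restrict_mono h) _ _ he

theorem mem_sccOf_self (P : Thread D Q) (q : Q) : q ∈ P.sccOf q := ⟨.refl, .refl⟩

theorem mem_sccOf_symm {P : Thread D Q} {q q' : Q} (h : q' ∈ P.sccOf q) : q ∈ P.sccOf q' :=
  ⟨h.2, h.1⟩

theorem mem_sccOf_trans {P : Thread D Q} {q q' q'' : Q} (h : q' ∈ P.sccOf q)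
    (h' : q'' ∈ P.sccOf q') : q'' ∈ P.sccOf q :=
  ⟨h.1.trans h'.1, h'.2.trans h.2⟩

theorem sccOf_eq_iff {P : Thread D Q} {q q' : Q} : P.sccOf q = P.sccOf q' ↔ q' ∈ P.sccOf q := by
  constructor
  · intro h
    rw [h]
    exact P.mem_sccOf_self q'
  · intro h
    ext x
    exact ⟨fun hx => mem_sccOf_trans (mem_sccOf_symm h) hx, fun hx => mem_sccOf_trans h hx⟩

theorem sccOf_restrict_mono (P : Thread D Q) {A B : Set D} (h : A ⊆ B) (q : Q) :
    (P.restrict A).sccOf q ⊆ (P.restrict B).sccOf q := fun _ hx =>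
  ⟨P.reach_restrict_mono h hx.1, P.reach_restrict_mono h hx.2⟩

theorem scc_finite [Finite Q] (P : Thread D Q) : P.scc.Finite := Set.finite_range _

/-- Allowing more reads merges components, so there are at most as many as without reads. -/
theorem ncard_scc_restrict_le [Finite Q] (P : Thread D Q) (A : Set D) :
    (P.restrict A).scc.ncard ≤ P.numSCC := by
  classical
  let g : Set Q → Set Q := fun S => if h : ∃ q, (P.restrict ∅).sccOf q = S then
    (P.restrict A).sccOf h.choose else ∅
  have hsub : (P.restrict A).scc ⊆ g '' (P.restrict ∅).scc := by
    rintro _ ⟨q, rfl⟩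
    refine ⟨(P.restrict ∅).sccOf q, ⟨q, rfl⟩, ?_⟩
    have h : ∃ q', (P.restrict ∅).sccOf q' = (P.restrict ∅).sccOf q := ⟨q, rfl⟩
    have h' := sccOf_eq_iff.1 h.choose_spec
    simp only [g, dif_pos h]
    exact sccOf_eq_iff.2 (P.sccOf_restrict_mono (Set.empty_subset A) _ h')
  exact (Set.ncard_le_ncard hsub ((scc_finite _).image _)).trans
    (Set.ncard_image_le (scc_finite _))

theorem numSCC_pos [Finite Q] (P : Thread D Q) : 1 ≤ P.numSCC :=
  (Set.ncard_pos (scc_finite _)).2 ⟨_, P.init, rfl⟩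

theorem level_zero (P : Thread D Q) (r : List D) : P.level r 0 = P.restrict ∅ := by
  simp [level]

/-! ### The number of candidates -/

theorem blockEntries_finite_and_ncard_le {D : ℕ} [Finite Q] (P : Thread (Fin D) Q)
    (A : Set (Fin D)) :
    ((P.restrict A).scc ×ˢ (Set.univ : Set (Option (Fin D)))).Finite ∧
    ((P.restrict A).scc ×ˢ (Set.univ : Set (Option (Fin D)))).ncard ≤ P.numSCC * (D + 1) := by
  refine ⟨(scc_finite _).prod Set.finite_univ, ?_⟩
  rw [Set.ncard_prod, Set.ncard_univ, Nat.card_eq_fintype_card, Fintype.card_option,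
    Fintype.card_fin]
  exact Nat.mul_le_mul_right _ (P.ncard_scc_restrict_le A)

/-- The blocks have at most `d - 1` entries, each of which is one of `s * (D + 1)` pairs. The remaining
factor `s * (D + 1)` pays for the last component, of which there are `s`, and for the length of the
word `r`. -/
theorem sccCandidates_finite_and_ncard_le {D : ℕ} [Finite Q] (P : Thread (Fin D) Q)
    (hD : 1 ≤ D) (hd : 1 ≤ P.straightLineDepth) :
    P.sccCandidates.Finite ∧ P.witSCC ≤ (P.numSCC * (D + 1)) ^ P.straightLineDepth * D ^ D *
        2 ^ (D + P.straightLineDepth) := by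
  classical
  obtain ⟨d, hd'⟩ : ∃ d, P.straightLineDepth = d + 1 := ⟨_, (Nat.sub_add_cancel hd).symm⟩
  set s := P.numSCC with hs
  have hs1 : 1 ≤ s := P.numSCC_pos
  have hb1 : 1 ≤ s * (D + 1) := Nat.mul_pos hs1 (by omega)
  obtain ⟨hw1, hw2⟩ := nodup_finite_and_ncard_le D hD
  let E : List (Fin D) → ℕ → Set (Set Q × Option (Fin D)) :=
    fun r i => (P.level r i).scc ×ˢ Set.univ
  let F : List (Fin D) → Set (List (Fin D) × List (List (Set Q × Option (Fin D))) × Set Q) :=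
    fun r => Prod.mk r '' (blockLists (E r) (r.length + 1) d ×ˢ (P.level r r.length).scc)
  have hF : ∀ r : List (Fin D), r.Nodup → (F r).Finite ∧
      (F r).ncard ≤ (s * (D + 1)) ^ d * 2 ^ (D + (d + 1)) * s := by
    intro r hr
    have hl := List.Nodup.length_le_card hr
    rw [Fintype.card_fin] at hl
    obtain ⟨h1, h2⟩ := blockLists_finite_and_ncard_le (s * (D + 1)) (r.length + 1) d (E r) hb1
      (fun i => (P.blockEntries_finite_and_ncard_le _).1)
      (fun i => (P.blockEntries_finite_and_ncard_le _).2)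
    have hp := h1.prod (scc_finite (P.level r r.length))
    refine ⟨hp.image _, (Set.ncard_image_le hp).trans ?_⟩
    rw [Set.ncard_prod]
    refine Nat.mul_le_mul (h2.trans (Nat.mul_le_mul_left _ ?_)) (P.ncard_scc_restrict_le _)
    exact Nat.pow_le_pow_right (by norm_num) (by omega)
  have hsub : P.sccCandidates ⊆ ⋃ r ∈ hw1.toFinset, F r := by
    rintro ⟨r, Bs, S⟩ ⟨h1, h2, h3, h4, h5⟩
    simp only [Set.mem_iUnion]
    refine ⟨r, by simpa using h1, (Bs, S), ⟨⟨h2, fun i B hB x hx => ⟨h3 i B hB x hx, trivial⟩,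
      ?_⟩, h5⟩, rfl⟩
    rw [hd'] at h4
    exact h4
  have hfin : (⋃ r ∈ hw1.toFinset, F r).Finite :=
    Set.Finite.biUnion (Finset.finite_toSet _) fun r hr => (hF r (by simpa using hr)).1
  refine ⟨hfin.subset hsub, (Set.ncard_le_ncard hsub hfin).trans ?_⟩
  refine (Finset.set_ncard_biUnion_le _ _).trans ?_
  refine (Finset.sum_le_card_nsmul _ _ _ fun r hr => (hF r (by simpa using hr)).2).trans ?_
  rw [smul_eq_mul, ← Set.ncard_eq_toFinset_card _ hw1, hd']
  refine (Nat.mul_le_mul_right _ hw2).trans (le_of_eq ?_)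
  rw [pow_succ (s * (D + 1)) d]
  ring

/-- The candidates over the empty word already number this geometric sum. -/
theorem geometric_sum_le_witSCC {D : ℕ} [Finite Q] (P : Thread (Fin D) Q)
    (hD : 1 ≤ D) (hd : 1 ≤ P.straightLineDepth) :
    P.numSCC * ∑ k ∈ Finset.range P.straightLineDepth, (P.numSCC * (D + 1)) ^ k ≤ P.witSCC := by
  obtain ⟨hfin, -⟩ := P.sccCandidates_finite_and_ncard_le hD hd
  set E : Set (Set Q × Option (Fin D)) := (P.restrict ∅).scc ×ˢ Set.univ
  have hE : E.Finite := (scc_finite _).prod Set.finite_univ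
  have hEc : E.ncard = P.numSCC * (D + 1) := by
    rw [Set.ncard_prod, Set.ncard_univ, Nat.card_eq_fintype_card, Fintype.card_option,
      Fintype.card_fin]
    rfl
  obtain ⟨h1, h2⟩ := ncard_lists_length_le E hE (P.straightLineDepth - 1)
  rw [Nat.sub_add_cancel hd, hEc] at h2
  have h3 : (fun p : List (Set Q × Option (Fin D)) × Set Q =>
      (([] : List (Fin D)), [p.1], p.2)) ''
      ({B | (∀ x ∈ B, x ∈ E) ∧ B.length ≤ P.straightLineDepth - 1} ×ˢ (P.restrict ∅).scc) ⊆
      P.sccCandidates := by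
    rintro _ ⟨⟨B, S⟩, ⟨⟨hB1, hB2⟩, hS⟩, rfl⟩
    refine ⟨List.nodup_nil, rfl, ?_, by simpa using hB2, by simpa [level] using hS⟩
    rintro (_ | i) B' hB' x hx
    · simp only [List.getElem?_cons_zero, Option.some.injEq] at hB'
      subst hB'
      rw [level_zero]
      exact (hB1 x hx).1
    · simp at hB'
  have h4 := Set.ncard_le_ncard h3 hfin
  rw [Set.ncard_image_of_injective _ (fun p p' hp => by
    simp only [Prod.mk.injEq, List.cons.injEq, and_true, true_and] at hp
    exact Prod.ext hp.1 hp.2), Set.ncard_prod, mul_comm] at h4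
  exact (Nat.mul_le_mul_left _ h2).trans h4

end Thread

/-! ### Paths in the graph of components and the straight line depth -/

namespace Thread

variable {D Q : Type}

theorem level_append (P : Thread D Q) (r : List D) (c : D) {i : ℕ} (hi : i ≤ r.length) :
    P.level (r ++ [c]) i = P.level r i := by
  simp [level, List.take_append_of_le_length hi]

theorem level_length (P : Thread D Q) (r : List D) :
    P.level r r.length = P.restrict {c | c ∈ r} := by
  simp [level]

/-- There is a path with `n` vertices in `G(P, r)` that ends in the component of `q` of the last
index. The last clause excludes that a component left before is entered again. -/
def PathTo (P : Thread D Q) (r : List D) (q : Q) (n : ℕ) : Prop :=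
  ∃ p : List (ℕ × Set Q), (∀ v ∈ p, v ∈ P.vertices r) ∧ p.Nodup ∧
    p.IsChain (P.GraphEdge r) ∧ p.length = n ∧
    p.getLast? = some (r.length, (P.restrict {c | c ∈ r}).sccOf q) ∧
    ∀ v ∈ p, v.1 = r.length → ∀ x ∈ v.2,
      Relation.ReflTransGen (P.restrict {c | c ∈ r}).Edge x q

theorem pathTo_nil (P : Thread D Q) (q : Q) : P.PathTo [] q 1 := by
  refine ⟨[(0, (P.restrict {c | c ∈ ([] : List D)}).sccOf q)], ?_, by simp, by simp, rfl, rfl, ?_⟩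
  · intro v hv
    simp only [List.mem_singleton] at hv
    subst hv
    exact ⟨by simp, by simp [level, scc]⟩
  · intro v hv _ x hx
    simp only [List.mem_singleton] at hv
    subst hv
    exact hx.2

/-- The path only depends on the component of its last state. -/
theorem PathTo.sameSCC {P : Thread D Q} {r : List D} {q q' : Q} {n : ℕ} (h : P.PathTo r q n)
    (hq : q' ∈ (P.restrict {c | c ∈ r}).sccOf q) : P.PathTo r q' n := by
  obtain ⟨p, h1, h2, h3, h4, h5, h6⟩ := h
  refine ⟨p, h1, h2, h3, h4, ?_, fun v hv hv1 x hx => (h6 v hv hv1 x hx).trans hq.1⟩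
  rw [h5, sccOf_eq_iff.2 hq]

/-- A transition into another component of the same index lengthens the path. The new component does not
occur on the path, as otherwise the component just left would be reachable from it. -/
theorem PathTo.edge {P : Thread D Q} {r : List D} {q q' : Q} {n : ℕ} (h : P.PathTo r q n)
    (he : (P.restrict {c | c ∈ r}).Edge q q')
    (hq : q' ∉ (P.restrict {c | c ∈ r}).sccOf q) : P.PathTo r q' (n + 1) := by
  obtain ⟨p, h1, h2, h3, h4, h5, h6⟩ := h
  have hnot : ¬ Relation.ReflTransGen (P.restrict {c | c ∈ r}).Edge q' q :=
    fun h => hq ⟨.single he, h⟩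
  refine ⟨p ++ [(r.length, (P.restrict {c | c ∈ r}).sccOf q')], ?_, ?_, ?_, by simp [h4],
    by simp, ?_⟩
  · intro v hv
    rcases List.mem_append.1 hv with hv | hv
    · exact h1 v hv
    · simp only [List.mem_singleton] at hv
      subst hv
      exact ⟨le_rfl, by simp [level, scc]⟩
  · rw [List.nodup_append]
    refine ⟨h2, by simp, ?_⟩
    rintro v hv w hw rfl
    simp only [List.mem_singleton] at hw
    subst hw
    exact hnot (h6 _ hv rfl q' (mem_sccOf_self _ _))
  · rw [List.isChain_append]
    refine ⟨h3, by simp, ?_⟩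
    intro x hx y hy
    rw [h5] at hx
    simp only [Option.mem_def, Option.some.injEq] at hx
    simp only [List.head?_cons, Option.mem_def, Option.some.injEq] at hy
    subst hx hy
    left
    refine ⟨rfl, fun h => hq (sccOf_eq_iff.1 h), q, mem_sccOf_self _ _, q', mem_sccOf_self _ _, ?_⟩
    rw [level_length]
    exact he
  · intro v hv hv1 x hx
    rcases List.mem_append.1 hv with hv | hv
    · exact (h6 v hv hv1 x hx).tail he
    · simp only [List.mem_singleton] at hv
      subst hv
      exact hx.2

/-- Reading a new value lengthens the path by a component of the next index. -/
theorem PathTo.read {P : Thread D Q} {r : List D} {q q' : Q} {c : D} {n : ℕ}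
    (h : P.PathTo r q n) (he : (q, some (Op.read c), q') ∈ P.trans) :
    P.PathTo (r ++ [c]) q' (n + 1) := by
  obtain ⟨p, h1, h2, h3, h4, h5, -⟩ := h
  have hlt : ∀ v ∈ p, v.1 ≤ r.length := fun v hv => (h1 v hv).1
  refine ⟨p ++ [((r ++ [c]).length, (P.restrict {a | a ∈ r ++ [c]}).sccOf q')], ?_, ?_, ?_,
    by simp [h4], by simp, ?_⟩
  · intro v hv
    rcases List.mem_append.1 hv with hv | hv
    · refine ⟨by have := hlt v hv; simp; omega, ?_⟩
      rw [level_append P r c (hlt v hv)]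
      exact (h1 v hv).2
    · simp only [List.mem_singleton] at hv
      subst hv
      refine ⟨le_rfl, ?_⟩
      rw [level_length]
      exact ⟨q', rfl⟩
  · rw [List.nodup_append]
    refine ⟨h2, by simp, ?_⟩
    rintro v hv w hw rfl
    simp only [List.mem_singleton] at hw
    have := hlt v hv
    simp [hw] at this
  · rw [List.isChain_append]
    refine ⟨h3.imp_of_mem_imp ?_, by simp, ?_⟩
    · intro v w hv hw hvw
      rcases hvw with ⟨a1, a2, a3⟩ | ⟨a1, x, hx, y, hy, b, hb, hbt⟩
      · left
        rw [level_append P r c (hlt v hv)]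
        exact ⟨a1, a2, a3⟩
      · right
        refine ⟨a1, x, hx, y, hy, b, ?_, hbt⟩
        have := hlt w hw
        rw [List.getElem?_append_left (by omega)]
        exact hb
    · intro x hx y hy
      rw [h5] at hx
      simp only [Option.mem_def, Option.some.injEq] at hx
      simp only [List.head?_cons, Option.mem_def, Option.some.injEq] at hy
      subst hx hy
      right
      exact ⟨by simp, q, mem_sccOf_self _ _, q', mem_sccOf_self _ _, c, by simp, he⟩
  · intro v hv hv1 x hx
    rcases List.mem_append.1 hv with hv | hv
    · have := hlt v hv
      simp [hv1] at this
    · simp only [List.mem_singleton] at hv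
      subst hv
      exact hx.2

/-- Following a run whose reads lie in `A` either lengthens the path or stays in the component. The
word is extended by the values that are read for the first time. -/
theorem PathTo.reach {P : Thread D Q} {A : Set D} {r : List D} {q q' : Q} {n : ℕ}
    (h : P.PathTo r q n) (hr : r.Nodup) (hrA : ∀ c ∈ r, c ∈ A)
    (he : Relation.ReflTransGen (P.restrict A).Edge q q') :
    ∃ (r' : List D) (n' : ℕ), r'.Nodup ∧ (∀ c ∈ r', c ∈ A) ∧ P.PathTo r' q' n' ∧
      (n < n' ∨ (n' = n ∧ r' = r ∧ q' ∈ (P.restrict {c | c ∈ r}).sccOf q)) := by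
  classical
  induction he with
  | refl => exact ⟨r, n, hr, hrA, h, Or.inr ⟨rfl, rfl, mem_sccOf_self _ _⟩⟩
  | @tail x y _ hxy ih =>
    obtain ⟨r', n', h1, h2, h3, h4⟩ := ih
    have hgt : n < n' + 1 := by rcases h4 with h4 | ⟨h4, -⟩ <;> omega
    obtain ⟨o, ho, hoA⟩ := hxy
    by_cases hc : ∃ c, o = some (Op.read c) ∧ c ∉ r'
    · obtain ⟨c, rfl, hcr⟩ := hc
      refine ⟨r' ++ [c], n' + 1, ?_, ?_, h3.read ho, Or.inl hgt⟩
      · rw [List.nodup_append]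
        refine ⟨h1, by simp, ?_⟩
        rintro a ha b hb rfl
        simp only [List.mem_singleton] at hb
        exact hcr (hb ▸ ha)
      · intro a ha
        rcases List.mem_append.1 ha with ha | ha
        · exact h2 a ha
        · simp only [List.mem_singleton] at ha
          subst ha
          exact hoA a rfl
    · push Not at hc
      have hedge : (P.restrict {c | c ∈ r'}).Edge x y := ⟨o, ho, fun a ha => hc a ha⟩
      by_cases hs : y ∈ (P.restrict {c | c ∈ r'}).sccOf x
      · refine ⟨r', n', h1, h2, h3.sameSCC hs, ?_⟩
        rcases h4 with h4 | ⟨h4, h5, h6⟩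
        · exact Or.inl h4
        · subst h5
          exact Or.inr ⟨h4, rfl, mem_sccOf_trans h6 hs⟩
      · exact ⟨r', n' + 1, h1, h2, h3.edge hedge hs, Or.inl hgt⟩

theorem length_le_depthOf [Finite Q] (P : Thread D Q) {r : List D} {p : List (ℕ × Set Q)}
    (h1 : ∀ v ∈ p, v ∈ P.vertices r) (h2 : p.Nodup) (h3 : p.IsChain (P.GraphEdge r)) :
    p.length ≤ P.depthOf r := by
  classical
  have hfin : (P.vertices r).Finite := by
    refine ((Set.finite_Iic r.length).prod (Set.finite_univ : (Set.univ : Set (Set Q)).Finite)).subset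
      fun v hv => ⟨hv.1, trivial⟩
  refine le_csSup ⟨hfin.toFinset.card, ?_⟩ ⟨p, h1, h2, h3, rfl⟩
  rintro _ ⟨p', h1', h2', -, rfl⟩
  rw [← List.toFinset_card_of_nodup h2']
  exact Finset.card_le_card fun v hv => by simpa using h1' v (by simpa using hv)

theorem depthOf_le_straightLineDepth [Finite D] (P : Thread D Q) {r : List D} (hr : r.Nodup) :
    P.depthOf r ≤ P.straightLineDepth := by
  have hfin : {r : List D | r.Nodup}.Finite := by
    have := Fintype.ofFinite D
    exact (List.finite_length_le D (Fintype.card D)).subset fun r hr => hr.length_le_card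
  refine le_csSup ?_ ⟨r, hr, rfl⟩
  refine ((hfin.image P.depthOf).subset ?_).bddAbove
  rintro _ ⟨r, hr, rfl⟩
  exact ⟨r, hr, rfl⟩

theorem PathTo.le_straightLineDepth [Finite D] [Finite Q] {P : Thread D Q} {r : List D} {q : Q}
    {n : ℕ} (h : P.PathTo r q n) (hr : r.Nodup) : n ≤ P.straightLineDepth := by
  obtain ⟨p, h1, h2, h3, rfl, -⟩ := h
  exact (P.length_le_depthOf h1 h2 h3).trans (P.depthOf_le_straightLineDepth hr)

theorem straightLineDepth_pos [Finite D] [Finite Q] (P : Thread D Q) :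
    1 ≤ P.straightLineDepth :=
  (P.pathTo_nil P.init).le_straightLineDepth List.nodup_nil

end Thread

/-! ### Search nodes -/

namespace Thread

variable {D Q : Type}

/-- The values that can be written from a state in `X`. -/
def writable (P : Thread D Q) (X : Set Q) : Set D :=
  {a | ∃ x ∈ X, ∃ x' : Q, (x, some (Op.write a), x') ∈ P.trans}

/-- The values written by transitions inside `T`. When `T` is a component of the leader, the leader
can write each of them arbitrarily often. -/
def loopWrites (P : Thread D Q) (T : Set Q) : Set D :=
  {a | ∃ p ∈ T, ∃ p' ∈ T, (p, some (Op.write a), p') ∈ P.trans}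

/-- An internal move or a read of a value in `B`. -/
def ReadStep (P : Thread D Q) (B : Set D) (x y : Q) : Prop :=
  (x, none, y) ∈ P.trans ∨ ∃ a ∈ B, (x, some (Op.read a), y) ∈ P.trans

/-- The states reachable from `X` by internal moves and reads of values in `B`. -/
def readClosure (P : Thread D Q) (B : Set D) (X : Set Q) : Set Q :=
  {y | ∃ x ∈ X, Relation.ReflTransGen (P.ReadStep B) x y}

theorem writable_mono (P : Thread D Q) {X Y : Set Q} (h : X ⊆ Y) :
    P.writable X ⊆ P.writable Y := fun _ ⟨x, hx, x', hx'⟩ => ⟨x, h hx, x', hx'⟩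

theorem loopWrites_mono (P : Thread D Q) {X Y : Set Q} (h : X ⊆ Y) :
    P.loopWrites X ⊆ P.loopWrites Y :=
  fun _ ⟨x, hx, x', hx', ht⟩ => ⟨x, h hx, x', h hx', ht⟩

theorem subset_readClosure (P : Thread D Q) (B : Set D) (X : Set Q) : X ⊆ P.readClosure B X :=
  fun x hx => ⟨x, hx, .refl⟩

theorem readClosure_subset {P : Thread D Q} {B : Set D} {X Y : Set Q} (h : X ⊆ Y)
    (hY : ∀ x ∈ Y, ∀ y, P.ReadStep B x y → y ∈ Y) : P.readClosure B X ⊆ Y := by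
  rintro y ⟨x, hx, hxy⟩
  induction hxy with
  | refl => exact h hx
  | tail _ hyz ih => exact hY _ ih _ hyz

theorem readStep_mem_readClosure {P : Thread D Q} {B : Set D} {X : Set Q} {x y : Q}
    (hx : x ∈ P.readClosure B X) (h : P.ReadStep B x y) : y ∈ P.readClosure B X := by
  obtain ⟨z, hz, hzx⟩ := hx
  exact ⟨z, hz, hzx.tail h⟩

end Thread

section Nodes

variable {D QL QC : Type} (PL : Thread D QL) (PC : Thread D QC)

/-- `Y` is closed under the moves of contributors while the leader stays in the component of `q`:
they may read what they can write themselves and what the leader can write in that component. -/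
def Saturated (q : QL) (Y : Set QC) : Prop :=
  ∀ x ∈ Y, ∀ (o : Option (Op D)) (x' : QC), (x, o, x') ∈ PC.trans →
    (∀ a : D, o = some (Op.read a) → a ∈ PC.writable Y ∨
      a ∈ PL.loopWrites ((PL.restrict (PC.writable Y)).sccOf q)) → x' ∈ Y

/-- The least saturated set containing `X`. -/
def saturation (q : QL) (X : Set QC) : Set QC :=
  ⋂₀ {Y | X ⊆ Y ∧ Saturated PL PC q Y}

theorem subset_saturation (q : QL) (X : Set QC) : X ⊆ saturation PL PC q X :=
  fun _ hx _ hY => hY.1 hx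

theorem saturated_saturation (q : QL) (X : Set QC) :
    Saturated PL PC q (saturation PL PC q X) := by
  intro x hx o x' ho hr Y hY
  have hsub : saturation PL PC q X ⊆ Y := fun z hz => hz Y hY
  refine hY.2 x (hx Y hY) o x' ho fun a ha => ?_
  rcases hr a ha with h | h
  · exact Or.inl (PC.writable_mono hsub h)
  · exact Or.inr (PL.loopWrites_mono (PL.sccOf_restrict_mono (PC.writable_mono hsub) q) h)

/-- A node of the search: the leader has just reached the component of `state`, possibly by writing
`value`, and every state in `contributors` was occupied before that by as many contributors as
desired. -/
structure SearchNode (D QL QC : Type) where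
  state : QL
  value : Option D
  contributors : Set QC

namespace SearchNode

/-- The contributor states that can be occupied while the leader stays in its component. While
`value` is in the memory, it can be read. -/
def reached (nd : SearchNode D QL QC) : Set QC :=
  saturation PL PC nd.state (PC.readClosure {a | nd.value = some a} nd.contributors)

/-- The values that contributors provide at a node. -/
def values (nd : SearchNode D QL QC) : Set D :=
  PC.writable (nd.reached PL PC)

/-- The component of the leader at a node, with respect to the values provided there. -/
def component (nd : SearchNode D QL QC) : Set QL :=
  (PL.restrict (nd.values PL PC)).sccOf nd.state

/-- The leader leaves its component: by a write which contributors may read once, or by any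
transition whose effect on the memory is ignored. The state that is entered is replaced by a
representative of its component without reads. -/
def Child (rep : QL → QL) (nd nd' : SearchNode D QL QC) : Prop :=
  ∃ p ∈ nd.component PL PC, ∃ p' ∉ nd.component PL PC, nd'.state = rep p' ∧
    nd'.contributors = nd.reached PL PC ∧
    ((∃ a, nd'.value = some a ∧ (p, some (Op.write a), p') ∈ PL.trans) ∨
      nd'.value = none ∧ (PL.restrict (nd.values PL PC)).Edge p p')

/-- The nodes at which the search starts. Before the first write the memory holds the initial value,
which is treated like a value just written by the leader. -/
def IsRoot (a₀ : D) (rep : QL → QL) (nd : SearchNode D QL QC) : Prop :=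
  ∃ p, Relation.ReflTransGen (PL.ReadStep {a₀}) PL.init p ∧ nd.state = rep p ∧
    nd.value = some a₀ ∧ nd.contributors = {PC.init}

/-- A node found by the search. -/
def Found (a₀ : D) (rep : QL → QL) (nd : SearchNode D QL QC) : Prop :=
  ∃ root, IsRoot PL PC a₀ rep root ∧ Relation.ReflTransGen (Child PL PC rep) root nd

end SearchNode

/-! ### Nodes are realized by runs -/

/-- For every `n` some run leads to a configuration with leader state `q`, a memory value in `M` and
at least `n` contributors in each state of `X`. -/
def Coverable (a₀ : D) (M : Set D) (q : QL) (X : Set QC) : Prop :=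
  ∀ n : ℕ, ∃ (t : ℕ) (c : Config D QL QC t),
    Relation.ReflTransGen (Step PL PC) ⟨PL.init, fun _ => PC.init, a₀⟩ c ∧ c.leader = q ∧
      c.memory ∈ M ∧ ∀ x ∈ X, ∃ s : Finset (Fin t), n ≤ s.card ∧ ∀ i ∈ s, c.contributor i = x

variable {PL PC} {a₀ : D} {M M' : Set D} {q q' : QL} {X Y : Set QC}

theorem coverable_init : Coverable PL PC a₀ {a₀} PL.init {PC.init} := fun n =>
  ⟨n, _, .refl, rfl, rfl, fun x hx => ⟨Finset.univ, by simp, fun _ _ => hx.symm⟩⟩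

theorem Coverable.mono (h : Coverable PL PC a₀ M q X) (hM : M ⊆ M') (hX : Y ⊆ X) :
    Coverable PL PC a₀ M' q Y := fun n =>
  let ⟨t, c, h1, h2, h3, h4⟩ := h n
  ⟨t, c, h1, h2, hM h3, fun x hx => h4 x (hX hx)⟩

theorem Coverable.leader (h : Coverable PL PC a₀ M q X) {o : Option (Op D)}
    (ho : (q, o, q') ∈ PL.trans) (hM : ∀ m ∈ M, ∃ b ∈ M', MemStep o m b) :
    Coverable PL PC a₀ M' q' X := by
  intro n
  obtain ⟨t, ⟨q₁, pc, m⟩, h1, rfl, h3, h4⟩ := h n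
  obtain ⟨b, hb, hs⟩ := hM m h3
  exact ⟨t, ⟨q', pc, b⟩, h1.tail (.leader _ _ _ _ _ _ ho hs), rfl, hb, h4⟩

/-- Contributors in the same state take the same transition, one after the other. -/
theorem reach_move_finset {t : ℕ} [DecidableEq (Fin t)] {c₀ : Config D QL QC t} {pc : Fin t → QC}
    {m b : D} {x x' : QC} {o : Option (Op D)}
    (ho : (x, o, x') ∈ PC.trans) (hm : MemStep o m b) (hb : MemStep o b b) (s : Finset (Fin t))
    (hx : ∀ i ∈ s, pc i = x) (h : Relation.ReflTransGen (Step PL PC) c₀ ⟨q, pc, m⟩) :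
    ∃ m', (s.Nonempty → m' = b) ∧ (s = ∅ → m' = m) ∧
      Relation.ReflTransGen (Step PL PC) c₀ ⟨q, fun i => if i ∈ s then x' else pc i, m'⟩ := by
  induction s using Finset.induction_on with
  | empty => exact ⟨m, by simp, by simp, by simpa using h⟩
  | insert i s hi ih =>
    obtain ⟨m', h1, h2, h3⟩ := ih fun j hj => hx j (Finset.mem_insert_of_mem hj)
    have hstep : MemStep o m' b := by
      rcases s.eq_empty_or_nonempty with hs | hs
      · rw [h2 hs]
        exact hm
      · rw [h1 hs]
        exact hb
    refine ⟨b, fun _ => rfl, fun h => absurd h (Finset.insert_ne_empty _ _), ?_⟩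
    have hpi : pc i = x := hx i (Finset.mem_insert_self _ _)
    have := h3.tail (.contributor q (fun i => if i ∈ s then x' else pc i) i x' o m' b
      (by simpa [hi, hpi] using ho) hstep)
    convert this using 2
    ext j
    by_cases hj : j = i
    · subst hj
      simp
    · simp [hj]

/-- Of `2 * (n + 1)` contributors in the state `x`, one half takes the transition and the other half
stays. -/
theorem Coverable.contributor (h : Coverable PL PC a₀ M q X) {x x' : QC} {o : Option (Op D)}
    (hx : x ∈ X) (ho : (x, o, x') ∈ PC.trans)
    (hM : ∀ m ∈ M, ∃ b ∈ M', MemStep o m b ∧ MemStep o b b) :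
    Coverable PL PC a₀ M' q (insert x' X) := by
  classical
  intro n
  obtain ⟨t, ⟨q₁, pc, m⟩, h1, rfl, h3, h4⟩ := h ((n + 1) + (n + 1))
  obtain ⟨b, hb, hs, hs'⟩ := hM m h3
  obtain ⟨s, hs1, hs2⟩ := h4 x hx
  obtain ⟨s', hs'1, hs'2⟩ := Finset.exists_subset_card_eq (show n + 1 ≤ s.card by omega)
  obtain ⟨m', hm', -, hr⟩ := reach_move_finset ho hs hs' s' (fun i hi => hs2 i (hs'1 hi)) h1
  have hm'' : m' = b := hm' (Finset.card_pos.1 (by omega))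
  subst hm''
  refine ⟨t, _, hr, rfl, hb, ?_⟩
  intro y hy
  rcases Set.mem_insert_iff.1 hy with rfl | hy
  · exact ⟨s', by omega, fun i hi => by simp [hi]⟩
  · obtain ⟨u, hu1, hu2⟩ := h4 y hy
    refine ⟨u \ s', ?_, fun i hi => ?_⟩
    · have := Finset.le_card_sdiff s' u
      omega
    · rw [Finset.mem_sdiff] at hi
      simpa [hi.2] using hu2 i hi.1

theorem Coverable.write (h : Coverable PL PC a₀ M q X) {a : D} (ha : a ∈ PC.writable X) :
    Coverable PL PC a₀ {a} q X := by
  obtain ⟨x, hx, x', hx'⟩ := ha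
  exact (h.contributor (M' := {a}) hx hx' fun m _ => ⟨a, rfl, .write _ _, .write _ _⟩).mono
    subset_rfl (Set.subset_insert _ _)

/-- Before the leader reads a value, a contributor writes it. -/
theorem Coverable.leaderReach (h : Coverable PL PC a₀ Set.univ q X)
    (hr : Relation.ReflTransGen (PL.restrict (PC.writable X)).Edge q q') :
    Coverable PL PC a₀ Set.univ q' X := by
  induction hr with
  | refl => exact h
  | tail _ hs ih =>
    obtain ⟨o, ho, hA⟩ := hs
    match o, ho, hA with
    | none, ho, _ => exact ih.leader ho fun m _ => ⟨m, trivial, .eps m⟩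
    | some (Op.write a), ho, _ => exact ih.leader ho fun m _ => ⟨a, trivial, .write m a⟩
    | some (Op.read a), ho, hA =>
      refine (ih.write (hA a rfl)).leader ho ?_
      rintro _ rfl
      exact ⟨_, trivial, .read _⟩

theorem exists_maximal_superset [Finite QC] (p : Set QC → Prop) (h : p X) :
    ∃ Y, X ⊆ Y ∧ p Y ∧ ∀ x, p (insert x Y) → x ∈ Y := by
  obtain ⟨Y, hXY, hY⟩ := (Set.toFinite {Y | p Y}).exists_le_maximal h
  exact ⟨Y, hXY, hY.1, fun x hx => hY.2 hx (Set.subset_insert x Y) (Set.mem_insert x Y)⟩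

theorem Coverable.readClosure [Finite QC] {B : Set D} (h : Coverable PL PC a₀ M q X)
    (hB : ∀ a ∈ B, ∀ m ∈ M, m = a) : Coverable PL PC a₀ M q (PC.readClosure B X) := by
  obtain ⟨Y, hXY, hY, hmax⟩ := exists_maximal_superset (Coverable PL PC a₀ M q) h
  refine hY.mono subset_rfl (Thread.readClosure_subset hXY fun x hx y hxy => hmax y ?_)
  rcases hxy with hxy | ⟨a, ha, hxy⟩
  · exact hY.contributor hx hxy fun m hm => ⟨m, hm, .eps m, .eps m⟩
  · refine hY.contributor hx hxy fun m hm => ⟨m, hm, ?_⟩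
    obtain rfl := hB a ha m hm
    exact ⟨.read m, .read m⟩

/-- A maximal coverable set is saturated: while the leader cycles through its component, it provides the
values written there. -/
theorem Coverable.saturation [Finite QC] (h : Coverable PL PC a₀ Set.univ q X) :
    Coverable PL PC a₀ Set.univ q (saturation PL PC q X) := by
  obtain ⟨Y, hXY, hY, hmax⟩ := exists_maximal_superset (Coverable PL PC a₀ Set.univ q) h
  refine hY.mono subset_rfl fun x hx => hx Y ⟨hXY, fun x hx o x' ho hr => hmax x' ?_⟩
  match o, ho, hr with
  | none, ho, _ => exact hY.contributor hx ho fun m _ => ⟨m, trivial, .eps m, .eps m⟩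
  | some (Op.write a), ho, _ =>
    exact hY.contributor hx ho fun m _ => ⟨a, trivial, .write m a, .write a a⟩
  | some (Op.read a), ho, hr =>
    have hread : ∀ m ∈ ({a} : Set D), ∃ b ∈ (Set.univ : Set D),
        MemStep (some (Op.read a)) m b ∧ MemStep (some (Op.read a)) b b := by
      rintro _ rfl
      exact ⟨_, trivial, .read _, .read _⟩
    rcases hr a rfl with ha | ⟨p, hp, p', hp', ht⟩
    · exact (hY.write ha).contributor hx ho hread
    · -- the leader runs to the write of `a` and, after it has been read, back to `q`
      have h1 : Coverable PL PC a₀ {a} p' Y :=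
        (hY.leaderReach hp.1).leader ht fun m _ => ⟨a, rfl, .write m a⟩
      exact (h1.contributor hx ho hread).leaderReach
        (PL.reach_restrict_mono (PC.writable_mono (Set.subset_insert _ _)) hp'.2)

/-- Everything that the search claims about a node is realized by runs. -/
theorem SearchNode.Found.coverable [Finite QC] {rep : QL → QL}
    (hrep : ∀ p, rep p ∈ (PL.restrict ∅).sccOf p) {nd : SearchNode D QL QC}
    (h : nd.Found PL PC a₀ rep) :
    Coverable PL PC a₀ Set.univ nd.state (nd.reached PL PC) := by
  -- moving to the representative may overwrite the memory, so the value is read before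
  have key : ∀ (nd : SearchNode D QL QC) (p : QL) (M : Set D), nd.state = rep p →
      Coverable PL PC a₀ M p nd.contributors → (∀ a, nd.value = some a → ∀ m ∈ M, m = a) →
      Coverable PL PC a₀ Set.univ nd.state (nd.reached PL PC) := by
    intro nd p M hp hc hv
    have h1 := (hc.readClosure (B := {a | nd.value = some a}) hv).mono (Set.subset_univ M)
      subset_rfl
    rw [SearchNode.reached, hp]
    exact (h1.leaderReach (PL.reach_restrict_mono (Set.empty_subset _) (hrep p).1)).saturation
  obtain ⟨root, ⟨p, hp, hs, hv, hX⟩, hreach⟩ := h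
  induction hreach with
  | refl =>
    refine key root p {a₀} hs ?_ ?_
    · rw [hX]
      clear hs
      induction hp with
      | refl => exact coverable_init
      | tail _ hst ih =>
        rcases hst with hst | ⟨a, rfl, hst⟩
        · exact ih.leader hst fun m hm => ⟨m, hm, .eps m⟩
        · refine ih.leader hst ?_
          rintro _ rfl
          exact ⟨_, rfl, .read _⟩
    · rintro a ha m rfl
      simpa [hv] using ha
  | tail _ hch ih =>
    obtain ⟨p, hp, p', -, hs', hX', ht⟩ := hch
    have h1 := ih.leaderReach hp.1
    rcases ht with ⟨a, ha, ht⟩ | ⟨ha, ht⟩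
    · refine key _ p' {a} hs' ?_ ?_
      · rw [hX']
        exact h1.leader ht fun m _ => ⟨a, rfl, .write m a⟩
      · rintro b hb m rfl
        simpa [ha] using hb
    · refine key _ p' Set.univ hs' ?_ (by simp [ha])
      rw [hX']
      exact h1.leaderReach (.single ht)

/-! ### Runs are covered by nodes -/

/-- The leader is in the component of the found node `nd` and the contributors are in states which
are reached there. -/
def AtNode (PL : Thread D QL) (PC : Thread D QC) (a₀ : D) (rep : QL → QL)
    (nd : SearchNode D QL QC) (q : QL) {t : ℕ} (pc : Fin t → QC) : Prop :=
  nd.Found PL PC a₀ rep ∧ q ∈ nd.component PL PC ∧ ∀ i, pc i ∈ nd.reached PL PC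

variable {rep : QL → QL} {nd : SearchNode D QL QC} {t : ℕ} {pc : Fin t → QC}

/-- A transition that reads at most a value provided by contributors stays at the node or leads to a child
without value. -/
theorem AtNode.edge (hrep : ∀ p, rep p ∈ (PL.restrict ∅).sccOf p)
    (h : AtNode PL PC a₀ rep nd q pc) (he : (PL.restrict (nd.values PL PC)).Edge q q') :
    ∃ nd', AtNode PL PC a₀ rep nd' q' pc ∧ nd.values PL PC ⊆ nd'.values PL PC := by
  by_cases hq : q' ∈ nd.component PL PC
  · exact ⟨nd, ⟨h.1, hq, h.2.2⟩, subset_rfl⟩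
  · obtain ⟨⟨root, h1, h2⟩, h3, h4⟩ := h
    let nd' : SearchNode D QL QC := ⟨rep q', none, nd.reached PL PC⟩
    have hsub : nd.reached PL PC ⊆ nd'.reached PL PC :=
      (PC.subset_readClosure _ _).trans (subset_saturation PL PC _ _)
    refine ⟨nd', ⟨⟨root, h1, h2.tail ⟨q, h3, q', hq, rfl, rfl, Or.inr ⟨rfl, he⟩⟩⟩, ?_,
      fun i => hsub (h4 i)⟩, PC.writable_mono hsub⟩
    exact PL.sccOf_restrict_mono (Set.empty_subset _) _ (Thread.mem_sccOf_symm (hrep q'))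

/-- A write of the leader, together with reads of the written value by contributors. Inside the component
such reads belong to the saturation, otherwise they are performed at a child. -/
theorem AtNode.write {q₁ : QL} {m : D} (hrep : ∀ p, rep p ∈ (PL.restrict ∅).sccOf p)
    (hF : nd.Found PL PC a₀ rep) (hq : q ∈ nd.component PL PC)
    (ht : (q, some (Op.write m), q₁) ∈ PL.trans)
    (hpc : ∀ i, pc i ∈ PC.readClosure {m} (nd.reached PL PC)) :
    ∃ nd', AtNode PL PC a₀ rep nd' q₁ pc := by
  by_cases hq₁ : q₁ ∈ nd.component PL PC
  · refine ⟨nd, hF, hq₁, fun i => Thread.readClosure_subset subset_rfl ?_ (hpc i)⟩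
    intro x hx y hxy
    rcases hxy with hxy | ⟨a, rfl, hxy⟩
    · exact saturated_saturation PL PC _ _ x hx _ _ hxy (by simp)
    · refine saturated_saturation PL PC _ _ x hx _ _ hxy fun b hb => Or.inr ?_
      simp only [Option.some.injEq, Op.read.injEq] at hb
      subst hb
      exact ⟨q, hq, q₁, hq₁, ht⟩
  · obtain ⟨root, h1, h2⟩ := hF
    let nd' : SearchNode D QL QC := ⟨rep q₁, some m, nd.reached PL PC⟩
    refine ⟨nd', ⟨root, h1, h2.tail ⟨q, hq, q₁, hq₁, rfl, rfl, Or.inl ⟨m, rfl, ht⟩⟩⟩, ?_, ?_⟩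
    · exact PL.sccOf_restrict_mono (Set.empty_subset _) _ (Thread.mem_sccOf_symm (hrep q₁))
    · intro i
      refine subset_saturation PL PC _ _ ?_
      have : {a | (some m : Option D) = some a} = {m} := by
        ext a
        simp [eq_comm]
      simpa [nd', this] using hpc i

theorem AtNode.epsReach (hrep : ∀ p, rep p ∈ (PL.restrict ∅).sccOf p)
    (h : ∃ nd, AtNode PL PC a₀ rep nd q pc) (he : PL.EpsReach q q') :
    ∃ nd, AtNode PL PC a₀ rep nd q' pc := by
  induction he with
  | refl => exact h
  | tail _ hs ih =>
    obtain ⟨nd, hnd⟩ := ih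
    obtain ⟨nd', h', -⟩ := hnd.edge hrep ⟨none, hs, by simp⟩
    exact ⟨nd', h'⟩

/-- The invariant of runs. Either a contributor can provide the value in the memory, or the leader
wrote it last, or it is still the initial value. In the second case the node describes the situation
before that write, which may still turn out to be the one of a crossing between components. -/
def Covered (PL : Thread D QL) (PC : Thread D QC) (a₀ : D) (rep : QL → QL) {t : ℕ}
    (c : Config D QL QC t) : Prop :=
  (∃ nd, AtNode PL PC a₀ rep nd c.leader c.contributor ∧ c.memory ∈ nd.values PL PC) ∨
  (∃ (nd : SearchNode D QL QC) (p q₁ : QL), nd.Found PL PC a₀ rep ∧ p ∈ nd.component PL PC ∧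
    (p, some (Op.write c.memory), q₁) ∈ PL.trans ∧ PL.EpsReach q₁ c.leader ∧
    ∀ i, c.contributor i ∈ PC.readClosure {c.memory} (nd.reached PL PC)) ∨
  (c.memory = a₀ ∧ Relation.ReflTransGen (PL.ReadStep {a₀}) PL.init c.leader ∧
    ∀ i, c.contributor i ∈ PC.readClosure {a₀} {PC.init})

theorem Covered.exists_atNode (hrep : ∀ p, rep p ∈ (PL.restrict ∅).sccOf p)
    {c : Config D QL QC t} (h : Covered PL PC a₀ rep c) :
    ∃ nd, AtNode PL PC a₀ rep nd c.leader c.contributor := by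
  rcases h with ⟨nd, h, -⟩ | ⟨nd, p, q₁, h1, h2, h3, h4, h5⟩ | ⟨-, h2, h3⟩
  · exact ⟨nd, h⟩
  · exact AtNode.epsReach hrep (AtNode.write hrep h1 h2 h3 h5) h4
  · refine ⟨⟨rep c.leader, some a₀, {PC.init}⟩, ⟨_, ⟨_, h2, rfl, rfl, rfl⟩, .refl⟩, ?_, ?_⟩
    · exact PL.sccOf_restrict_mono (Set.empty_subset _) _ (Thread.mem_sccOf_symm (hrep _))
    · intro i
      refine subset_saturation PL PC _ _ ?_
      have : {a | (some a₀ : Option D) = some a} = {a₀} := by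
        ext a
        simp [eq_comm]
      simpa [this] using h3 i

/-- The invariant is kept. When the leader reads the value that it wrote last, the assumption on own reads
replaces the read by internal moves, so the case of a pending write persists. -/
theorem Covered.step (hrep : ∀ p, rep p ∈ (PL.restrict ∅).sccOf p)
    (hown : PL.OwnReadsReplaceable) {c c' : Config D QL QC t} (h : Covered PL PC a₀ rep c)
    (hs : Step PL PC c c') : Covered PL PC a₀ rep c' := by
  cases hs with
  | leader q q' pc o a b ho hm =>
    cases hm with
    | eps =>
      rcases h with ⟨nd, h, hv⟩ | ⟨nd, p, q₁, h1, h2, h3, h4, h5⟩ | ⟨h1, h2, h3⟩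
      · obtain ⟨nd', h', hsub⟩ := h.edge hrep ⟨none, ho, by simp⟩
        exact Or.inl ⟨nd', h', hsub hv⟩
      · exact Or.inr (Or.inl ⟨nd, p, q₁, h1, h2, h3, h4.tail ho, h5⟩)
      · exact Or.inr (Or.inr ⟨h1, h2.tail (Or.inl ho), h3⟩)
    | read =>
      rcases h with ⟨nd, h, hv⟩ | ⟨nd, p, q₁, h1, h2, h3, h4, h5⟩ | ⟨h1, h2, h3⟩
      · obtain ⟨nd', h', hsub⟩ := h.edge hrep ⟨_, ho, fun a ha => by
          simp only [Option.some.injEq, Op.read.injEq] at ha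
          exact ha ▸ hv⟩
        exact Or.inl ⟨nd', h', hsub hv⟩
      · obtain ⟨q₁', h6, h7⟩ := hown _ _ _ _ _ h3 h4 ho
        exact Or.inr (Or.inl ⟨nd, p, q₁', h1, h2, h6, h7, h5⟩)
      · exact Or.inr (Or.inr ⟨h1, h2.tail (Or.inr ⟨_, h1, ho⟩), h3⟩)
    | write =>
      obtain ⟨nd, h1, h2, h3⟩ := h.exists_atNode hrep
      exact Or.inr (Or.inl ⟨nd, q, q', h1, h2, ho, .refl, fun i =>
        PC.subset_readClosure _ _ (h3 i)⟩)
  | contributor q pc i x o a b ho hm =>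
    have hupd : ∀ S : Set QC, (∀ j, pc j ∈ S) → x ∈ S → ∀ j, Function.update pc i x j ∈ S := by
      intro S hS hx j
      rcases eq_or_ne j i with rfl | hj
      · simpa using hx
      · simpa [hj] using hS j
    cases hm with
    | eps =>
      rcases h with ⟨nd, h, hv⟩ | ⟨nd, p, q₁, h1, h2, h3, h4, h5⟩ | ⟨h1, h2, h3⟩
      · exact Or.inl ⟨nd, ⟨h.1, h.2.1, hupd _ h.2.2
          (saturated_saturation PL PC _ _ _ (h.2.2 i) _ _ ho (by simp))⟩, hv⟩
      · exact Or.inr (Or.inl ⟨nd, p, q₁, h1, h2, h3, h4, hupd _ h5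
          (Thread.readStep_mem_readClosure (h5 i) (Or.inl ho))⟩)
      · exact Or.inr (Or.inr ⟨h1, h2, hupd _ h3
          (Thread.readStep_mem_readClosure (h3 i) (Or.inl ho))⟩)
    | read =>
      rcases h with ⟨nd, h, hv⟩ | ⟨nd, p, q₁, h1, h2, h3, h4, h5⟩ | ⟨h1, h2, h3⟩
      · refine Or.inl ⟨nd, ⟨h.1, h.2.1, hupd _ h.2.2
          (saturated_saturation PL PC _ _ _ (h.2.2 i) _ _ ho fun b hb => Or.inl ?_)⟩, hv⟩
        simp only [Option.some.injEq, Op.read.injEq] at hb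
        exact hb ▸ hv
      · exact Or.inr (Or.inl ⟨nd, p, q₁, h1, h2, h3, h4, hupd _ h5
          (Thread.readStep_mem_readClosure (h5 i) (Or.inr ⟨_, rfl, ho⟩))⟩)
      · exact Or.inr (Or.inr ⟨h1, h2, hupd _ h3
          (Thread.readStep_mem_readClosure (h3 i) (Or.inr ⟨_, h1, ho⟩))⟩)
    | write =>
      obtain ⟨nd, h1, h2, h3⟩ := h.exists_atNode hrep
      exact Or.inl ⟨nd, ⟨h1, h2, hupd _ h3
        (saturated_saturation PL PC _ _ _ (h3 i) _ _ ho (by simp))⟩, _, h3 i, _, ho⟩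

end Nodes

/-- The search is correct: it suffices to inspect the components of the found nodes. -/
theorem LCRInstance.reachable_iff {L C D : ℕ} (I : LCRInstance L C D)
    (hown : I.leader.OwnReadsReplaceable) {rep : Fin L → Fin L}
    (hrep : ∀ p, rep p ∈ (I.leader.restrict ∅).sccOf p) :
    I.Reachable ↔ ∃ nd : SearchNode (Fin D) (Fin L) (Fin C),
      nd.Found I.leader I.contributor I.initValue rep ∧
        ∃ p ∈ nd.component I.leader I.contributor, p ∈ I.bad := by
  constructor
  · rintro ⟨t, c, hc, hb⟩
    have h : Covered I.leader I.contributor I.initValue rep c := by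
      clear hb
      induction hc with
      | refl => exact Or.inr (Or.inr ⟨rfl, .refl, fun _ => Thread.subset_readClosure _ _ _ rfl⟩)
      | tail _ hs ih => exact ih.step hrep hown hs
    obtain ⟨nd, h1, h2, -⟩ := h.exists_atNode hrep
    exact ⟨nd, h1, _, h2, hb⟩
  · rintro ⟨nd, h, p, hp, hb⟩
    obtain ⟨t, c, h1, h2, -⟩ := (h.coverable hrep).leaderReach hp.1 0
    exact ⟨t, c, h1, h2 ▸ hb⟩

/-! ### The size of the search -/

section Size

variable {D L : ℕ} {QC : Type} {PL : Thread (Fin D) (Fin L)} {PC : Thread (Fin D) QC}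
  {a₀ : Fin D} {rep : Fin L → Fin L}

namespace SearchNode

/-- A path with `n` vertices leads to the state of the node and reads only values provided there. -/
def HasPath (PL : Thread (Fin D) (Fin L)) (PC : Thread (Fin D) QC)
    (nd : SearchNode (Fin D) (Fin L) QC) (n : ℕ) : Prop :=
  ∃ r : List (Fin D), r.Nodup ∧ (∀ c ∈ r, c ∈ nd.values PL PC) ∧ PL.PathTo r nd.state n

/-- The length by which the longest path to the node can at most be extended. -/
noncomputable def rank (PL : Thread (Fin D) (Fin L)) (PC : Thread (Fin D) QC)
    (nd : SearchNode (Fin D) (Fin L) QC) : ℕ :=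
  PL.straightLineDepth - sSup {n | nd.HasPath PL PC n}

theorem hasPath_one (nd : SearchNode (Fin D) (Fin L) QC) : nd.HasPath PL PC 1 :=
  ⟨[], List.nodup_nil, by simp, PL.pathTo_nil _⟩

theorem HasPath.le {nd : SearchNode (Fin D) (Fin L) QC} {n : ℕ} (h : nd.HasPath PL PC n) :
    n ≤ PL.straightLineDepth := by
  obtain ⟨r, hr, -, hp⟩ := h
  exact hp.le_straightLineDepth hr

theorem bddAbove_hasPath (nd : SearchNode (Fin D) (Fin L) QC) :
    BddAbove {n | nd.HasPath PL PC n} :=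
  ⟨_, fun _ hn => HasPath.le hn⟩

theorem rank_lt_straightLineDepth (nd : SearchNode (Fin D) (Fin L) QC) :
    nd.rank PL PC < PL.straightLineDepth := by
  have := le_csSup (bddAbove_hasPath (PL := PL) (PC := PC) nd) nd.hasPath_one
  have := PL.straightLineDepth_pos
  unfold rank
  omega

/-- A crossing leaves a component for good, also in the graph `G(P, r)`, where `r` lists the values
in the order in which a run through the nodes reads them first. -/
theorem Child.hasPath (hrep : ∀ p, rep p ∈ (PL.restrict ∅).sccOf p)
    {nd nd' : SearchNode (Fin D) (Fin L) QC} (h : nd.Child PL PC rep nd') {n : ℕ}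
    (hn : nd.HasPath PL PC n) : ∃ n' > n, nd'.HasPath PL PC n' := by
  obtain ⟨r, hr, hrA, hp⟩ := hn
  obtain ⟨p, hpT, p', hp'T, hs, hX, ht⟩ := h
  have hedge : (PL.restrict (nd.values PL PC)).Edge p p' := by
    rcases ht with ⟨a, -, ht⟩ | ⟨-, ht⟩
    · exact ⟨_, ht, by simp⟩
    · exact ht
  have hsub : nd.values PL PC ⊆ nd'.values PL PC := PC.writable_mono <|
    hX ▸ (PC.subset_readClosure _ _).trans (subset_saturation PL PC _ _)
  have hscc := PL.sccOf_restrict_mono (Set.empty_subset (nd.values PL PC)) _ (hrep p')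
  obtain ⟨r', n', h1, h2, h3, h4⟩ := hp.reach hr hrA ((hpT.1.tail hedge).trans hscc.1)
  rw [← hs] at h3 h4 hscc
  refine ⟨n', ?_, r', h1, fun c hc => hsub (h2 c hc), h3⟩
  rcases h4 with h4 | ⟨-, -, h4⟩
  · exact h4
  · exact absurd (Thread.mem_sccOf_trans (PL.sccOf_restrict_mono hrA _ h4)
      (Thread.mem_sccOf_symm hscc)) hp'T

/-- The rank of the nodes decreases from parent to child. -/
theorem Child.rank_lt (hrep : ∀ p, rep p ∈ (PL.restrict ∅).sccOf p)
    {nd nd' : SearchNode (Fin D) (Fin L) QC} (h : nd.Child PL PC rep nd') :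
    nd'.rank PL PC < nd.rank PL PC := by
  have hmem := Nat.sSup_mem ⟨1, nd.hasPath_one (PL := PL) (PC := PC)⟩ (bddAbove_hasPath nd)
  obtain ⟨n', h1, h2⟩ := h.hasPath hrep hmem
  have h3 := le_csSup (bddAbove_hasPath (PL := PL) (PC := PC) nd') h2
  have h4 := h2.le
  unfold rank
  omega

/-- A bound for the number of nodes below `nd`, where every node has at most `b` children. -/
noncomputable def weight (PL : Thread (Fin D) (Fin L)) (PC : Thread (Fin D) QC) (b : ℕ)
    (nd : SearchNode (Fin D) (Fin L) QC) : ℕ :=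
  ∑ k ∈ Finset.range (nd.rank PL PC + 1), b ^ k

/-- Nodes that are determined by state and value can be counted by these. -/
theorem length_le_of_nodup {l : List (SearchNode (Fin D) (Fin L) QC)} (hl : l.Nodup) {b : ℕ}
    (f : SearchNode (Fin D) (Fin L) QC → Fin L × Option (Fin D)) (hf : ∀ x ∈ l, ∀ y ∈ l,
      f x = f y → x = y) (S : Set (Fin L × Option (Fin D))) (hS : ∀ x ∈ l, f x ∈ S)
    (hb : S.ncard ≤ b) : l.length ≤ b := by
  classical
  refine le_trans ?_ hb
  have h1 : (l.map f).Nodup := hl.map_on hf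
  rw [← List.length_map (f := f), ← List.toFinset_card_of_nodup h1, ← Set.ncard_coe_finset]
  refine Set.ncard_le_ncard ?_ (Set.toFinite _)
  intro y hy
  simp only [List.coe_toFinset, List.mem_map, Set.mem_ofPred_eq] at hy
  obtain ⟨x, hx, rfl⟩ := hy
  exact hS x hx

theorem ncard_range_rep_le (hrep' : ∀ p, ∀ p' ∈ (PL.restrict ∅).sccOf p, rep p' = rep p) :
    (Set.range rep).ncard ≤ PL.numSCC := by
  classical
  have h : Set.range rep ⊆ (fun S : Set (Fin L) => if h : S.Nonempty then rep h.some else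
      PL.init) '' (PL.restrict ∅).scc := by
    rintro _ ⟨p, rfl⟩
    have hne : ((PL.restrict ∅).sccOf p).Nonempty := ⟨p, Thread.mem_sccOf_self _ _⟩
    refine ⟨_, ⟨p, rfl⟩, ?_⟩
    simp only [dif_pos hne]
    exact hrep' p _ hne.some_mem
  exact (Set.ncard_le_ncard h (Set.toFinite _)).trans (Set.ncard_image_le (Set.toFinite _))

/-- The children of a node are determined by a representative and by a value or its absence, and they
have a smaller rank; so the weights of the children and the node itself fit into its weight. -/
theorem weight_children (hrep : ∀ p, rep p ∈ (PL.restrict ∅).sccOf p)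
    (hrep' : ∀ p, ∀ p' ∈ (PL.restrict ∅).sccOf p, rep p' = rep p)
    {nd : SearchNode (Fin D) (Fin L) QC} {l : List (SearchNode (Fin D) (Fin L) QC)}
    (hl : l.Nodup) (hc : ∀ nd' ∈ l, nd.Child PL PC rep nd') :
    (l.map (weight PL PC (PL.numSCC * (D + 1)))).sum + 1 ≤
      nd.weight PL PC (PL.numSCC * (D + 1)) := by
  set b := PL.numSCC * (D + 1)
  have hlen : l.length ≤ b := by
    refine length_le_of_nodup hl (fun x => (x.state, x.value)) ?_
      (Set.range rep ×ˢ Set.univ) ?_ ?_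
    · intro x hx y hy hxy
      obtain ⟨-, -, -, -, -, hX, -⟩ := hc x hx
      obtain ⟨-, -, -, -, -, hY, -⟩ := hc y hy
      cases x
      cases y
      simp_all
    · intro x hx
      obtain ⟨-, -, p', -, hs, -⟩ := hc x hx
      exact ⟨⟨p', hs.symm⟩, trivial⟩
    · rw [Set.ncard_prod, Set.ncard_univ, Nat.card_eq_fintype_card, Fintype.card_option,
        Fintype.card_fin]
      exact Nat.mul_le_mul_right _ (ncard_range_rep_le hrep')
  have hsum : ∀ nd' ∈ l, nd'.weight PL PC b ≤ ∑ k ∈ Finset.range (nd.rank PL PC), b ^ k := by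
    intro nd' hnd'
    refine Finset.sum_le_sum_of_subset (Finset.range_mono ?_)
    exact (hc nd' hnd').rank_lt hrep
  have h1 := List.sum_le_card_nsmul (l.map (weight PL PC b)) _ (by simpa using hsum)
  rw [List.length_map, smul_eq_mul] at h1
  have h2 := h1.trans (Nat.mul_le_mul_right _ hlen)
  unfold weight at h2 ⊢
  rw [Finset.sum_range_succ']
  simp only [pow_zero, pow_succ]
  rw [← Finset.sum_mul, mul_comm _ b]
  omega

/-- The weights of the roots are bounded by the number of candidates over the empty word. -/
theorem weight_roots (hD : 1 ≤ D)
    (hrep' : ∀ p, ∀ p' ∈ (PL.restrict ∅).sccOf p, rep p' = rep p)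
    {l : List (SearchNode (Fin D) (Fin L) QC)}
    (hl : l.Nodup) (hc : ∀ nd ∈ l, nd.IsRoot PL PC a₀ rep) :
    (l.map (weight PL PC (PL.numSCC * (D + 1)))).sum ≤ PL.witSCC := by
  set b := PL.numSCC * (D + 1)
  have hlen : l.length ≤ PL.numSCC := by
    refine length_le_of_nodup hl (fun x => (x.state, x.value)) ?_
      (Set.range rep ×ˢ {some a₀}) ?_ ?_
    · intro x hx y hy hxy
      obtain ⟨-, -, -, -, hX⟩ := hc x hx
      obtain ⟨-, -, -, -, hY⟩ := hc y hy
      cases x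
      cases y
      simp_all
    · intro x hx
      obtain ⟨p, -, hs, hv, -⟩ := hc x hx
      exact ⟨⟨p, hs.symm⟩, hv⟩
    · rw [Set.ncard_prod, Set.ncard_singleton, mul_one]
      exact ncard_range_rep_le hrep'
  have hsum : ∀ nd ∈ l, nd.weight PL PC b ≤ ∑ k ∈ Finset.range PL.straightLineDepth, b ^ k := by
    intro nd _
    refine Finset.sum_le_sum_of_subset (Finset.range_mono ?_)
    exact nd.rank_lt_straightLineDepth
  have h1 := List.sum_le_card_nsmul (l.map (weight PL PC b)) _ (by simpa using hsum)
  rw [List.length_map, smul_eq_mul] at h1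
  exact (h1.trans (Nat.mul_le_mul_right _ hlen)).trans
    (PL.geometric_sum_le_witSCC hD PL.straightLineDepth_pos)

end SearchNode

end Size

/-! ### Reasoning about programs -/

namespace RAM

/-- The registers that a program may change. -/
def Prog.regs : Prog → List ℕ
  | .const x _ => [x]
  | .add x _ _ => [x]
  | .sub x _ _ => [x]
  | .load x _ _ => [x]
  | .store _ _ _ => []
  | .seq p p' => p.regs ++ p'.regs
  | .cond _ p p' => p.regs ++ p'.regs
  | .loop _ p => p.regs

/-- The arrays that a program may change. -/
def Prog.arrs : Prog → List ℕ
  | .store k _ _ => [k]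
  | .seq p p' => p.arrs ++ p'.arrs
  | .cond _ p p' => p.arrs ++ p'.arrs
  | .loop _ p => p.arrs
  | _ => []

/-- `τ` differs from `σ` only in registers and arrays that `p` may change. -/
structure Frame (p : Prog) (σ τ : State) : Prop where
  reg : ∀ x : ℕ, x ∉ p.regs → τ.reg x = σ.reg x
  arr : ∀ k : ℕ, k ∉ p.arrs → τ.arr k = σ.arr k

theorem Frame.refl (p : Prog) (σ : State) : Frame p σ σ := ⟨fun _ _ => rfl, fun _ _ => rfl⟩

theorem Frame.trans {p p₁ p₂ : Prog} {σ τ υ : State} (h₁ : Frame p₁ σ τ) (h₂ : Frame p₂ τ υ)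
    (hr₁ : p₁.regs ⊆ p.regs) (hr₂ : p₂.regs ⊆ p.regs) (ha₁ : p₁.arrs ⊆ p.arrs)
    (ha₂ : p₂.arrs ⊆ p.arrs) : Frame p σ υ :=
  ⟨fun x hx => (h₂.reg x fun h => hx (hr₂ h)).trans (h₁.reg x fun h => hx (hr₁ h)),
    fun k hk => (h₂.arr k fun h => hk (ha₂ h)).trans (h₁.arr k fun h => hk (ha₁ h))⟩

/-- What a program does not mention as a target remains unchanged. -/
theorem Run.frame {p : Prog} {σ τ : State} {t : ℕ} (h : Run p σ τ t) : Frame p σ τ := by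
  induction h with
  | const σ x n => exact ⟨fun y hy => by simp_all [State.setReg, Prog.regs], fun _ _ => rfl⟩
  | add σ x y z => exact ⟨fun y hy => by simp_all [State.setReg, Prog.regs], fun _ _ => rfl⟩
  | sub σ x y z => exact ⟨fun y hy => by simp_all [State.setReg, Prog.regs], fun _ _ => rfl⟩
  | load σ x k y => exact ⟨fun y hy => by simp_all [State.setReg, Prog.regs], fun _ _ => rfl⟩
  | store σ k y x => exact ⟨fun _ _ => rfl, fun y hy => by simp_all [State.setArr, Prog.arrs]⟩
  | seq _ _ ih₁ ih₂ =>
    exact ih₁.trans ih₂ (by simp [Prog.regs]) (by simp [Prog.regs]) (by simp [Prog.arrs])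
      (by simp [Prog.arrs])
  | condTrue _ _ ih =>
    exact ⟨fun y hy => ih.reg y (by simp_all [Prog.regs]),
      fun k hk => ih.arr k (by simp_all [Prog.arrs])⟩
  | condFalse _ _ ih =>
    exact ⟨fun y hy => ih.reg y (by simp_all [Prog.regs]),
      fun k hk => ih.arr k (by simp_all [Prog.arrs])⟩
  | loopStop => exact .refl _ _
  | loopStep _ _ _ ih₁ ih₂ =>
    exact ih₁.trans ih₂ (by simp [Prog.regs]) (by simp [Prog.regs]) (by simp [Prog.arrs])
      (by simp [Prog.arrs])

/-- Started in `σ`, the program halts after at most `T` steps in a state that satisfies `Q`. -/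
def Exec (p : Prog) (σ : State) (T : ℕ) (Q : State → Prop) : Prop :=
  ∃ (τ : State) (t : ℕ), Run p σ τ t ∧ t ≤ T ∧ Q τ

namespace Exec

variable {p p' : Prog} {σ : State} {T T' : ℕ} {Q Q' : State → Prop}

theorem mono (h : Exec p σ T Q) (hT : T ≤ T') (hQ : ∀ τ, Frame p σ τ → Q τ → Q' τ) :
    Exec p σ T' Q' := by
  obtain ⟨τ, t, h1, h2, h3⟩ := h
  exact ⟨τ, t, h1, h2.trans hT, hQ τ h1.frame h3⟩

theorem seq (h : Exec p σ T fun τ => Frame p σ τ → Exec p' τ T' Q) :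
    Exec (.seq p p') σ (T + T') Q := by
  obtain ⟨τ, t, h1, h2, h3⟩ := h
  obtain ⟨υ, t', h1', h2', h3'⟩ := h3 h1.frame
  exact ⟨υ, t + t', .seq h1 h1', by omega, h3'⟩

theorem bind (h : Exec p σ T Q') (h' : ∀ τ, Frame p σ τ → Q' τ → Exec p' τ T' Q) :
    Exec (.seq p p') σ (T + T') Q :=
  seq (h.mono le_rfl fun τ _ hQ hF => h' τ hF hQ)

theorem cond {x : ℕ} (h : σ.reg x ≠ 0 → Exec p σ T Q) (h' : σ.reg x = 0 → Exec p' σ T Q) :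
    Exec (.cond x p p') σ (T + 1) Q := by
  by_cases hx : σ.reg x = 0
  · obtain ⟨τ, t, h1, h2, h3⟩ := h' hx
    exact ⟨τ, t + 1, .condFalse hx h1, by omega, h3⟩
  · obtain ⟨τ, t, h1, h2, h3⟩ := h hx
    exact ⟨τ, t + 1, .condTrue hx h1, by omega, h3⟩

/-- The rule for loops. The first argument of the invariant is a number of steps which is still
available. -/
theorem loop {x : ℕ} (I : ℕ → State → Prop)
    (hs : ∀ (b : ℕ) (τ : State), Frame (.loop x p) σ τ → I b τ → τ.reg x ≠ 0 →
      ∃ b' t, t + 1 + b' ≤ b ∧ Exec p τ t (I b'))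
    {b : ℕ} (h0 : I b σ) :
    Exec (.loop x p) σ (b + 1) fun τ => τ.reg x = 0 ∧ ∃ b', I b' τ := by
  have key : ∀ (b : ℕ) (τ : State), Frame (.loop x p) σ τ → I b τ →
      Exec (.loop x p) τ (b + 1) fun τ => τ.reg x = 0 ∧ ∃ b', I b' τ := by
    intro b
    induction b using Nat.strong_induction_on with
    | _ b ih =>
      intro τ hF hI
      by_cases hx : τ.reg x = 0
      · exact ⟨τ, 1, .loopStop hx, by omega, hx, b, hI⟩
      · obtain ⟨b', t, hb, τ', t', h1, h2, h3⟩ := hs b τ hF hI hx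
        have hF' : Frame (.loop x p) σ τ' := hF.trans h1.frame (by simp) (by simp [Prog.regs])
          (by simp) (by simp [Prog.arrs])
        obtain ⟨υ, t'', h4, h5, h6⟩ := ih b' (by omega) τ' hF' h3
        exact ⟨υ, t' + t'' + 1, .loopStep hx h1 h4, by omega, h6⟩
  exact key b σ (.refl _ _) h0

end Exec

/-! ### Programs without loops -/

/-- No loop occurs in the program. -/
def Prog.straight : Prog → Bool
  | .seq p p' => p.straight && p'.straight
  | .cond _ p p' => p.straight && p'.straight
  | .loop _ _ => false
  | _ => true

/-- The final state of a program without loops. -/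
def Prog.exec : Prog → State → State
  | .const x n, σ => σ.setReg x n
  | .add x y z, σ => σ.setReg x (σ.reg y + σ.reg z)
  | .sub x y z, σ => σ.setReg x (σ.reg y - σ.reg z)
  | .load x k y, σ => σ.setReg x (σ.arr k (σ.reg y))
  | .store k y x, σ => σ.setArr k (σ.reg y) (σ.reg x)
  | .seq p p', σ => p'.exec (p.exec σ)
  | .cond x p p', σ => if σ.reg x = 0 then p'.exec σ else p.exec σ
  | .loop _ _, σ => σ

/-- A bound for the number of steps of a program without loops. -/
def Prog.size : Prog → ℕ
  | .seq p p' => p.size + p'.size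
  | .cond _ p p' => max p.size p'.size + 1
  | _ => 1

/-- Programs without loops are verified by evaluation. -/
theorem Exec.straight {p : Prog} {σ : State} {Q : State → Prop} (hp : p.straight = true)
    (hQ : Q (p.exec σ)) : Exec p σ p.size Q := by
  suffices h : ∀ σ, ∃ t, Run p σ (p.exec σ) t ∧ t ≤ p.size from
    let ⟨t, h1, h2⟩ := h σ
    ⟨_, t, h1, h2, hQ⟩
  clear hQ
  induction p with
  | const x n => exact fun σ => ⟨1, .const _ _ _, le_rfl⟩
  | add x y z => exact fun σ => ⟨1, .add _ _ _ _, le_rfl⟩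
  | sub x y z => exact fun σ => ⟨1, .sub _ _ _ _, le_rfl⟩
  | load x k y => exact fun σ => ⟨1, .load _ _ _ _, le_rfl⟩
  | store k y x => exact fun σ => ⟨1, .store _ _ _ _, le_rfl⟩
  | seq p p' ih ih' =>
    intro σ
    simp only [Prog.straight, Bool.and_eq_true] at hp
    obtain ⟨t, h1, h2⟩ := ih hp.1 σ
    obtain ⟨t', h1', h2'⟩ := ih' hp.2 (p.exec σ)
    exact ⟨_, .seq h1 h1', Nat.add_le_add h2 h2'⟩
  | cond x p p' ih ih' =>
    intro σ
    simp only [Prog.straight, Bool.and_eq_true] at hp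
    by_cases hx : σ.reg x = 0
    · obtain ⟨t', h1', h2'⟩ := ih' hp.2 σ
      refine ⟨t' + 1, ?_, by simp only [Prog.size]; omega⟩
      simpa [Prog.exec, hx] using Run.condFalse hx h1'
    · obtain ⟨t, h1, h2⟩ := ih hp.1 σ
      refine ⟨t + 1, ?_, by simp only [Prog.size]; omega⟩
      simpa [Prog.exec, hx] using Run.condTrue hx h1
  | loop x p => simp [Prog.straight] at hp

theorem Exec.straight_seq {p p' : Prog} {σ : State} {T : ℕ} {Q : State → Prop}
    (hp : p.straight = true) (h : Exec p' (p.exec σ) T Q) :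
    Exec (.seq p p') σ (p.size + T) Q :=
  Exec.bind (Q' := fun τ => τ = p.exec σ) (Exec.straight hp rfl) (by rintro τ - rfl; exact h)

/-! ### Counting loops -/

/-- `for i := 0` up to `n - 1` `do body`. Register `6` holds the number `1`, and register `i + 1`
the number of rounds that remain. -/
def forN (i n : ℕ) (body : Prog) : Prog :=
  .seq (.const i 0) (.seq (.sub (i + 1) n i)
    (.loop (i + 1) (.seq body (.seq (.add i i 6) (.sub (i + 1) n i)))))

theorem forN_regs (i n : ℕ) (body : Prog) (x : ℕ) :
    x ∈ (forN i n body).regs ↔ x = i ∨ x = i + 1 ∨ x ∈ body.regs := by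
  simp [forN, Prog.regs]
  tauto

theorem forN_arrs (i n : ℕ) (body : Prog) : (forN i n body).arrs = body.arrs := by
  simp [forN, Prog.arrs]

/-- The rule for counting loops. The invariant depends on the number of finished rounds and on a
number of steps which is still available. -/
theorem Exec.forN_budget {i n N : ℕ} {body : Prog} {σ : State} (I : ℕ → ℕ → State → Prop)
    (hn : σ.reg n = N) (h6 : σ.reg 6 = 1)
    (hd : n ≠ i ∧ n ≠ i + 1 ∧ 6 ≠ i ∧ 6 ≠ i + 1 ∧ n ∉ body.regs ∧ 6 ∉ body.regs ∧ i ∉ body.regs)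
    {b : ℕ} (h0 : I 0 b ((σ.setReg i 0).setReg (i + 1) N))
    (hs : ∀ (k b : ℕ) (τ : State), k < N → Frame (forN i n body) σ τ → τ.reg i = k → I k b τ →
      ∃ b' t, t + b' ≤ b ∧ Exec body τ t
        fun τ' => I (k + 1) b' ((τ'.setReg i (k + 1)).setReg (i + 1) (N - (k + 1)))) :
    Exec (forN i n body) σ (b + 3 * N + 3) fun τ => ∃ b', I N b' τ := by
  obtain ⟨d1, d2, d3, d4, d5, d6, d7⟩ := hd
  set σ₁ := (σ.setReg i 0).setReg (i + 1) N with hσ₁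
  have hrun : ∃ σ₁', Run (.const i 0) σ (σ.setReg i 0) 1 ∧
      Run (.sub (i + 1) n i) (σ.setReg i 0) σ₁' 1 ∧ σ₁' = σ₁ := by
    refine ⟨_, .const _ _ _, .sub _ _ _ _, ?_⟩
    simp [hσ₁, State.setReg, d1, hn]
  obtain ⟨_, hr1, hr2, rfl⟩ := hrun
  have hσF : Frame (forN i n body) σ σ₁ := by
    refine ⟨fun x hx => ?_, fun k _ => rfl⟩
    rw [forN_regs] at hx
    push Not at hx
    simp [hσ₁, State.setReg, hx.1, hx.2.1]
  have hloop := Exec.loop (x := i + 1)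
    (p := .seq body (.seq (.add i i 6) (.sub (i + 1) n i))) (σ := σ₁)
    (fun B τ => ∃ k b, k ≤ N ∧ τ.reg i = k ∧ τ.reg (i + 1) = N - k ∧ I k b τ ∧
      b + 3 * (N - k) ≤ B) ?_ (b := b + 3 * N) ⟨0, b, by omega, by simp [hσ₁, State.setReg],
      by simp [hσ₁, State.setReg], h0, by omega⟩
  · obtain ⟨τ, t, h1, h2, h3, -, k, b', hk1, -, hk2, hI, -⟩ := hloop
    have hkN : k = N := by omega
    subst hkN
    exact ⟨τ, _, .seq hr1 (.seq hr2 h1), by omega, b', hI⟩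
  · rintro B τ hF ⟨k, b, hk1, hk2, hk3, hI, hB⟩ hne
    have hkN : k < N := by omega
    have hF' : Frame (forN i n body) σ τ := hσF.trans hF (by simp)
      (by simp [forN, Prog.regs]) (by simp) (by simp [forN, Prog.arrs])
    obtain ⟨b', t, hb, τ', t', h1, h2, h3⟩ := hs k b τ hkN hF' hk2 hI
    refine ⟨B - (t + 3), t + 2, by omega, ?_⟩
    have hτn : τ'.reg n = N := by
      rw [h1.frame.reg n d5, hF'.reg n (by rw [forN_regs]; tauto), hn]
    have hτ6 : τ'.reg 6 = 1 := by
      rw [h1.frame.reg 6 d6, hF'.reg 6 (by rw [forN_regs]; tauto), h6]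
    have hτi : τ'.reg i = k := by rw [h1.frame.reg i d7, hk2]
    have hfin : ∃ υ, Run (.add i i 6) τ' (τ'.setReg i (k + 1)) 1 ∧
        Run (.sub (i + 1) n i) (τ'.setReg i (k + 1)) υ 1 ∧
        υ = (τ'.setReg i (k + 1)).setReg (i + 1) (N - (k + 1)) := by
      refine ⟨_, ?_, .sub _ _ _ _, ?_⟩
      · simpa [hτi, hτ6] using Run.add τ' i i 6
      · simp [State.setReg, d1, hτn]
    obtain ⟨_, hr3, hr4, rfl⟩ := hfin
    exact ⟨_, _, .seq h1 (.seq hr3 hr4), by omega, k + 1, b', by omega,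
      by simp [State.setReg], by simp [State.setReg], h3, by omega⟩

/-- The rule for counting loops whose rounds are equally expensive. -/
theorem Exec.forN {i n N c : ℕ} {body : Prog} {σ : State} (I : ℕ → State → Prop)
    (hn : σ.reg n = N) (h6 : σ.reg 6 = 1)
    (hd : n ≠ i ∧ n ≠ i + 1 ∧ 6 ≠ i ∧ 6 ≠ i + 1 ∧ n ∉ body.regs ∧ 6 ∉ body.regs ∧ i ∉ body.regs)
    (h0 : I 0 ((σ.setReg i 0).setReg (i + 1) N))
    (hs : ∀ (k : ℕ) (τ : State), k < N → Frame (RAM.forN i n body) σ τ → τ.reg i = k → I k τ →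
      Exec body τ c fun τ' => I (k + 1) ((τ'.setReg i (k + 1)).setReg (i + 1) (N - (k + 1)))) :
    Exec (RAM.forN i n body) σ (N * (c + 3) + 3) (I N) := by
  refine (Exec.forN_budget (fun k b τ => I k τ ∧ b = (N - k) * c) hn h6 hd (b := N * c)
    ⟨h0, by simp⟩ ?_).mono (by rw [mul_add]; omega) (fun τ _ ⟨b', h, _⟩ => h)
  rintro k b τ hk hF hi ⟨hI, rfl⟩
  refine ⟨(N - (k + 1)) * c, c, ?_, (hs k τ hk hF hi hI).mono le_rfl fun τ' _ h => ⟨h, rfl⟩⟩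
  obtain ⟨m, rfl⟩ : ∃ m, N = k + 1 + m := ⟨N - (k + 1), by omega⟩
  simp only [show k + 1 + m - k = m + 1 by omega, show k + 1 + m - (k + 1) = m by omega]
  rw [add_mul, one_mul, add_comm]

end RAM

namespace RAM

/-! ### Subroutines on sets and relations -/

/-- Sequential composition. -/
infixr:35 " ⨟ " => Prog.seq

/-- A step without effect on the registers that are used. -/
def skip : Prog := .const 27 0

/-- The array `f` represents the set `S`: a cell is not zero if its index belongs to `S`. -/
def IsSet {n : ℕ} (f : ℕ → ℕ) (S : Set (Fin n)) : Prop :=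
  ∀ x : Fin n, f x ≠ 0 ↔ x ∈ S

/-- The array `f` represents the relation `R`, row by row. -/
def IsRel {n : ℕ} (f : ℕ → ℕ) (R : Fin n → Fin n → Prop) : Prop :=
  ∀ x y : Fin n, f (x * n + y) ≠ 0 ↔ R x y

/-- The array `f` represents the relations `R a`, one after the other. -/
def IsTable {D n : ℕ} (f : ℕ → ℕ) (R : Fin D → Fin n → Fin n → Prop) : Prop :=
  ∀ (a : Fin D) (x y : Fin n), f (a * (n * n) + (x * n + y)) ≠ 0 ↔ R a x y

theorem pair_lt {n x y : ℕ} (hx : x < n) (hy : y < n) : x * n + y < n * n := by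
  have : (x + 1) * n ≤ n * n := Nat.mul_le_mul_right n hx
  rw [add_mul, one_mul] at this
  omega

/-- `dst[i] := dst[i] + src[off + i]` for all `i` below the number in register `n`, where the offset
is in register `20`. -/
def addSeg (dst src n : ℕ) : Prog :=
  forN 22 n (.add 24 20 22 ⨟ .load 25 src 24 ⨟ .load 26 dst 22 ⨟ .add 26 26 25 ⨟ .store dst 22 26)

/-- `dst[i] := src[off + i]` for all `i` below the number in register `n`, where the offset is in
register `20`. -/
def copySeg (dst src n : ℕ) : Prog :=
  forN 22 n (.add 24 20 22 ⨟ .load 25 src 24 ⨟ .store dst 22 25)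

/-- Clear the first cells of an array. Array `14` is never written. -/
def setZero (dst n : ℕ) : Prog :=
  .const 20 0 ⨟ copySeg dst 14 n

theorem addSeg_spec {dst src n N : ℕ} {σ : State} (hn : σ.reg n = N) (h6 : σ.reg 6 = 1)
    (hn' : n < 20) (hne : dst ≠ src) :
    Exec (addSeg dst src n) σ (8 * N + 3) fun τ =>
      (∀ i < N, τ.arr dst i = σ.arr dst i + σ.arr src (σ.reg 20 + i)) := by
  refine (Exec.forN (c := 5) (fun k τ => ∀ i, τ.arr dst i =
    if i < k then σ.arr dst i + σ.arr src (σ.reg 20 + i) else σ.arr dst i) hn h6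
    (by simp [Prog.regs]; omega) (by simp [State.setReg]) ?_).mono (by omega)
    fun τ _ h i hi => by rw [h i, if_pos hi]
  intro k τ hk hF hi hI
  refine Exec.straight rfl ?_
  have h1 : τ.reg 20 = σ.reg 20 := hF.reg 20 (by simp [forN_regs, Prog.regs])
  have h2 : τ.arr src = σ.arr src := hF.arr src (by simp [forN_arrs, Prog.arrs, hne.symm])
  intro i
  simp only [Prog.exec, State.setReg, State.setArr, Function.update_apply]
  simp only [Function.update_apply, Nat.reduceEqDiff, if_true, if_false, h1, h2, hi]
  rcases lt_trichotomy i k with h | h | h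
  · rw [if_neg (by omega), hI, if_pos h, if_pos (by omega)]
  · subst h
    simp [hI]
  · rw [if_neg (by omega), hI, if_neg (by omega), if_neg (by omega)]

theorem copySeg_spec {dst src n N : ℕ} {σ : State} (hn : σ.reg n = N) (h6 : σ.reg 6 = 1)
    (hn' : n < 20) (hne : dst ≠ src) :
    Exec (copySeg dst src n) σ (6 * N + 3) fun τ =>
      (∀ i < N, τ.arr dst i = σ.arr src (σ.reg 20 + i)) := by
  refine (Exec.forN (c := 3) (fun k τ => ∀ i < k, τ.arr dst i = σ.arr src (σ.reg 20 + i)) hn h6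
    (by simp [Prog.regs]; omega) (by simp) ?_).mono (by omega) fun τ _ h => h
  intro k τ hk hF hi hI
  refine Exec.straight rfl ?_
  have h1 : τ.reg 20 = σ.reg 20 := hF.reg 20 (by simp [forN_regs, Prog.regs])
  have h2 : τ.arr src = σ.arr src := hF.arr src (by simp [forN_arrs, Prog.arrs, hne.symm])
  intro i hik
  simp only [Prog.exec, State.setReg, State.setArr, Function.update_apply]
  simp only [Function.update_apply, Nat.reduceEqDiff, if_true, if_false, h1, h2, hi]
  rcases Nat.lt_succ_iff_lt_or_eq.1 hik with h | h
  · rw [if_neg (by omega), hI i h]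
  · subst h
    simp

theorem setZero_spec {dst n N : ℕ} {σ : State} (hn : σ.reg n = N) (h6 : σ.reg 6 = 1)
    (h14 : ∀ i, σ.arr 14 i = 0) (hn' : n < 20) (hne : dst ≠ 14) :
    Exec (setZero dst n) σ (6 * N + 4) fun τ => ∀ i < N, τ.arr dst i = 0 := by
  refine (Exec.bind (Exec.straight rfl (Q := fun τ => τ = σ.setReg 20 0) rfl)
    (T' := 6 * N + 3) ?_).mono (by simp [Prog.size]; omega) fun τ _ h => h
  rintro τ - rfl
  refine (copySeg_spec (N := N) ?_ ?_ hn' hne).mono le_rfl fun τ _ h i hi => ?_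
  · simp [State.setReg, hn, show n ≠ 20 by omega]
  · simp [State.setReg, h6]
  · rw [h i hi]
    exact h14 _

/-- `z := x * y` -/
def mulReg (z x y : ℕ) : Prog :=
  .const z 0 ⨟ forN 22 y (.add z z x)

theorem mulReg_spec {z x y X Y : ℕ} {σ : State} (hx : σ.reg x = X) (hy : σ.reg y = Y)
    (h6 : σ.reg 6 = 1) (hd : z ≠ x ∧ z ≠ y ∧ z ≠ 6 ∧ z ≠ 22 ∧ z ≠ 23 ∧ x ≠ 22 ∧ x ≠ 23 ∧ y ≠ 22 ∧
      y ≠ 23) :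
    Exec (mulReg z x y) σ (4 * Y + 4) fun τ => τ.reg z = X * Y := by
  obtain ⟨d1, d2, d3, d4, d5, d6, d7, d8, d9⟩ := hd
  refine (Exec.bind (Exec.straight rfl (Q := fun τ => τ = σ.setReg z 0) rfl)
    (T' := 4 * Y + 3) ?_).mono (by simp [Prog.size]; omega) fun τ _ h => h
  rintro τ - rfl
  refine (Exec.forN (N := Y) (c := 1) (fun k τ => τ.reg z = X * k) ?_ ?_ ?_ ?_ ?_).mono (by omega)
    fun τ _ h => h
  · simp [State.setReg, hy, d2.symm]
  · simp [State.setReg, h6, d3.symm]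
  · simp [Prog.regs]
    omega
  · simp [State.setReg, d4, d5]
  · intro k τ hk hF hi hI
    refine Exec.straight rfl ?_
    have h1 : τ.reg x = X := by
      rw [hF.reg x (by simp [forN_regs, Prog.regs]; omega)]
      simp [State.setReg, hx, d1.symm]
    simp only [Prog.exec, State.setReg, Function.update_apply, d4, d5, if_false, if_true]
    rw [hI, h1]
    ring

/-! ### Graph search -/

/-- Extend the set in array `set` to all vertices that can be reached from it. The number of
vertices is in register `n`, the adjacency matrix in array `adj`. Array `30` marks the vertices
whose neighbours have been added. In every round, some vertex that is not yet marked is looked for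
and treated. -/
def search (adj set n : ℕ) : Prog :=
  setZero 30 n ⨟
  forN 30 n (
    .const 32 0 ⨟ .const 33 0 ⨟
    forN 34 n (
      .load 36 set 34 ⨟
      .cond 36 (
        .load 37 30 34 ⨟
        .cond 37 skip (.const 32 1 ⨟ .add 38 34 7 ⨟ .add 39 33 7)) skip ⨟
      .add 33 33 n) ⨟
    .cond 32 (.store 30 38 6 ⨟ .add 20 39 7 ⨟ addSeg set adj n) skip)

/-- The inner loop of the search finds a vertex which is not yet marked if there is one. -/
theorem search_scan_spec {set n N : ℕ} {σ : State} (hn : σ.reg n = N) (h6 : σ.reg 6 = 1)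
    (h7 : σ.reg 7 = 0) (h32 : σ.reg 32 = 0) (h33 : σ.reg 33 = 0) (hn' : n < 20) :
    Exec (forN 34 n (
      .load 36 set 34 ⨟
      .cond 36 (
        .load 37 30 34 ⨟
        .cond 37 skip (.const 32 1 ⨟ .add 38 34 7 ⨟ .add 39 33 7)) skip ⨟
      .add 33 33 n)) σ (11 * N + 3) fun τ =>
      (τ.reg 32 = 0 ∧ ∀ x < N, σ.arr set x ≠ 0 → σ.arr 30 x ≠ 0) ∨
      (τ.reg 32 = 1 ∧ τ.reg 38 < N ∧ σ.arr set (τ.reg 38) ≠ 0 ∧ σ.arr 30 (τ.reg 38) = 0 ∧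
        τ.reg 39 = τ.reg 38 * N) := by
  refine (Exec.forN (c := 8) (fun k τ => τ.reg 33 = k * N ∧
      ((τ.reg 32 = 0 ∧ ∀ x < k, σ.arr set x ≠ 0 → σ.arr 30 x ≠ 0) ∨
      (τ.reg 32 = 1 ∧ τ.reg 38 < N ∧ σ.arr set (τ.reg 38) ≠ 0 ∧ σ.arr 30 (τ.reg 38) = 0 ∧
        τ.reg 39 = τ.reg 38 * N))) hn h6 (by simp [Prog.regs, skip]; omega)
    (by simp [State.setReg, h32, h33]) ?_).mono (by omega) fun τ _ h => h.2
  intro k τ hk hF hi hI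
  refine Exec.straight rfl ?_
  have h1 : τ.reg n = N := by
    rw [hF.reg n (by simp [forN_regs, Prog.regs, skip]; omega), hn]
  have h2 : τ.arr = σ.arr := funext fun k => hF.arr k (by simp [forN_arrs, Prog.arrs, skip])
  have h3 : τ.reg 7 = 0 := by rw [hF.reg 7 (by simp [forN_regs, Prog.regs, skip]), h7]
  have e : ∀ m, m ∈ [27, 32, 33, 36, 37, 38, 39] → n ≠ m := by
    intro m hm
    simp only [List.mem_cons, List.not_mem_nil, or_false] at hm
    omega
  simp only [List.mem_cons, List.not_mem_nil, or_false, forall_eq_or_imp, forall_eq] at e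
  obtain ⟨e1, e2, e3, e4, e5, e6, e7⟩ := e
  obtain ⟨hI1, hI2⟩ := hI
  by_cases hs : σ.arr set k = 0
  · simp [Prog.exec, State.setReg, skip, hi, h2, hs, h1, hI1, e1, e4, add_mul]
    rcases hI2 with ⟨a, b⟩ | h
    · left
      refine ⟨a, fun x hx hx0 => ?_⟩
      rcases Nat.lt_or_eq_of_le hx with h | rfl
      · exact b x h hx0
      · exact absurd hs hx0
    · exact Or.inr h
  · by_cases hd : σ.arr 30 k = 0
    · simp [Prog.exec, State.setReg, hi, h2, hs, h1, hI1, h3, hd, e2, e4, e5, e6, e7,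
        add_mul, hk]
    · simp [Prog.exec, State.setReg, skip, hi, h2, hs, h1, hI1, hd,
        e1, e4, e5, add_mul]
      rcases hI2 with ⟨a, b⟩ | h
      · left
        refine ⟨a, fun x hx hx0 => ?_⟩
        rcases Nat.lt_or_eq_of_le hx with h | rfl
        · exact b x h hx0
        · exact hd
      · exact Or.inr h

/-- In every round a vertex is marked unless all vertices found are marked already, so `N` rounds
suffice. -/
theorem search_spec {adj set n N : ℕ} {σ : State} {R : Fin N → Fin N → Prop} {S : Set (Fin N)}
    (hn : σ.reg n = N) (h6 : σ.reg 6 = 1) (h7 : σ.reg 7 = 0) (h14 : ∀ i, σ.arr 14 i = 0)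
    (hN : 1 ≤ N) (hd : n < 20 ∧ adj ≠ set ∧ adj ≠ 30 ∧ set ≠ 30)
    (hR : IsRel (σ.arr adj) R) (hS : IsSet (σ.arr set) S) :
    Exec (search adj set n) σ (50 * (N * N)) fun τ =>
      IsSet (τ.arr set) {y | ∃ x ∈ S, Relation.ReflTransGen R x y} := by
  classical
  obtain ⟨d1, d2, d3, d4⟩ := hd
  have hNN : N ≤ N * N := Nat.le_mul_self N
  refine (Exec.bind (setZero_spec hn h6 h14 d1 (by norm_num)) (T' := N * (19 * N + 14) + 3)
    ?_).mono (by ring_nf; nlinarith) fun τ _ h => h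
  intro τ hτF hτ
  have hregs : ∀ x, x < 20 → τ.reg x = σ.reg x := fun x hx =>
    hτF.reg x (by simp [setZero, copySeg, forN_regs, Prog.regs]; omega)
  have harr : ∀ k, k ≠ 30 → τ.arr k = σ.arr k := fun k hk =>
    hτF.arr k (by simp [setZero, copySeg, forN_arrs, Prog.arrs, hk])
  refine (Exec.forN (N := N) (c := 19 * N + 11) (fun k υ =>
      (∀ y : Fin N, υ.arr set y ≠ 0 → ∃ x ∈ S, Relation.ReflTransGen R x y) ∧
      (∀ y ∈ S, υ.arr set y ≠ 0) ∧
      (∀ x : Fin N, υ.arr 30 x ≠ 0 → υ.arr set x ≠ 0 ∧ ∀ y, R x y → υ.arr set y ≠ 0) ∧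
      ((∀ x : Fin N, υ.arr set x ≠ 0 → υ.arr 30 x ≠ 0) ∨
        k ≤ (Finset.univ.filter fun x : Fin N => υ.arr 30 x ≠ 0).card)) ?_ ?_ ?_ ?_ ?_).mono
    (by ring_nf; omega) ?_
  · rw [hregs n d1, hn]
  · rw [hregs 6 (by norm_num), h6]
  · simp [Prog.regs, forN_regs, addSeg, skip]
    omega
  · refine ⟨fun y hy => ⟨y, ?_, .refl⟩, fun y hy => ?_, fun x hx => ?_, Or.inr (Nat.zero_le _)⟩
    · exact (hS y).1 (by simpa [State.setReg, harr set d4] using hy)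
    · have := (hS y).2 hy
      simpa [State.setReg, harr set d4] using this
    · exact absurd (hτ x x.2) (by simpa [State.setReg] using hx)
  · intro k υ hk hυF hi ⟨hI1, hI2, hI3, hI4⟩
    have hregs' : ∀ x, x < 20 → υ.reg x = σ.reg x := fun x hx => by
      rw [hυF.reg x (by simp [addSeg, skip, forN_regs, Prog.regs]; omega), hregs x hx]
    have hadj : υ.arr adj = σ.arr adj := by
      rw [hυF.arr adj (by simp [addSeg, skip, forN_arrs, Prog.arrs, d2, d3]), harr adj d3]
    refine (Exec.straight_seq rfl (Exec.straight_seq rfl (Exec.bind (T' := 8 * N + 6)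
      (search_scan_spec (N := N) ?_ ?_ ?_ ?_ ?_ d1) ?_))).mono
      (by simp [Prog.size]; omega) fun τ _ h => h
    · simp [Prog.exec, State.setReg, show n ≠ 32 by omega, show n ≠ 33 by omega, hregs' n d1, hn]
    · simp [Prog.exec, State.setReg, hregs' 6, h6]
    · simp [Prog.exec, State.setReg, hregs' 7, h7]
    · simp [Prog.exec, State.setReg]
    · simp [Prog.exec, State.setReg]
    intro ρ hρF hρ
    have ha : ρ.arr = υ.arr := funext fun k => hρF.arr k (by simp [forN_arrs, Prog.arrs, skip])
    have hr : ∀ x, x < 20 → ρ.reg x = σ.reg x := fun x hx => by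
      rw [hρF.reg x (by simp [skip, forN_regs, Prog.regs]; omega)]
      simp [Prog.exec, State.setReg, show x ≠ 32 by omega, show x ≠ 33 by omega, hregs' x hx]
    simp only [Prog.exec, State.setReg] at hρ
    rcases hρ with ⟨g1, g2⟩ | ⟨g1, g2, g3, g4, g5⟩
    · -- nothing is left to do
      refine (Exec.cond (T := 1) (fun h => absurd g1 h) fun _ => Exec.straight rfl ?_).mono
        (by omega) fun τ _ h => h
      simp only [Prog.exec, State.setReg, skip, ha]
      exact ⟨hI1, hI2, hI3, Or.inl fun x hx => g2 x x.2 hx⟩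
    · refine (Exec.cond (T := 8 * N + 5) (fun _ => ?_) (fun h => absurd h (by omega))).mono
        (by omega) fun τ _ h => h
      refine (Exec.straight_seq rfl (Exec.straight_seq rfl ((addSeg_spec (N := N) ?_ ?_ d1
        d2.symm).mono le_rfl fun τ' hF' hτ' => ?_))).mono (by simp [Prog.size]; omega)
        fun _ _ h => h
      · simp [Prog.exec, State.setReg, State.setArr, show n ≠ 20 by omega, hr n d1, hn]
      · simp [Prog.exec, State.setReg, State.setArr, hr 6, h6]
      have hx7 : ρ.reg 7 = 0 := by rw [hr 7 (by norm_num), h7]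
      have hx6 : ρ.reg 6 = 1 := by rw [hr 6 (by norm_num), h6]
      have h30 : τ'.arr 30 = Function.update (υ.arr 30) (ρ.reg 38) 1 := by
        rw [hF'.arr 30 (by simp [addSeg, forN_arrs, Prog.arrs, d4.symm])]
        simp [Prog.exec, State.setReg, State.setArr, ha, hx6]
      set x₀ : Fin N := ⟨ρ.reg 38, g2⟩ with hx₀
      have hset : ∀ y : Fin N, τ'.arr set y ≠ 0 ↔ υ.arr set y ≠ 0 ∨ R x₀ y := by
        intro y
        rw [← hR x₀ y, hτ' y y.2]
        simp [Prog.exec, State.setReg, State.setArr, d4, d3, ha, hadj, hx7, g5, hx₀]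
        tauto
      simp only [State.setReg]
      refine ⟨?_, ?_, ?_, Or.inr ?_⟩
      · intro y hy
        rcases (hset y).1 hy with h | h
        · exact hI1 y h
        · obtain ⟨x, hx, hxx⟩ := hI1 x₀ (by simpa [ha] using g3)
          exact ⟨x, hx, hxx.tail h⟩
      · exact fun y hy => (hset y).2 (Or.inl (hI2 y hy))
      · intro x hx
        rw [h30] at hx
        by_cases hxe : x = x₀
        · subst hxe
          exact ⟨(hset _).2 (Or.inl (by simpa [ha] using g3)),
            fun y hy => (hset y).2 (Or.inr hy)⟩
        · have hne : (x : ℕ) ≠ ρ.reg 38 := fun h => hxe (Fin.ext h)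
          rw [Function.update_of_ne hne] at hx
          obtain ⟨u, v⟩ := hI3 x hx
          exact ⟨(hset _).2 (Or.inl u), fun y hy => (hset y).2 (Or.inl (v y hy))⟩
      · rcases hI4 with h | h
        · exact absurd (by simpa [ha] using g4) (h x₀ (by simpa [ha] using g3))
        · refine Nat.succ_le_of_lt (lt_of_le_of_lt h (Finset.card_lt_card ?_))
          rw [Finset.ssubset_iff_of_subset]
          · refine ⟨x₀, ?_, ?_⟩
            · simp [h30, hx₀]
            · simpa [ha, hx₀] using g4
          · intro x hx
            simp only [Finset.mem_filter, Finset.mem_univ, true_and, h30] at hx ⊢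
            by_cases hne : (x : ℕ) = ρ.reg 38
            · rw [hne]
              simp
            · rwa [Function.update_of_ne hne]
  · rintro υ - ⟨hI1, hI2, hI3, hI4⟩ y
    have hall : ∀ x : Fin N, υ.arr set x ≠ 0 → υ.arr 30 x ≠ 0 := by
      rcases hI4 with h | h
      · exact h
      · intro x _
        have h' := Finset.eq_univ_of_card (Finset.univ.filter fun x : Fin N => υ.arr 30 x ≠ 0)
          (le_antisymm (Finset.card_le_univ _) (by simpa using h))
        have := Finset.mem_univ x
        rw [← h'] at this
        simpa using this
    refine ⟨hI1 y, ?_⟩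
    rintro ⟨x, hx, hxy⟩
    induction hxy with
    | refl => exact hI2 x hx
    | tail _ h ih => exact (hI3 _ (hall _ ih)).2 _ h

/-- `dst` becomes the transpose of the matrix in `src`, with the number of rows in register `0`. -/
def transpose (dst src : ℕ) : Prog :=
  .const 30 0 ⨟
  forN 32 0 (
    .add 31 32 7 ⨟
    forN 34 0 (.load 36 src 30 ⨟ .store dst 31 36 ⨟ .add 30 30 6 ⨟ .add 31 31 0))

theorem transpose_spec {dst src N : ℕ} {σ : State} {R : Fin N → Fin N → Prop}
    (hn : σ.reg 0 = N) (h6 : σ.reg 6 = 1) (h7 : σ.reg 7 = 0) (hN : 1 ≤ N) (hne : dst ≠ src)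
    (hR : IsRel (σ.arr src) R) :
    Exec (transpose dst src) σ (20 * (N * N)) fun τ => IsRel (τ.arr dst) fun x y => R y x := by
  have hNN : N ≤ N * N := Nat.le_mul_self N
  refine (Exec.straight_seq rfl (Exec.forN (N := N) (c := 7 * N + 4) (fun k τ =>
    τ.reg 30 = k * N ∧ ∀ x < N, ∀ y < k, τ.arr dst (x * N + y) = σ.arr src (y * N + x))
    ?_ ?_ ?_ ?_ ?_)).mono (by simp only [Prog.size]; ring_nf; nlinarith) ?_
  · simpa [Prog.exec, State.setReg] using hn
  · simpa [Prog.exec, State.setReg] using h6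
  · simp [Prog.regs, forN_regs]
  · simp [Prog.exec, State.setReg]
  · intro k τ hk hF hi ⟨hI1, hI2⟩
    have h0 : τ.reg 0 = N := by
      rw [hF.reg 0 (by simp [forN_regs, Prog.regs])]
      simpa [Prog.exec, State.setReg] using hn
    have h6' : τ.reg 6 = 1 := by
      rw [hF.reg 6 (by simp [forN_regs, Prog.regs])]
      simpa [Prog.exec, State.setReg] using h6
    have h7' : τ.reg 7 = 0 := by
      rw [hF.reg 7 (by simp [forN_regs, Prog.regs])]
      simpa [Prog.exec, State.setReg] using h7
    have hs : τ.arr src = σ.arr src := hF.arr src (by simp [forN_arrs, Prog.arrs, hne.symm])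
    refine (Exec.straight_seq rfl (Exec.forN (N := N) (c := 4) (fun j υ =>
      υ.reg 30 = k * N + j ∧ υ.reg 31 = k + j * N ∧
      ∀ x < N, ∀ y < k + 1, y < k ∨ x < j → υ.arr dst (x * N + y) = σ.arr src (y * N + x))
      ?_ ?_ ?_ ?_ ?_)).mono (by simp only [Prog.size]; omega) ?_
    · simpa [Prog.exec, State.setReg] using h0
    · simpa [Prog.exec, State.setReg] using h6'
    · simp [Prog.regs]
    · simp [Prog.exec, State.setReg, hI1, h7', hi]
      exact fun x hx y _ hy => hI2 x hx y hy
    · intro j υ hj hυF hυi ⟨g1, g2, g3⟩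
      have e6 : υ.reg 6 = 1 := by
        rw [hυF.reg 6 (by simp [forN_regs, Prog.regs])]
        simpa [Prog.exec, State.setReg] using h6'
      have e0 : υ.reg 0 = N := by
        rw [hυF.reg 0 (by simp [forN_regs, Prog.regs])]
        simpa [Prog.exec, State.setReg] using h0
      have es : υ.arr src = σ.arr src := by
        rw [hυF.arr src (by simp [forN_arrs, Prog.arrs, hne.symm])]
        simpa [Prog.exec, State.setReg] using hs
      refine Exec.straight rfl ?_
      simp [Prog.exec, State.setReg, State.setArr, g1, g2, e6, e0, es, add_mul, ← add_assoc]
      intro x hx y hy hxy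
      rw [Function.update_apply]
      split_ifs with h
      · -- an index determines its row and its column
        have hxj : x = j := by
          have e1 : (y + x * N) / N = x := by
            rw [Nat.add_mul_div_right _ _ (by omega), Nat.div_eq_of_lt (by omega), zero_add]
          have e2 : (k + j * N) / N = j := by
            rw [Nat.add_mul_div_right _ _ (by omega), Nat.div_eq_of_lt (by omega), zero_add]
          rw [← e1, ← e2, ← h, add_comm]
        subst hxj
        have hyk : y = k := by omega
        subst hyk
        rfl
      · refine g3 x hx y (by omega) ?_
        by_contra hcon
        push Not at hcon
        have : y = k := by omega
        have : x = j := by omega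
        subst x y
        exact h (add_comm _ _)
    · rintro υ - ⟨g1, g2, g3⟩
      simp only [State.setReg]
      refine ⟨by simp [g1, add_mul], fun x hx y hy => ?_⟩
      exact g3 x hx y hy (Or.inr hx)
  · rintro τ - ⟨-, h⟩ x y
    rw [h x x.2 y y.2]
    exact hR y x

end RAM

namespace RAM

/-! ### The representation of an instance -/

theorem pair_inj {n x x' y y' : ℕ} (hy : y < n) (hy' : y' < n)
    (h : x * n + y = x' * n + y') : x = x' ∧ y = y' := by
  have e : ∀ u v : ℕ, v < n → (u * n + v) / n = u := fun u v hv => by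
    rw [add_comm, Nat.add_mul_div_right _ _ (by omega), Nat.div_eq_of_lt hv, zero_add]
  have hx : x = x' := by rw [← e x y hy, ← e x' y' hy', h]
  subst hx
  exact ⟨rfl, by omega⟩

theorem bit01_ne_zero {p : Prop} : bit01 p ≠ 0 ↔ p := by
  unfold bit01
  split_ifs <;> simp_all

theorem isRel_epsTable {D n : ℕ} (P : Thread (Fin D) (Fin n)) :
    IsRel P.epsTable fun x y => (x, none, y) ∈ P.trans := by
  intro x y
  rw [Thread.epsTable, bit01_ne_zero]
  constructor
  · rintro ⟨q, q', h, ht⟩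
    obtain ⟨h1, h2⟩ := pair_inj y.2 q'.2 h
    rwa [Fin.ext h1, Fin.ext h2]
  · exact fun h => ⟨x, y, rfl, h⟩

theorem isTable_opTable {D n : ℕ} (P : Thread (Fin D) (Fin n)) (op : Fin D → Op (Fin D)) :
    IsTable (P.opTable op) fun a x y => (x, some (op a), y) ∈ P.trans := by
  intro a x y
  rw [Thread.opTable, bit01_ne_zero]
  constructor
  · rintro ⟨b, q, q', h, ht⟩
    have h' : (a * n + x : ℕ) * n + y = (b * n + q) * n + q' := by rw [← h]; ring
    obtain ⟨h1, h2⟩ := pair_inj y.2 q'.2 h'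
    obtain ⟨h3, h4⟩ := pair_inj x.2 q.2 h1
    rwa [Fin.ext h2, Fin.ext h3, Fin.ext h4]
  · exact fun h => ⟨a, x, y, by ring, h⟩

/-- The registers and arrays that hold the instance, together with the constants `1` and `0` in
registers `6` and `7`, the products `L * L`, `C * C` and `D * C` in registers `8` to `10`, and an empty
array. -/
structure Inputs {L C D : ℕ} (I : LCRInstance L C D) (σ : State) : Prop where
  r0 : σ.reg 0 = L
  r1 : σ.reg 1 = C
  r2 : σ.reg 2 = D
  r3 : σ.reg 3 = I.initValue
  r4 : σ.reg 4 = I.leader.init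
  r5 : σ.reg 5 = I.contributor.init
  r6 : σ.reg 6 = 1
  r7 : σ.reg 7 = 0
  r8 : σ.reg 8 = L * L
  r9 : σ.reg 9 = C * C
  r10 : σ.reg 10 = D * C
  bad : IsSet (σ.arr 0) I.bad
  epsL : IsRel (σ.arr 1) fun x y => (x, none, y) ∈ I.leader.trans
  writeL : IsTable (σ.arr 2) fun a x y => (x, some (Op.write a), y) ∈ I.leader.trans
  readL : IsTable (σ.arr 3) fun a x y => (x, some (Op.read a), y) ∈ I.leader.trans
  epsC : IsRel (σ.arr 4) fun x y => (x, none, y) ∈ I.contributor.trans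
  writeC : IsTable (σ.arr 5) fun a x y => (x, some (Op.write a), y) ∈ I.contributor.trans
  readC : IsTable (σ.arr 6) fun a x y => (x, some (Op.read a), y) ∈ I.contributor.trans
  zero : ∀ i, σ.arr 14 i = 0

variable {L C D : ℕ} {I : LCRInstance L C D}

theorem Inputs.frame {σ τ : State} {p : Prog} (h : Inputs I σ) (hF : Frame p σ τ)
    (hr : ∀ x ∈ p.regs, 11 ≤ x) (ha : ∀ k ∈ p.arrs, 7 ≤ k ∧ k ≠ 14) : Inputs I τ := by
  have e : ∀ x < 11, τ.reg x = σ.reg x := fun x hx => hF.reg x fun hm => by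
    have := hr x hm
    omega
  have f : ∀ k, k < 7 ∨ k = 14 → τ.arr k = σ.arr k := fun k hk => hF.arr k fun hm => by
    have := ha k hm
    omega
  constructor
  all_goals
    first
    | rw [e _ (by norm_num)]
    | rw [f _ (by norm_num)]
  exacts [h.r0, h.r1, h.r2, h.r3, h.r4, h.r5, h.r6, h.r7, h.r8, h.r9, h.r10, h.bad, h.epsL,
    h.writeL, h.readL, h.epsC, h.writeC, h.readC, h.zero]

theorem Inputs.pos {σ : State} (_h : Inputs I σ) : 1 ≤ L ∧ 1 ≤ C ∧ 1 ≤ D :=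
  ⟨I.leader.init.pos, I.contributor.init.pos, I.initValue.pos⟩

/-! ### Relations selected by values -/

/-- Add to the matrix `dst` the matrices in `src` that belong to the values marked in `flag`. The
size of a matrix is in register `nn`. -/
def addSel (dst src nn flag : ℕ) : Prog :=
  .const 20 0 ⨟
  forN 50 2 (.load 52 flag 50 ⨟ .cond 52 (addSeg dst src nn) skip ⨟ .add 20 20 nn)

/-- The offset of the matrix of a value is increased by `N * N` from round to round, as products are not
available. -/
theorem addSel_spec {dst src nn flag N : ℕ} {σ : State} {R : Fin N → Fin N → Prop}
    {Rt : Fin D → Fin N → Fin N → Prop} {F : Set (Fin D)} (hI : Inputs I σ) (hN : 1 ≤ N)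
    (hnn : σ.reg nn = N * N) (hd : nn < 20 ∧ dst ≠ src ∧ dst ≠ flag)
    (hR : IsRel (σ.arr dst) R) (hRt : IsTable (σ.arr src) Rt) (hF : IsSet (σ.arr flag) F) :
    Exec (addSel dst src nn flag) σ (25 * (D * (N * N))) fun τ =>
      IsRel (τ.arr dst) fun x y => R x y ∨ ∃ a ∈ F, Rt a x y := by
  obtain ⟨d1, d2, d3⟩ := hd
  have hD := hI.pos.2.2
  have hNN : 1 ≤ N * N := Nat.mul_pos hN hN
  refine (Exec.straight_seq rfl (Exec.forN (N := D) (c := 8 * (N * N) + 6) (fun k τ =>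
    τ.reg 20 = k * (N * N) ∧ IsRel (τ.arr dst) fun x y => R x y ∨ ∃ a ∈ F, a < k ∧ Rt a x y)
    ?_ ?_ ?_ ?_ ?_)).mono (by simp only [Prog.size]; nlinarith) ?_
  · simp [Prog.exec, State.setReg, hI.r2]
  · simp [Prog.exec, State.setReg, hI.r6]
  · simp [Prog.regs, forN_regs, addSeg, skip]
  · simpa [Prog.exec, State.setReg] using hR
  · intro k τ hk hτF hi ⟨g1, g2⟩
    have hnn' : τ.reg nn = N * N := by
      rw [hτF.reg nn (by simp [Prog.regs, forN_regs, addSeg, skip]; omega)]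
      simp [Prog.exec, State.setReg, hnn, show nn ≠ 20 by omega]
    have h6 : τ.reg 6 = 1 := by
      rw [hτF.reg 6 (by simp [Prog.regs, forN_regs, addSeg, skip])]
      simp [Prog.exec, State.setReg, hI.r6]
    have hflag : τ.arr flag = σ.arr flag :=
      hτF.arr flag (by simp [Prog.arrs, forN_arrs, addSeg, skip, d3.symm])
    have hsrc : τ.arr src = σ.arr src :=
      hτF.arr src (by simp [Prog.arrs, forN_arrs, addSeg, skip, d2.symm])
    set a₀ : Fin D := ⟨k, hk⟩ with ha₀
    have hlt : ∀ a : Fin D, (a : ℕ) < k + 1 ↔ a < k ∨ a = a₀ := fun a => by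
      rw [Fin.ext_iff]
      simp [ha₀]
      omega
    refine (Exec.straight_seq rfl (Exec.bind (T' := 1) (Q' := fun υ =>
      υ.reg 20 = k * (N * N) ∧ υ.reg nn = N * N ∧
        IsRel (υ.arr dst) fun x y => R x y ∨ ∃ a ∈ F, a < k + 1 ∧ Rt a x y)
      (Exec.cond (T := 8 * (N * N) + 3) (fun h => ?_) fun h => ?_) ?_)).mono
      (by simp only [Prog.size]; omega) fun _ _ h => h
    · have hF' : a₀ ∈ F := (hF a₀).1 (by simpa [Prog.exec, State.setReg, hi, hflag, ha₀] using h)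
      refine (addSeg_spec (N := N * N) ?_ ?_ d1 d2).mono le_rfl fun υ hυF hυ => ⟨?_, ?_, ?_⟩
      · simp [Prog.exec, State.setReg, hnn', show nn ≠ 52 by omega]
      · simp [Prog.exec, State.setReg, h6]
      · rw [hυF.reg 20 (by simp [Prog.regs, forN_regs, addSeg])]
        simpa [Prog.exec, State.setReg] using g1
      · rw [hυF.reg nn (by simp [Prog.regs, forN_regs, addSeg]; omega)]
        simp [Prog.exec, State.setReg, hnn', show nn ≠ 52 by omega]
      · intro x y
        have e1 := g2 x y
        have e2 := hRt a₀ x y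
        rw [hυ _ (pair_lt x.2 y.2)]
        simp only [Prog.exec, State.setReg, hsrc, Function.update_apply, Nat.reduceEqDiff,
          if_false, g1]
        rw [Ne, Nat.add_eq_zero_iff, not_and_or, ← Ne, ← Ne, e1, e2]
        simp only [hlt]
        constructor
        · rintro ((h | ⟨a, h⟩) | h)
          · exact Or.inl h
          · exact Or.inr ⟨a, h.1, Or.inl h.2.1, h.2.2⟩
          · exact Or.inr ⟨a₀, hF', Or.inr rfl, h⟩
        · rintro (h | ⟨a, h1, h2 | rfl, h3⟩)
          · exact Or.inl (Or.inl h)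
          · exact Or.inl (Or.inr ⟨a, h1, h2, h3⟩)
          · exact Or.inr h3
    · have hF' : a₀ ∉ F := fun hmem => (hF a₀).2 hmem
        (by simpa [Prog.exec, State.setReg, hi, hflag, ha₀] using h)
      refine (Exec.straight rfl ?_ : Exec skip _ 1 _).mono
        (by simp [skip, Prog.size]) fun _ _ h => h
      refine ⟨by simpa [Prog.exec, State.setReg, skip] using g1,
        by simp [Prog.exec, State.setReg, skip, hnn', show nn ≠ 52 by omega,
          show nn ≠ 27 by omega], ?_⟩
      intro x y
      have e1 := g2 x y
      simp only [Prog.exec, State.setReg, skip]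
      rw [e1]
      simp only [hlt]
      constructor
      · rintro (h | ⟨a, h⟩)
        · exact Or.inl h
        · exact Or.inr ⟨a, h.1, Or.inl h.2.1, h.2.2⟩
      · rintro (h | ⟨a, h1, h2 | rfl, h3⟩)
        · exact Or.inl h
        · exact Or.inr ⟨a, h1, h2, h3⟩
        · exact absurd h1 hF'
    · rintro υ - ⟨u1, u2, u3⟩
      refine Exec.straight rfl ?_
      simp only [Prog.exec, State.setReg, Function.update_apply, Nat.reduceEqDiff, if_true,
        if_false, u1, u2]
      exact ⟨by ring, u3⟩
  · rintro τ - ⟨-, h⟩ x y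
    rw [h x y]
    simp

/-! ### Components of the leader -/

theorem edge_restrict_iff {Q D : Type} (P : Thread D Q) (A : Set D) (x y : Q) :
    (P.restrict A).Edge x y ↔
      (P.restrict ∅).Edge x y ∨ ∃ a ∈ A, (x, some (Op.read a), y) ∈ P.trans := by
  constructor
  · rintro ⟨o, h1, h2⟩
    match o, h1, h2 with
    | none, h1, _ => exact Or.inl ⟨none, h1, by simp⟩
    | some (Op.write a), h1, _ => exact Or.inl ⟨_, h1, by simp⟩
    | some (Op.read a), h1, h2 => exact Or.inr ⟨a, h2 a rfl, h1⟩
  · rintro (h | ⟨a, ha, h⟩)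
    · exact P.edge_restrict_mono (Set.empty_subset A) h
    · refine ⟨_, h, fun b hb => ?_⟩
      simp only [Option.some.injEq, Op.read.injEq] at hb
      exact hb ▸ ha

theorem isSet_singleton {n N : ℕ} {σ : State} {k x : ℕ} (hz : ∀ i < N, σ.arr k i = 0) {q : Fin N}
    (hq : σ.reg x = q) (hn : σ.reg n = 1) :
    IsSet ((σ.setArr k (σ.reg x) (σ.reg n)).arr k) ({q} : Set (Fin N)) := by
  intro y
  simp only [State.setArr, Function.update_self, Set.mem_singleton_iff, Fin.ext_iff]
  rw [Function.update_apply, hq, hn]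
  split_ifs with h
  · simp [h]
  · simp [h, hz y y.2]

/-- The set in array `set` becomes the set of vertices reachable from the vertex in register `x`. -/
def searchFrom (adj set x n : ℕ) : Prog :=
  setZero set n ⨟ .store set x 6 ⨟ search adj set n

theorem searchFrom_spec {adj set x n N : ℕ} {σ : State} {R : Fin N → Fin N → Prop} {q : Fin N}
    (hn : σ.reg n = N) (h6 : σ.reg 6 = 1) (h7 : σ.reg 7 = 0) (h14 : ∀ i, σ.arr 14 i = 0)
    (hx : σ.reg x = q) (hd : n < 20 ∧ adj ≠ set ∧ adj ≠ 30 ∧ set ≠ 30 ∧ set ≠ 14 ∧ x < 20)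
    (hR : IsRel (σ.arr adj) R) :
    Exec (searchFrom adj set x n) σ (65 * (N * N)) fun τ =>
      IsSet (τ.arr set) {y | Relation.ReflTransGen R q y} := by
  obtain ⟨d1, d2, d3, d4, d5, d6⟩ := hd
  have hN : 1 ≤ N := q.pos
  have hNN : N ≤ N * N := Nat.le_mul_self N
  refine (Exec.bind (setZero_spec hn h6 h14 d1 d5) (T' := 1 + 50 * (N * N)) ?_).mono (by omega)
    fun _ _ h => h
  intro τ hF hτ
  have hr : ∀ y < 20, τ.reg y = σ.reg y := fun y hy =>
    hF.reg y (by simp [setZero, copySeg, forN_regs, Prog.regs]; omega)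
  have ha : ∀ k, k ≠ set → τ.arr k = σ.arr k := fun k hk =>
    hF.arr k (by simp [setZero, copySeg, forN_arrs, Prog.arrs, hk])
  have hS := isSet_singleton (n := 6) (x := x) hτ (q := q) (by rw [hr x d6, hx])
    (by rw [hr 6 (by norm_num), h6])
  refine Exec.straight_seq rfl ((search_spec (N := N) (R := R) (S := {q}) ?_ ?_ ?_ ?_ hN
    ⟨d1, d2, d3, d4⟩ ?_ hS).mono le_rfl fun υ _ hυ y => ?_)
  · simpa [Prog.exec, State.setArr, hr n d1] using hn
  · simpa [Prog.exec, State.setArr, hr 6] using h6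
  · simpa [Prog.exec, State.setArr, hr 7] using h7
  · simpa [Prog.exec, State.setArr, d5.symm, ha 14 d5.symm] using h14
  · simpa [Prog.exec, State.setArr, d2, ha adj d2] using hR
  · rw [hυ y]
    simp


/-- `dst` becomes the intersection of the sets in arrays `27` and `28`. -/
def intersect (dst : ℕ) : Prog :=
  forN 22 0 (.const 25 0 ⨟ .load 24 27 22 ⨟ .cond 24 (.load 25 28 22) skip ⨟ .store dst 22 25)

theorem intersect_spec {dst N : ℕ} {σ : State} {S T : Set (Fin N)} (hn : σ.reg 0 = N)
    (h6 : σ.reg 6 = 1) (hd : dst ≠ 27 ∧ dst ≠ 28) (hS : IsSet (σ.arr 27) S)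
    (hT : IsSet (σ.arr 28) T) :
    Exec (intersect dst) σ (8 * N + 3) fun τ => IsSet (τ.arr dst) (S ∩ T) := by
  obtain ⟨d1, d2⟩ := hd
  refine (Exec.forN (N := N) (c := 5) (fun k τ => ∀ x : Fin N, (x : ℕ) < k →
    (τ.arr dst x ≠ 0 ↔ x ∈ S ∩ T)) hn h6 (by simp [Prog.regs, skip]) (by simp) ?_).mono
    (by omega) fun τ _ h x => h x x.2
  intro k τ hk hF hi hI
  have h27 : τ.arr 27 = σ.arr 27 := hF.arr 27 (by simp [forN_arrs, Prog.arrs, skip, d1.symm])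
  have h28 : τ.arr 28 = σ.arr 28 := hF.arr 28 (by simp [forN_arrs, Prog.arrs, skip, d2.symm])
  refine Exec.straight rfl fun x hx => ?_
  by_cases hxk : (x : ℕ) = k
  · have e1 := hS x
    have e2 := hT x
    rw [hxk] at e1 e2
    by_cases h : σ.arr 27 k = 0
    · have : x ∉ S := fun hm => e1.2 hm h
      simp [Prog.exec, State.setReg, State.setArr, hi, h27, h, skip, hxk, this]
    · simp [Prog.exec, State.setReg, State.setArr, hi, h27, h28, h, hxk, e1.1 h, ← e2]
  · have := hI x (by omega)
    by_cases h : σ.arr 27 k = 0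
    · simpa [Prog.exec, State.setReg, State.setArr, hi, h27, h, skip, hxk] using this
    · simpa [Prog.exec, State.setReg, State.setArr, hi, h27, h28, h, hxk] using this

/-- Compute the component of the leader state in register `14`, where the values marked in array
`21` can be read. The adjacency matrix is written to array `25`, the component to array `29`. Array
`7` holds the transitions that read nothing. -/
def leaderComponent : Prog :=
  .const 20 0 ⨟ copySeg 25 7 8 ⨟ addSel 25 3 8 21 ⨟ transpose 26 25 ⨟
  searchFrom 25 27 14 0 ⨟ searchFrom 26 28 14 0 ⨟ intersect 29

theorem leaderComponent_spec {σ : State} {A : Set (Fin D)} {q : Fin L} (hI : Inputs I σ)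
    (hfree : IsRel (σ.arr 7) (I.leader.restrict ∅).Edge) (hq : σ.reg 14 = q)
    (hA : IsSet (σ.arr 21) A) :
    Exec leaderComponent σ (200 * (L * L * D)) fun τ =>
      IsRel (τ.arr 25) (I.leader.restrict A).Edge ∧
      IsSet (τ.arr 29) ((I.leader.restrict A).sccOf q) := by
  obtain ⟨hL, hC, hD⟩ := hI.pos
  have hI₀ : Inputs I ((Prog.const 20 0).exec σ) :=
    hI.frame (Run.frame (.const σ 20 0)) (by decide) (by decide)
  refine (Exec.straight_seq rfl
    (Exec.bind (copySeg_spec (dst := 25) (src := 7) (n := 8) (N := L * L) hI₀.r8 hI₀.r6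
      (by norm_num) (by norm_num))
    (T' := 25 * (D * (L * L)) + (20 * (L * L) + (65 * (L * L) + (65 * (L * L) + (8 * L + 3)))))
    ?_)).mono (by simp only [Prog.size]; nlinarith [Nat.le_mul_self L, Nat.mul_pos hL hL,
      Nat.le_mul_of_pos_right (L * L) hD]) fun _ _ h => h
  intro τ₁ hF₁ h₁
  have hI₁ : Inputs I τ₁ := hI₀.frame hF₁ (by decide) (by decide)
  have hR₁ : IsRel (τ₁.arr 25) (I.leader.restrict ∅).Edge := fun x y => by
    rw [h₁ _ (pair_lt x.2 y.2)]
    simpa [Prog.exec, State.setReg] using hfree x y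
  have hA₁ : IsSet (τ₁.arr 21) A := by
    rw [hF₁.arr 21 (by decide)]
    exact hA
  refine Exec.bind (addSel_spec hI₁ hL hI₁.r8 (by norm_num) hR₁ hI₁.readL hA₁) ?_
  intro τ₂ hF₂ h₂
  have hI₂ : Inputs I τ₂ := hI₁.frame hF₂ (by decide) (by decide)
  have hR₂ : IsRel (τ₂.arr 25) (I.leader.restrict A).Edge := fun x y =>
    (h₂ x y).trans (edge_restrict_iff _ _ _ _).symm
  refine Exec.bind (transpose_spec hI₂.r0 hI₂.r6 hI₂.r7 hL (by norm_num) hR₂) ?_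
  intro τ₃ hF₃ h₃
  have hI₃ : Inputs I τ₃ := hI₂.frame hF₃ (by decide) (by decide)
  have hq₃ : τ₃.reg 14 = q := by
    rw [hF₃.reg 14 (by decide), hF₂.reg 14 (by decide), hF₁.reg 14 (by decide)]
    exact hq
  have hR₃ : IsRel (τ₃.arr 25) (I.leader.restrict A).Edge := by
    rw [hF₃.arr 25 (by decide)]
    exact hR₂
  refine Exec.bind (searchFrom_spec hI₃.r0 hI₃.r6 hI₃.r7 hI₃.zero hq₃ (by norm_num) hR₃) ?_
  intro τ₄ hF₄ h₄
  have hI₄ : Inputs I τ₄ := hI₃.frame hF₄ (by decide) (by decide)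
  have hq₄ : τ₄.reg 14 = q := by rw [hF₄.reg 14 (by decide), hq₃]
  refine Exec.bind (searchFrom_spec (R := fun x y => (I.leader.restrict A).Edge y x) hI₄.r0 hI₄.r6
    hI₄.r7 hI₄.zero hq₄ (by norm_num) (by rw [hF₄.arr 26 (by decide)]; exact h₃)) ?_
  intro τ₅ hF₅ h₅
  have hI₅ : Inputs I τ₅ := hI₄.frame hF₅ (by decide) (by decide)
  refine (intersect_spec hI₅.r0 hI₅.r6 (by norm_num)
    (by rw [hF₅.arr 27 (by decide)]; exact h₄) h₅).mono le_rfl fun τ₆ hF₆ h₆ => ⟨?_, ?_⟩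
  · rw [hF₆.arr 25 (by decide), hF₅.arr 25 (by decide), hF₄.arr 25 (by decide)]
    exact hR₃
  · intro y
    rw [h₆ y]
    refine and_congr_right fun _ => ?_
    exact Relation.reflTransGen_swap

end RAM

namespace RAM

variable {L C D : ℕ} {I : LCRInstance L C D}

/-! ### One round of the saturation -/

/-- Array `23` becomes the set of the values that the leader can write inside the component in
array `29`. -/
def findLoopWrites : Prog :=
  .const 60 0 ⨟
  forN 50 2 (
    .const 52 0 ⨟
    forN 54 0 (
      .load 56 29 54 ⨟
      forN 58 0 (
        .cond 56 (.load 61 29 58 ⨟ .cond 61 (.load 62 2 60 ⨟ .add 52 52 62) skip) skip ⨟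
        .add 60 60 6)) ⨟
    .store 23 50 52)

theorem findLoopWrites_row_spec {σ : State} {T : Set (Fin L)} (hI : Inputs I σ)
    (hT : IsSet (σ.arr 29) T) (a : Fin D) (p : Fin L)
    (h56 : σ.reg 56 ≠ 0 ↔ p ∈ T) (h60 : σ.reg 60 = a * (L * L) + p * L) {P : Prop}
    (h52 : σ.reg 52 ≠ 0 ↔ P) :
    Exec (forN 58 0 (
        .cond 56 (.load 61 29 58 ⨟ .cond 61 (.load 62 2 60 ⨟ .add 52 52 62) skip) skip ⨟
        .add 60 60 6)) σ (9 * L + 3) fun τ =>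
      τ.reg 60 = a * (L * L) + p * L + L ∧ (τ.reg 52 ≠ 0 ↔ P ∨ p ∈ T ∧ ∃ p' ∈ T,
        (p, some (Op.write a), p') ∈ I.leader.trans) := by
  refine (Exec.forN (N := L) (c := 6) (fun k τ => τ.reg 60 = a * (L * L) + p * L + k ∧
    (τ.reg 52 ≠ 0 ↔ P ∨ p ∈ T ∧ ∃ p' ∈ T, (p' : ℕ) < k ∧
      (p, some (Op.write a), p') ∈ I.leader.trans)) hI.r0 hI.r6 (by simp [Prog.regs, skip])
    (by simpa [State.setReg, h60] using h52) ?_).mono (by omega)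
    fun τ _ h => ⟨h.1, by simpa using h.2⟩
  intro k τ hk hF hi ⟨g1, g2⟩
  refine Exec.straight rfl ?_
  have e29 : τ.arr 29 = σ.arr 29 := hF.arr 29 (by decide)
  have e2 : τ.arr 2 = σ.arr 2 := hF.arr 2 (by decide)
  have e56 : τ.reg 56 = σ.reg 56 := hF.reg 56 (by decide)
  have e6 : τ.reg 6 = 1 := (hI.frame hF (by decide) (by decide)).r6
  set p₀ : Fin L := ⟨k, hk⟩ with hp₀
  have hlt : ∀ y : Fin L, (y : ℕ) < k + 1 ↔ y < k ∨ y = p₀ := fun y => by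
    rw [Fin.ext_iff]
    simp [hp₀]
    omega
  have e1 := hT p₀
  have e3 := hI.writeL a p p₀
  rw [← add_assoc] at e3
  simp only [hp₀] at e1 e3
  by_cases hp : σ.reg 56 = 0
  · have hp' : p ∉ T := fun h => h56.2 h hp
    simp [Prog.exec, State.setReg, e56, hp, skip, g1, e6, add_assoc, hp'] at g2 ⊢
    exact g2
  · have hp' : p ∈ T := h56.1 hp
    by_cases hk' : σ.arr 29 k = 0
    · have hn : p₀ ∉ T := fun h => e1.2 h hk'
      simp [Prog.exec, State.setReg, e56, hp, skip, g1, e6, add_assoc, hp', hi, e29, hk', hlt] at g2 ⊢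
      rw [g2]
      refine or_congr_right ⟨fun ⟨y, h1, h2, h3⟩ => ⟨y, h1, Or.inl h2, h3⟩, ?_⟩
      rintro ⟨y, h1, h2 | rfl, h3⟩
      · exact ⟨y, h1, h2, h3⟩
      · exact absurd h1 hn
    · have hn : p₀ ∈ T := e1.1 hk'
      simp only [Prog.exec, State.setReg, Function.update_apply, Nat.reduceEqDiff, if_true, if_false,
        e56, hp, g1, e6, hi, e29, hk', e2]
      refine ⟨by omega, ?_⟩
      rw [Ne, Nat.add_eq_zero_iff, not_and_or, ← Ne, ← Ne, g2, e3]
      simp only [hlt]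
      constructor
      · rintro ((h | ⟨h, y, h1, h2, h3⟩) | h)
        · exact Or.inl h
        · exact Or.inr ⟨h, y, h1, Or.inl h2, h3⟩
        · exact Or.inr ⟨hp', p₀, hn, Or.inr rfl, h⟩
      · rintro (h | ⟨h, y, h1, h2 | rfl, h3⟩)
        · exact Or.inl (Or.inl h)
        · exact Or.inl (Or.inr ⟨h, y, h1, h2, h3⟩)
        · exact Or.inr h3

theorem findLoopWrites_spec {σ : State} {T : Set (Fin L)} (hI : Inputs I σ)
    (hT : IsSet (σ.arr 29) T) :
    Exec findLoopWrites σ (30 * (L * L * D)) fun τ =>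
      IsSet (τ.arr 23) (I.leader.loopWrites T) := by
  obtain ⟨hL, hC, hD⟩ := hI.pos
  have hI₀ : Inputs I ((Prog.const 60 0).exec σ) :=
    hI.frame (Run.frame (.const σ 60 0)) (by decide) (by decide)
  have hT₀ : IsSet (((Prog.const 60 0).exec σ).arr 29) T := hT
  refine (Exec.straight_seq rfl ((Exec.forN (N := D) (c := L * (9 * L + 4 + 3) + 5) (fun k τ =>
    τ.reg 60 = k * (L * L) ∧ ∀ a : Fin D, (a : ℕ) < k →
      (τ.arr 23 a ≠ 0 ↔ a ∈ I.leader.loopWrites T)) hI₀.r2 hI₀.r6 (by decide) ?_ ?_).mono le_rfl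
      fun τ _ h a => h.2 a a.2)).mono ?_ fun _ _ h => h
  · simp [Prog.exec, State.setReg]
  · intro k τ hk hF hi ⟨g1, g2⟩
    have hIτ : Inputs I τ := hI₀.frame hF (by decide) (by decide)
    have hTτ : IsSet (τ.arr 29) T := by
      rw [hF.arr 29 (by decide)]
      exact hT
    have hI₁ : Inputs I ((Prog.const 52 0).exec τ) :=
      hIτ.frame (Run.frame (.const τ 52 0)) (by decide) (by decide)
    refine (Exec.straight_seq rfl (Exec.bind (T' := 1) (Exec.forN (N := L) (c := 9 * L + 4)
      (fun j υ => υ.reg 60 = k * (L * L) + j * L ∧ (υ.reg 52 ≠ 0 ↔ ∃ p ∈ T, (p : ℕ) < j ∧ ∃ p' ∈ T,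
        (p, some (Op.write ⟨k, hk⟩), p') ∈ I.leader.trans)) hI₁.r0 hI₁.r6 (by decide) ?_ ?_)
      ?_)).mono (by simp only [Prog.size]; omega) fun _ _ h => h
    · simp [Prog.exec, State.setReg, g1]
    · intro j υ hj hυF hυi ⟨u1, u2⟩
      have hIυ : Inputs I υ := hI₁.frame hυF (by decide) (by decide)
      have hTυ : IsSet (υ.arr 29) T := by
        rw [hυF.arr 29 (by decide)]
        exact hTτ
      have hI₂ : Inputs I ((Prog.load 56 29 54).exec υ) :=
        hIυ.frame (Run.frame (.load υ 56 29 54)) (by decide) (by decide)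
      refine (Exec.straight_seq rfl ((findLoopWrites_row_spec hI₂ (a := ⟨k, hk⟩) (p := ⟨j, hj⟩)
        hTυ (P := υ.reg 52 ≠ 0) ?_ ?_ ?_).mono le_rfl fun ρ _ hρ => ?_)).mono
        (by simp only [Prog.size]; omega) fun _ _ h => h
      · simpa [Prog.exec, State.setReg, hυi] using hTυ ⟨j, hj⟩
      · simp [Prog.exec, State.setReg, u1]
      · simp [Prog.exec, State.setReg]
      · obtain ⟨r1, r2⟩ := hρ
        simp only [State.setReg, Function.update_apply, Nat.reduceEqDiff, if_false]
        refine ⟨by rw [r1]; ring, ?_⟩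
        rw [r2, u2]
        constructor
        · rintro (⟨p, h1, h2, h3⟩ | ⟨h1, h2⟩)
          · exact ⟨p, h1, by omega, h3⟩
          · exact ⟨_, h1, by simp, h2⟩
        · rintro ⟨p, h1, h2, h3⟩
          rcases Nat.lt_succ_iff_lt_or_eq.1 h2 with h | h
          · exact Or.inl ⟨p, h1, h, h3⟩
          · obtain rfl : p = ⟨j, hj⟩ := Fin.ext h
            exact Or.inr ⟨h1, h3⟩
    · intro υ hυF ⟨u1, u2⟩
      have hυ50 : υ.reg 50 = k := by
        rw [hυF.reg 50 (by decide)]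
        simp [Prog.exec, State.setReg, hi]
      refine Exec.straight rfl ?_
      simp only [Prog.exec, State.setReg, State.setArr, Function.update_apply, Nat.reduceEqDiff,
        if_false, if_true, hυ50]
      refine ⟨by rw [u1]; ring, fun a ha => ?_⟩
      split_ifs with h
      · obtain rfl : a = ⟨k, hk⟩ := Fin.ext h
        rw [u2]
        simp [Thread.loopWrites]
      · rw [hυF.arr 23 (by decide)]
        exact g2 a (by omega)
  · simp only [Prog.size]
    have h1 : L * D ≤ L * L * D := Nat.mul_le_mul_right D (Nat.le_mul_self L)
    have h2 : D ≤ L * D := Nat.le_mul_of_pos_left D hL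
    nlinarith

/-- Add to array `21` the values that contributors in the states in array `20` can write. Register
`16` tells whether a value was added. -/
def collectWrites : Prog :=
  .const 16 0 ⨟ .const 60 0 ⨟
  forN 50 2 (
    .load 52 21 50 ⨟ .const 53 0 ⨟
    forN 54 1 (
      .load 56 20 54 ⨟ .cond 56 (.load 57 9 60 ⨟ .add 53 53 57) skip ⨟ .add 60 60 6) ⨟
    .cond 52 skip (.cond 53 (.store 21 50 53 ⨟ .const 16 1) skip))

/-- The array `f` tells which values can be written in which states. -/
def IsWriteTable (P : Thread (Fin D) (Fin C)) (f : ℕ → ℕ) : Prop :=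
  ∀ (a : Fin D) (x : Fin C), f (a * C + x) ≠ 0 ↔ ∃ x', (x, some (Op.write a), x') ∈ P.trans

theorem collectWrites_row_spec {σ : State} {X : Set (Fin C)} (hI : Inputs I σ)
    (hX : IsSet (σ.arr 20) X) (hW : IsWriteTable I.contributor (σ.arr 9)) (a : Fin D)
    (h60 : σ.reg 60 = a * C) (h53 : σ.reg 53 = 0) :
    Exec (forN 54 1 (
      .load 56 20 54 ⨟ .cond 56 (.load 57 9 60 ⨟ .add 53 53 57) skip ⨟ .add 60 60 6)) σ
      (8 * C + 3) fun τ =>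
      τ.reg 60 = a * C + C ∧ (τ.reg 53 ≠ 0 ↔ a ∈ I.contributor.writable X) := by
  refine (Exec.forN (N := C) (c := 5) (fun k τ => τ.reg 60 = a * C + k ∧
    (τ.reg 53 ≠ 0 ↔ ∃ x ∈ X, (x : ℕ) < k ∧ ∃ x', (x, some (Op.write a), x') ∈ I.contributor.trans))
    hI.r1 hI.r6 (by decide) (by simp [State.setReg, h60, h53]) ?_).mono (by omega)
    fun τ _ h => ⟨h.1, by simpa [Thread.writable] using h.2⟩
  intro k τ hk hF hi ⟨g1, g2⟩
  refine Exec.straight rfl ?_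
  have e20 : τ.arr 20 = σ.arr 20 := hF.arr 20 (by decide)
  have e9 : τ.arr 9 = σ.arr 9 := hF.arr 9 (by decide)
  have e6 : τ.reg 6 = 1 := (hI.frame hF (by decide) (by decide)).r6
  set x₀ : Fin C := ⟨k, hk⟩ with hx₀
  have hlt : ∀ y : Fin C, (y : ℕ) < k + 1 ↔ y < k ∨ y = x₀ := fun y => by
    rw [Fin.ext_iff]
    simp [hx₀]
    omega
  have e1 := hX x₀
  have e3 := hW a x₀
  simp only [hx₀] at e1 e3
  by_cases hk' : σ.arr 20 k = 0
  · have hn : x₀ ∉ X := fun h => e1.2 h hk'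
    simp [Prog.exec, State.setReg, skip, g1, e6, add_assoc, hi, e20, hk', hlt] at g2 ⊢
    rw [g2]
    refine ⟨fun ⟨y, h1, h2, h3⟩ => ⟨y, h1, Or.inl h2, h3⟩, ?_⟩
    rintro ⟨y, h1, h2 | rfl, h3⟩
    · exact ⟨y, h1, h2, h3⟩
    · exact absurd h1 hn
  · have hn : x₀ ∈ X := e1.1 hk'
    simp only [Prog.exec, State.setReg, Function.update_apply, Nat.reduceEqDiff, if_true, if_false,
      g1, e6, hi, e20, hk', e9]
    refine ⟨by omega, ?_⟩
    rw [Ne, Nat.add_eq_zero_iff, not_and_or, ← Ne, ← Ne, g2, e3]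
    simp only [hlt]
    constructor
    · rintro (⟨y, h1, h2, h3⟩ | h)
      · exact ⟨y, h1, Or.inl h2, h3⟩
      · exact ⟨x₀, hn, Or.inr rfl, h⟩
    · rintro ⟨y, h1, h2 | rfl, h3⟩
      · exact Or.inl ⟨y, h1, h2, h3⟩
      · exact Or.inr h3

theorem collectWrites_spec {σ : State} {X : Set (Fin C)} {A : Set (Fin D)} (hI : Inputs I σ)
    (hX : IsSet (σ.arr 20) X) (hW : IsWriteTable I.contributor (σ.arr 9))
    (hA : IsSet (σ.arr 21) A) :
    Exec collectWrites σ (30 * (D * C)) fun τ =>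
      IsSet (τ.arr 21) (A ∪ I.contributor.writable X) ∧
      (τ.reg 16 = 0 ↔ I.contributor.writable X ⊆ A) := by
  obtain ⟨hL, hC, hD⟩ := hI.pos
  have hI₀ : Inputs I ((Prog.const 60 0).exec ((Prog.const 16 0).exec σ)) :=
    (hI.frame (Run.frame (.const σ 16 0)) (by decide) (by decide)).frame
      (Run.frame (.const _ 60 0)) (by decide) (by decide)
  refine (Exec.straight_seq rfl (Exec.straight_seq rfl ((Exec.forN (N := D) (c := 8 * C + 9)
    (fun k τ => τ.reg 60 = k * C ∧
      (∀ a : Fin D, (a : ℕ) < k → (τ.arr 21 a ≠ 0 ↔ a ∈ A ∪ I.contributor.writable X)) ∧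
      (∀ a : Fin D, k ≤ (a : ℕ) → (τ.arr 21 a ≠ 0 ↔ a ∈ A)) ∧
      (τ.reg 16 = 0 ↔ ∀ a ∈ I.contributor.writable X, (a : ℕ) < k → a ∈ A))
    hI₀.r2 hI₀.r6 (by decide) ?_ ?_).mono le_rfl
      fun τ _ h => ⟨fun a => h.2.1 a a.2, h.2.2.2.trans ?_⟩))).mono ?_ fun _ _ h => h
  · refine ⟨by simp [Prog.exec, State.setReg], by simp, fun a _ => hA a,
      by simp [Prog.exec, State.setReg]⟩
  · intro k τ hk hF hi ⟨g1, g2, g3, g4⟩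
    have hIτ : Inputs I τ := hI₀.frame hF (by decide) (by decide)
    have hI₁ : Inputs I ((Prog.const 53 0).exec ((Prog.load 52 21 50).exec τ)) :=
      (hIτ.frame (Run.frame (.load τ 52 21 50)) (by decide) (by decide)).frame
        (Run.frame (.const _ 53 0)) (by decide) (by decide)
    set a₀ : Fin D := ⟨k, hk⟩ with ha₀
    refine (Exec.straight_seq rfl (Exec.straight_seq rfl (Exec.bind
      (collectWrites_row_spec (X := X) hI₁ ?_ ?_ a₀ ?_ ?_) (T' := 4) ?_))).mono
      (by simp only [Prog.size]; omega) fun _ _ h => h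
    · rw [show ((Prog.const 53 0).exec ((Prog.load 52 21 50).exec τ)).arr 20 = τ.arr 20 from rfl,
        hF.arr 20 (by decide)]
      exact hX
    · rw [show ((Prog.const 53 0).exec ((Prog.load 52 21 50).exec τ)).arr 9 = τ.arr 9 from rfl,
        hF.arr 9 (by decide)]
      exact hW
    · simp [Prog.exec, State.setReg, g1, ha₀]
    · simp [Prog.exec, State.setReg]
    · intro υ hυF ⟨u1, u2⟩
      have e50 : υ.reg 50 = k := by
        rw [hυF.reg 50 (by decide)]
        simp [Prog.exec, State.setReg, hi]
      have e52 : υ.reg 52 = τ.arr 21 k := by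
        rw [hυF.reg 52 (by decide)]
        simp [Prog.exec, State.setReg, hi]
      have e16 : υ.reg 16 = τ.reg 16 := by
        rw [hυF.reg 16 (by decide)]
        simp [Prog.exec, State.setReg]
      have e21 : υ.arr 21 = τ.arr 21 := hυF.arr 21 (by decide)
      have hlt : ∀ a : Fin D, (a : ℕ) < k + 1 → (a : ℕ) < k ∨ a = a₀ := fun a ha => by
        rcases Nat.lt_succ_iff_lt_or_eq.1 ha with h | h
        · exact Or.inl h
        · exact Or.inr (Fin.ext h)
      have e3 := g3 a₀ le_rfl
      simp only [ha₀] at e3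
      refine Exec.straight rfl ?_
      have keep : (a₀ ∈ A ∨ a₀ ∉ I.contributor.writable X) →
          (∀ a : Fin D, (a : ℕ) < k + 1 → (τ.arr 21 a ≠ 0 ↔ a ∈ A ∪ I.contributor.writable X)) ∧
          (∀ a : Fin D, k + 1 ≤ (a : ℕ) → (τ.arr 21 a ≠ 0 ↔ a ∈ A)) ∧
          (τ.reg 16 = 0 ↔ ∀ a ∈ I.contributor.writable X, (a : ℕ) < k + 1 → a ∈ A) := by
        intro hor
        refine ⟨fun a ha => ?_, fun a ha => g3 a (by omega), g4.trans ⟨fun h a h1 h2 => ?_,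
          fun h a h1 h2 => h a h1 (by omega)⟩⟩
        · rcases hlt a ha with h | rfl
          · exact g2 a h
          · rw [g3 a₀ le_rfl, Set.mem_union]
            tauto
        · rcases hlt a h2 with h' | rfl
          · exact h a h1 h'
          · tauto
      by_cases h52 : τ.arr 21 k = 0
      · have hA₀ : a₀ ∉ A := fun h => e3.2 h h52
        by_cases h53 : υ.reg 53 = 0
        · have hw : a₀ ∉ I.contributor.writable X := fun h => u2.2 h h53
          simp only [Prog.exec, State.setReg, Function.update_apply, Nat.reduceEqDiff, if_true,
            if_false, e52, h52, h53, e16, e21, u1, ha₀, skip]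
          exact ⟨by ring, keep (Or.inr hw)⟩
        · have hw : a₀ ∈ I.contributor.writable X := u2.1 h53
          simp only [Prog.exec, State.setReg, State.setArr, Function.update_apply, Nat.reduceEqDiff,
            if_true, if_false, e52, h52, h53, e50, u1, ha₀]
          refine ⟨by ring, fun a ha => ?_, fun a ha => ?_, ?_⟩
          · rcases hlt a ha with h | rfl
            · rw [if_neg (by omega), e21]
              exact g2 a h
            · simp only [ha₀, if_true]
              exact ⟨fun _ => Or.inr hw, fun _ => h53⟩
          · rw [if_neg (by omega), e21]
            exact g3 a (by omega)
          · simp only [false_iff, not_forall]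
            exact ⟨a₀, hw, by simp [ha₀], hA₀⟩
      · simp only [Prog.exec, State.setReg, Function.update_apply, Nat.reduceEqDiff,
          if_false, e52, h52, e16, e21, u1, ha₀, skip]
        exact ⟨by ring, keep (Or.inl (e3.1 h52))⟩
  · change 1 + (1 + (D * (8 * C + 9 + 3) + 3)) ≤ _
    have h2 : D ≤ D * C := Nat.le_mul_of_pos_right D hC
    nlinarith
  · exact ⟨fun h a ha => h a ha a.2, fun h a ha _ => h ha⟩

end RAM

namespace RAM

variable {L C D : ℕ} {I : LCRInstance L C D}

theorem Inputs.exec {σ : State} (h : Inputs I σ) {p : Prog} (hp : p.straight = true)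
    (hr : ∀ x ∈ p.regs, 11 ≤ x) (ha : ∀ k ∈ p.arrs, 7 ≤ k ∧ k ≠ 14) : Inputs I (p.exec σ) := by
  obtain ⟨τ, t, h1, -, rfl⟩ := Exec.straight (Q := fun τ => τ = p.exec σ) hp rfl
  exact h.frame h1.frame hr ha

/-! ### Reads of contributors -/

/-- Make the values marked in array `21` or `23` readable for contributors, whose adjacency matrix is
in array `24`. Array `22` marks the values that are readable already. -/
def activate : Prog :=
  .const 20 0 ⨟
  forN 50 2 (
    .load 52 21 50 ⨟ .load 53 23 50 ⨟ .add 52 52 53 ⨟ .load 53 22 50 ⨟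
    .cond 53 skip (.cond 52 (.store 22 50 6 ⨟ addSeg 24 6 9) skip) ⨟
    .add 20 20 9)

/-- The time for the matrices has to be paid only for values that become readable. -/
theorem activate_spec {σ : State} {A W B : Set (Fin D)} (hI : Inputs I σ)
    (hA : IsSet (σ.arr 21) A) (hW : IsSet (σ.arr 23) W) (hB : IsSet (σ.arr 22) B)
    (hR : IsRel (σ.arr 24) (I.contributor.restrict B).Edge) :
    Exec activate σ (20 * D + 13 * (C * C) * ((A ∪ W) \ B).ncard + 5) fun τ =>
      IsSet (τ.arr 22) (B ∪ (A ∪ W)) ∧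
      IsRel (τ.arr 24) (I.contributor.restrict (B ∪ (A ∪ W))).Edge := by
  obtain ⟨hL, hC, hD⟩ := hI.pos
  have hCC : 1 ≤ C * C := Nat.mul_pos hC hC
  have hI₀ : Inputs I ((Prog.const 20 0).exec σ) := hI.exec rfl (by decide) (by decide)
  refine (Exec.straight_seq rfl ((Exec.forN_budget (N := D)
    (b := D * 10 + 13 * (C * C) * ((A ∪ W) \ B).ncard)
    (fun k b τ => τ.reg 20 = k * (C * C) ∧
      (∀ a : Fin D, (a : ℕ) < k → (τ.arr 22 a ≠ 0 ↔ a ∈ B ∪ (A ∪ W))) ∧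
      (∀ a : Fin D, k ≤ (a : ℕ) → (τ.arr 22 a ≠ 0 ↔ a ∈ B)) ∧
      IsRel (τ.arr 24) (I.contributor.restrict (B ∪ {a ∈ A ∪ W | (a : ℕ) < k})).Edge ∧
      b = (D - k) * 10 + 13 * (C * C) * {a ∈ (A ∪ W) \ B | k ≤ (a : ℕ)}.ncard)
    hI₀.r2 hI₀.r6 (by decide) ?_ ?_).mono le_rfl ?_)).mono
    (by simp only [Prog.size]; omega) fun _ _ h => h
  · have e : {a ∈ (A ∪ W) \ B | 0 ≤ (a : ℕ)} = (A ∪ W) \ B :=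
      Set.ext fun a => ⟨fun h => h.1, fun h => ⟨h, Nat.zero_le _⟩⟩
    refine ⟨by simp [Prog.exec, State.setReg], by simp, fun a _ => hB a, ?_,
      by rw [e, Nat.sub_zero]⟩
    simpa [Prog.exec, State.setReg] using hR
  · intro k b τ hk hF hi ⟨g1, g2, g3, g4, g5⟩
    have hIτ : Inputs I τ := hI₀.frame hF (by decide) (by decide)
    set a₀ : Fin D := ⟨k, hk⟩ with ha₀
    have e21 : τ.arr 21 = σ.arr 21 := hF.arr 21 (by decide)
    have e23 : τ.arr 23 = σ.arr 23 := hF.arr 23 (by decide)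
    have eA : σ.arr 21 k ≠ 0 ↔ a₀ ∈ A := hA a₀
    have eW : σ.arr 23 k ≠ 0 ↔ a₀ ∈ W := hW a₀
    have eB : τ.arr 22 k ≠ 0 ↔ a₀ ∈ B := g3 a₀ le_rfl
    have hlt : ∀ a : Fin D, (a : ℕ) < k + 1 ↔ (a : ℕ) < k ∨ a = a₀ := fun a => by
      rw [Fin.ext_iff]
      simp [ha₀]
      omega
    have hDk : D - k = (D - (k + 1)) + 1 := by omega
    set υ := (Prog.load 53 22 50).exec ((Prog.add 52 52 53).exec ((Prog.load 53 23 50).exec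
      ((Prog.load 52 21 50).exec τ))) with hυ
    have hIυ : Inputs I υ := (((hIτ.exec (p := .load 52 21 50) rfl (by decide) (by decide)).exec
      (p := .load 53 23 50) rfl (by decide) (by decide)).exec (p := .add 52 52 53) rfl (by decide)
      (by decide)).exec (p := .load 53 22 50) rfl (by decide) (by decide)
    have u52 : υ.reg 52 = σ.arr 21 k + σ.arr 23 k := by
      simp [hυ, Prog.exec, State.setReg, hi, e21, e23]
    have u53 : υ.reg 53 = τ.arr 22 k := by
      simp [hυ, Prog.exec, State.setReg, hi]
    have u50 : υ.reg 50 = k := by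
      simp [hυ, Prog.exec, State.setReg, hi]
    have u20 : υ.reg 20 = k * (C * C) := by
      simp [hυ, Prog.exec, State.setReg, g1]
    have uarr : υ.arr = τ.arr := rfl
    by_cases hnew : a₀ ∈ (A ∪ W) \ B
    · have hcard : {a ∈ (A ∪ W) \ B | k ≤ (a : ℕ)}.ncard =
          {a ∈ (A ∪ W) \ B | k + 1 ≤ (a : ℕ)}.ncard + 1 := by
        rw [← Set.ncard_insert_of_notMem (a := a₀) (by simp [ha₀])]
        congr 1
        ext a
        simp only [Set.mem_insert_iff, Set.mem_ofPred_eq]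
        constructor
        · rintro ⟨h1, h2⟩
          rcases Nat.eq_or_lt_of_le h2 with h | h
          · exact Or.inl (Fin.ext h.symm)
          · exact Or.inr ⟨h1, h⟩
        · rintro (rfl | ⟨h1, h2⟩)
          · exact ⟨hnew, le_rfl⟩
          · exact ⟨h1, by omega⟩
      refine ⟨(D - (k + 1)) * 10 + 13 * (C * C) * {a ∈ (A ∪ W) \ B | k + 1 ≤ (a : ℕ)}.ncard,
        8 * (C * C) + 11, ?_, ?_⟩
      · rw [g5, hcard, hDk, mul_add]
        omega
      refine (Exec.straight_seq rfl (Exec.straight_seq rfl (Exec.straight_seq rfl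
        (Exec.straight_seq rfl (Exec.bind (T' := 1)
        (Exec.cond (T := 8 * (C * C) + 5) (fun h => absurd (u53 ▸ h) fun h => hnew.2 (eB.1 h))
          fun _ => Exec.cond (T := 8 * (C * C) + 4) (fun _ => ?_) fun h => ?_)
        (fun ρ hρF hρ => Exec.straight rfl hρ)))))).mono (by simp only [Prog.size]; omega)
        fun _ _ h => h
      · have hI₂ : Inputs I ((Prog.store 22 50 6).exec υ) := hIυ.exec rfl (by decide) (by decide)
        refine (Exec.straight_seq rfl ((addSeg_spec (N := C * C) hI₂.r9 hI₂.r6 (by norm_num)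
          (by norm_num)).mono le_rfl fun ρ hρF hρ => ?_)).mono (by simp only [Prog.size]; omega)
          fun _ _ h => h
        have r20 : ρ.reg 20 = k * (C * C) := by
          rw [hρF.reg 20 (by decide)]
          exact u20
        have r9 : ρ.reg 9 = C * C := (hI₂.frame hρF (by decide) (by decide)).r9
        have r22 : ρ.arr 22 = Function.update (τ.arr 22) k 1 := by
          rw [hρF.arr 22 (by decide)]
          simp [Prog.exec, State.setArr, u50, hIυ.r6, uarr]
        simp only [Prog.exec, State.setReg, Function.update_apply, Nat.reduceEqDiff, if_true,
          if_false, r20, r9, r22]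
        refine ⟨by ring, fun a ha => ?_, fun a ha => ?_, ?_, trivial⟩
        · rcases (hlt a).1 ha with h | rfl
          · rw [if_neg (by omega)]
            exact g2 a h
          · simp [ha₀]
            exact Or.inr hnew.1
        · rw [if_neg (by omega)]
          exact g3 a (by omega)
        · intro x y
          have e4 := g4 x y
          have e5 : υ.arr 6 (k * (C * C) + (x * C + y)) ≠ 0 ↔
            (x, some (Op.read a₀), y) ∈ I.contributor.trans := hIυ.readC a₀ x y
          have e6 := hρ _ (pair_lt x.2 y.2)
          simp only [Prog.exec, State.setArr, Function.update_apply, Nat.reduceEqDiff,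
            if_false, u20] at e6
          rw [e6, Ne, Nat.add_eq_zero_iff, not_and_or, ← Ne, ← Ne, uarr, e4, ← uarr, e5,
            edge_restrict_iff, edge_restrict_iff _ (B ∪ {a ∈ A ∪ W | (a : ℕ) < k + 1})]
          simp only [hlt]
          constructor
          · rintro ((h | ⟨a, h | h, h'⟩) | h)
            · exact Or.inl h
            · exact Or.inr ⟨a, Or.inl h, h'⟩
            · exact Or.inr ⟨a, Or.inr ⟨h.1, Or.inl h.2⟩, h'⟩
            · exact Or.inr ⟨a₀, Or.inr ⟨hnew.1, Or.inr rfl⟩, h⟩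
          · rintro (h | ⟨a, h | ⟨h1, h2 | rfl⟩, h'⟩)
            · exact Or.inl (Or.inl h)
            · exact Or.inl (Or.inr ⟨a, Or.inl h, h'⟩)
            · exact Or.inl (Or.inr ⟨a, Or.inr ⟨h1, h2⟩, h'⟩)
            · exact Or.inr h'
      · rw [u52] at h
        rcases hnew.1 with h' | h'
        · exact absurd h' fun h' => eA.2 h' (by omega)
        · exact absurd h' fun h' => eW.2 h' (by omega)
    · have hcard : {a ∈ (A ∪ W) \ B | k ≤ (a : ℕ)} = {a ∈ (A ∪ W) \ B | k + 1 ≤ (a : ℕ)} := by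
        ext a
        simp only [Set.mem_ofPred_eq]
        refine and_congr_right fun h => ⟨fun h' => ?_, fun h' => by omega⟩
        rcases Nat.eq_or_lt_of_le h' with h' | h'
        · exact absurd ((Fin.ext h' : a₀ = a) ▸ h) hnew
        · exact h'
      have hset : B ∪ {a ∈ A ∪ W | (a : ℕ) < k + 1} = B ∪ {a ∈ A ∪ W | (a : ℕ) < k} := by
        ext a
        simp only [Set.mem_union, Set.mem_ofPred_eq, hlt]
        constructor
        · rintro (h | ⟨h1, h2 | rfl⟩)
          · exact Or.inl h
          · exact Or.inr ⟨h1, h2⟩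
          · exact Or.inl (by_contra fun h => hnew ⟨h1, h⟩)
        · rintro (h | ⟨h1, h2⟩)
          · exact Or.inl h
          · exact Or.inr ⟨h1, Or.inl h2⟩
      refine ⟨(D - (k + 1)) * 10 + 13 * (C * C) * {a ∈ (A ∪ W) \ B | k + 1 ≤ (a : ℕ)}.ncard,
        8, by rw [g5, hcard, hDk]; omega, ?_⟩
      have hskip : Exec skip υ 1 fun ρ => ρ.reg 20 = k * (C * C) ∧ ρ.reg 9 = C * C ∧
          ρ.arr = τ.arr :=
        Exec.straight rfl ⟨by simpa [Prog.exec, State.setReg, skip] using u20,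
          by simpa [Prog.exec, State.setReg, skip] using hIυ.r9, rfl⟩
      refine (Exec.straight_seq rfl (Exec.straight_seq rfl (Exec.straight_seq rfl
        (Exec.straight_seq rfl (Exec.bind (T' := 1)
        (Exec.cond (T := 2) (fun _ => hskip.mono (by norm_num) fun _ _ h => h)
          fun h => Exec.cond (T := 1) (fun h' => ?_) fun _ => hskip)
        (fun ρ hρF hρ => Exec.straight rfl ?_)))))).mono (by simp only [Prog.size]; omega)
        fun _ _ h => h
      · exfalso
        have h1 : a₀ ∉ B := fun hm => eB.2 hm (u53 ▸ h)
        refine hnew ⟨?_, h1⟩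
        by_contra hcon
        simp only [Set.mem_union, not_or] at hcon
        refine h' ?_
        have h2 : σ.arr 21 k = 0 := by_contra fun h => hcon.1 (eA.1 h)
        have h3 : σ.arr 23 k = 0 := by_contra fun h => hcon.2 (eW.1 h)
        change υ.reg 52 = 0
        rw [u52, h2, h3]
      · obtain ⟨r1, r2, r3⟩ := hρ
        simp only [Prog.exec, State.setReg, Function.update_apply, Nat.reduceEqDiff, if_true,
          if_false, r1, r2, r3, hset]
        refine ⟨by ring, fun a ha => ?_, fun a ha => g3 a (by omega), g4, trivial⟩
        rcases (hlt a).1 ha with h | rfl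
        · exact g2 a h
        · rw [g3 _ le_rfl]
          refine ⟨Or.inl, ?_⟩
          rintro (h | h)
          · exact h
          · exact by_contra fun h' => hnew ⟨h, h'⟩
  · rintro τ - ⟨b, -, h2, -, h4, -⟩
    have e : {a ∈ A ∪ W | (a : ℕ) < D} = A ∪ W :=
      Set.ext fun a => ⟨fun h => h.1, fun h => ⟨h, a.2⟩⟩
    exact ⟨fun a => h2 a a.2, e ▸ h4⟩

/-- The number by which a value or its absence is stored. -/
def valueCode : Option (Fin D) → ℕ
  | none => D
  | some a => a

/-- Extend the set of contributor states in array `20` by internal moves and reads of the value in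
register `15`, if there is one. -/
def readValue : Prog :=
  .const 20 0 ⨟ copySeg 24 4 9 ⨟ .sub 21 2 15 ⨟
  .cond 21 (mulReg 20 9 15 ⨟ addSeg 24 6 9) skip ⨟ search 24 20 1

theorem readValue_spec {σ : State} {v : Option (Fin D)} {X : Set (Fin C)} (hI : Inputs I σ)
    (hv : σ.reg 15 = valueCode v) (hX : IsSet (σ.arr 20) X) :
    Exec readValue σ (100 * (D * (C * C))) fun τ =>
      IsSet (τ.arr 20) (I.contributor.readClosure {a | v = some a} X) := by
  obtain ⟨hL, hC, hD⟩ := hI.pos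
  have hCC : 1 ≤ C * C := Nat.mul_pos hC hC
  have hI₀ : Inputs I ((Prog.const 20 0).exec σ) := hI.exec rfl (by decide) (by decide)
  refine (Exec.straight_seq rfl (Exec.bind (copySeg_spec (dst := 24) (src := 4) (n := 9)
    (N := C * C) hI₀.r9 hI₀.r6 (by norm_num) (by norm_num))
    (T' := 1 + (4 * D + 8 * (C * C) + 8 + 50 * (C * C))) ?_)).mono
    (by simp only [Prog.size]; nlinarith [Nat.mul_pos hD hCC]) fun _ _ h => h
  intro τ hF hτ
  have hIτ : Inputs I τ := hI₀.frame hF (by decide) (by decide)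
  set υ := (Prog.sub 21 2 15).exec τ with hυ
  have hIυ : Inputs I υ := hIτ.exec rfl (by decide) (by decide)
  have u15 : υ.reg 15 = valueCode v := by
    rw [← hv]
    exact hF.reg 15 (by decide)
  have u21 : υ.reg 21 = D - valueCode v := by
    have h : υ.reg 21 = τ.reg 2 - τ.reg 15 := by simp [hυ, Prog.exec, State.setReg]
    rw [h, hIτ.r2, ← hv, hF.reg 15 (by decide)]
    rfl
  have uX : IsSet (υ.arr 20) X := by
    change IsSet (τ.arr 20) X
    rw [hF.arr 20 (by decide)]
    exact hX
  have u24 : IsRel (υ.arr 24) fun x y => (x, none, y) ∈ I.contributor.trans := by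
    intro x y
    change τ.arr 24 _ ≠ 0 ↔ _
    rw [hτ _ (pair_lt x.2 y.2)]
    simpa [Prog.exec, State.setReg] using hI₀.epsC x y
  refine Exec.straight_seq rfl (Exec.bind (Q' := fun ρ => Inputs I ρ ∧ IsSet (ρ.arr 20) X ∧
    IsRel (ρ.arr 24) (I.contributor.ReadStep {a | v = some a}))
    (Exec.cond (T := 4 * D + 8 * (C * C) + 7) (fun h => ?_) fun h => ?_) ?_)
  · match v, u15, u21 with
    | none, u15, u21 => exact absurd u21 (by simpa [valueCode] using h)
    | some a, u15, u21 =>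
      refine (Exec.bind (mulReg_spec (X := C * C) (Y := a) hIυ.r9 u15 hIυ.r6 (by decide))
        (T' := 8 * (C * C) + 3) ?_).mono (by have := a.2; omega) fun _ _ h => h
      intro ρ hρF hρ
      have hIρ : Inputs I ρ := hIυ.frame hρF (by decide) (by decide)
      refine (addSeg_spec (N := C * C) hIρ.r9 hIρ.r6 (by norm_num) (by norm_num)).mono le_rfl
        fun ν hνF hν => ⟨hIρ.frame hνF (by decide) (by decide), ?_, ?_⟩
      · rw [hνF.arr 20 (by decide), hρF.arr 20 (by decide)]
        exact uX
      · intro x y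
        have e := hIρ.readC a x y
        rw [hν _ (pair_lt x.2 y.2), hρ, mul_comm (C * C), Ne, Nat.add_eq_zero_iff, not_and_or,
          ← Ne, ← Ne, e, hρF.arr 24 (by decide), u24 x y]
        simp [Thread.ReadStep]
  · match v, u15, u21 with
    | some a, u15, u21 =>
      have h' : υ.reg 21 = 0 := h
      rw [u21] at h'
      have := a.2
      simp only [valueCode] at h'
      omega
    | none, u15, u21 =>
      refine (Exec.straight (p := skip) rfl ?_).mono (by simp [skip, Prog.size]) fun _ _ h => h
      refine ⟨hIυ.exec rfl (by decide) (by decide), uX, fun x y => ?_⟩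
      refine (u24 x y).trans ?_
      simp [Thread.ReadStep]
  · rintro ρ - ⟨h1, h2, h3⟩
    exact search_spec h1.r1 h1.r6 h1.r7 h1.zero hC (by norm_num) h3 h2

end RAM

namespace RAM

variable {L C D : ℕ} {I : LCRInstance L C D}

/-! ### The saturation loop -/

/-- The tables that are computed from the input once. -/
structure Tables {L C D : ℕ} (I : LCRInstance L C D) (rep : Fin L → Fin L) (σ : State) : Prop
    extends Inputs I σ where
  freeL : IsRel (σ.arr 7) (I.leader.restrict ∅).Edge
  freeC : IsRel (σ.arr 8) (I.contributor.restrict ∅).Edge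
  writes : IsWriteTable I.contributor (σ.arr 9)
  rep : ∀ p : Fin L, σ.arr 10 p = rep p

variable {rep : Fin L → Fin L}

theorem Tables.frame {σ τ : State} {p : Prog} (h : Tables I rep σ) (hF : Frame p σ τ)
    (hr : ∀ x ∈ p.regs, 11 ≤ x) (ha : ∀ k ∈ p.arrs, 11 ≤ k ∧ k ≠ 14) : Tables I rep τ := by
  have f : ∀ k, k < 11 → τ.arr k = σ.arr k := fun k hk => hF.arr k fun hm => by
    have := ha k hm
    omega
  refine ⟨h.toInputs.frame hF hr fun k hk => ⟨by have := ha k hk; omega, (ha k hk).2⟩,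
    ?_, ?_, ?_, ?_⟩
  all_goals rw [f _ (by norm_num)]
  exacts [h.freeL, h.freeC, h.writes, h.rep]

theorem Tables.exec {σ : State} (h : Tables I rep σ) {p : Prog} (hp : p.straight = true)
    (hr : ∀ x ∈ p.regs, 11 ≤ x) (ha : ∀ k ∈ p.arrs, 11 ≤ k ∧ k ≠ 14) :
    Tables I rep (p.exec σ) := by
  obtain ⟨τ, t, h1, -, rfl⟩ := Exec.straight (Q := fun τ => τ = p.exec σ) hp rfl
  exact h.frame h1.frame hr ha

/-- One round: the component of the leader for the values in array `21`, what can be written there,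
the contributor states reachable with these values, and the values they can write. -/
def round : Prog :=
  leaderComponent ⨟ findLoopWrites ⨟ activate ⨟ search 24 20 1 ⨟ collectWrites

/-- The state between two rounds: array `20` holds the contributor states `X`, array `21` the values
they can write, array `22` the values `B` that contributors may read, array `24` their moves. -/
structure RoundState {L C D : ℕ} (I : LCRInstance L C D) (rep : Fin L → Fin L) (q : Fin L)
    (X : Set (Fin C)) (B : Set (Fin D)) (σ : State) : Prop where
  tables : Tables I rep σ
  state : σ.reg 14 = q
  reached : IsSet (σ.arr 20) X
  values : IsSet (σ.arr 21) (I.contributor.writable X)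
  readable : IsSet (σ.arr 22) B
  moves : IsRel (σ.arr 24) (I.contributor.restrict B).Edge

/-- The values readable after a round that starts with the contributor states `X`. -/
def roundValues (I : LCRInstance L C D) (q : Fin L) (X : Set (Fin C)) : Set (Fin D) :=
  I.contributor.writable X ∪
    I.leader.loopWrites ((I.leader.restrict (I.contributor.writable X)).sccOf q)

/-- The contributor states after a round. -/
def roundReached (I : LCRInstance L C D) (q : Fin L) (X : Set (Fin C)) (B : Set (Fin D)) :
    Set (Fin C) :=
  {y | ∃ x ∈ X, Relation.ReflTransGen
    (I.contributor.restrict (B ∪ roundValues I q X)).Edge x y}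

theorem subset_roundReached (q : Fin L) (X : Set (Fin C)) (B : Set (Fin D)) :
    X ⊆ roundReached I q X B := fun x hx => ⟨x, hx, .refl⟩

set_option maxRecDepth 8000 in
/-- In the time bound, adding the matrices of the reads is paid only for the values that become
readable. -/
theorem round_spec {σ : State} {q : Fin L} {X : Set (Fin C)} {B : Set (Fin D)}
    (h : RoundState I rep q X B σ) :
    Exec round σ (260 * (L * L * D) + 30 * (D * C) + 50 * (C * C) +
        13 * (C * C) * (roundValues I q X \ B).ncard) fun τ =>
      RoundState I rep q (roundReached I q X B) (B ∪ roundValues I q X) τ ∧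
      (τ.reg 16 = 0 ↔
        I.contributor.writable (roundReached I q X B) ⊆ I.contributor.writable X) ∧
      IsRel (τ.arr 25) (I.leader.restrict (I.contributor.writable X)).Edge ∧
      IsSet (τ.arr 29) ((I.leader.restrict (I.contributor.writable X)).sccOf q) := by
  obtain ⟨hL, hC, hD⟩ := h.tables.pos
  obtain ⟨h1, h2, h3, h4, h5, h6⟩ := h
  refine (Exec.bind (leaderComponent_spec h1.toInputs h1.freeL h2 h4)
    (T' := 30 * (L * L * D) + (20 * D + 13 * (C * C) * (roundValues I q X \ B).ncard + 5 +
      (50 * (C * C) + 30 * (D * C)))) ?_).mono ?_ fun _ _ h => h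
  · intro τ₁ hF₁ ⟨a1, a2⟩
    have hT₁ := h1.frame hF₁ (by decide) (by decide)
    refine Exec.bind (findLoopWrites_spec hT₁.toInputs a2) ?_
    intro τ₂ hF₂ b1
    have hT₂ := hT₁.frame hF₂ (by decide) (by decide)
    refine Exec.bind (activate_spec (A := I.contributor.writable X) (B := B) hT₂.toInputs ?_ b1 ?_
      ?_) ?_
    · rw [hF₂.arr 21 (by decide), hF₁.arr 21 (by decide)]
      exact h4
    · rw [hF₂.arr 22 (by decide), hF₁.arr 22 (by decide)]
      exact h5
    · rw [hF₂.arr 24 (by decide), hF₁.arr 24 (by decide)]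
      exact h6
    intro τ₃ hF₃ ⟨c1, c2⟩
    have hT₃ := hT₂.frame hF₃ (by decide) (by decide)
    have hX₃ : IsSet (τ₃.arr 20) X := by
      rw [hF₃.arr 20 (by decide), hF₂.arr 20 (by decide), hF₁.arr 20 (by decide)]
      exact h3
    refine Exec.bind (search_spec hT₃.r1 hT₃.r6 hT₃.r7 hT₃.zero hC (by norm_num) c2 hX₃) ?_
    intro τ₄ hF₄ d1
    have hT₄ := hT₃.frame hF₄ (by decide) (by decide)
    refine (collectWrites_spec (X := roundReached I q X B) (A := I.contributor.writable X)
      hT₄.toInputs d1 hT₄.writes ?_).mono le_rfl ?_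
    · rw [hF₄.arr 21 (by decide), hF₃.arr 21 (by decide), hF₂.arr 21 (by decide),
        hF₁.arr 21 (by decide)]
      exact h4
    intro τ₅ hF₅ ⟨e1, e2⟩
    refine ⟨⟨hT₄.frame hF₅ (by decide) (by decide), ?_, ?_, ?_, ?_, ?_⟩, e2, ?_, ?_⟩
    · rw [hF₅.reg 14 (by decide), hF₄.reg 14 (by decide), hF₃.reg 14 (by decide),
        hF₂.reg 14 (by decide), hF₁.reg 14 (by decide)]
      exact h2
    · rw [hF₅.arr 20 (by decide)]
      exact d1
    · rwa [Set.union_eq_right.2 (I.contributor.writable_mono (subset_roundReached q X B))] at e1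
    · rw [hF₅.arr 22 (by decide), hF₄.arr 22 (by decide)]
      exact c1
    · rw [hF₅.arr 24 (by decide), hF₄.arr 24 (by decide)]
      exact c2
    · rw [hF₅.arr 25 (by decide), hF₄.arr 25 (by decide), hF₃.arr 25 (by decide),
        hF₂.arr 25 (by decide)]
      exact a1
    · rw [hF₅.arr 29 (by decide), hF₄.arr 29 (by decide), hF₃.arr 29 (by decide),
        hF₂.arr 29 (by decide)]
      exact a2
  · have : D ≤ L * L * D := Nat.le_mul_of_pos_left D (Nat.mul_pos hL hL)
    omega

/-- Array `20` becomes the saturation of the contributor states for the leader state in register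
`14`, array `21` the values provided, array `25` the moves of the leader with these values, array
`29` its component. -/
def saturate : Prog :=
  .const 20 0 ⨟ copySeg 24 8 9 ⨟ setZero 22 2 ⨟ setZero 21 2 ⨟ collectWrites ⨟ .const 16 1 ⨟
  .loop 16 round

/-- The rounds stay below the saturation. -/
theorem roundReached_subset {q : Fin L} {X₀ X : Set (Fin C)} {B : Set (Fin D)}
    (hX : X ⊆ saturation I.leader I.contributor q X₀)
    (hB : B ⊆ roundValues I q (saturation I.leader I.contributor q X₀)) :
    B ∪ roundValues I q X ⊆ roundValues I q (saturation I.leader I.contributor q X₀) ∧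
    roundReached I q X B ⊆ saturation I.leader I.contributor q X₀ := by
  have h1 : B ∪ roundValues I q X ⊆
      roundValues I q (saturation I.leader I.contributor q X₀) := by
    refine Set.union_subset hB (Set.union_subset_union (I.contributor.writable_mono hX) ?_)
    exact I.leader.loopWrites_mono
      (I.leader.sccOf_restrict_mono (I.contributor.writable_mono hX) q)
  refine ⟨h1, ?_⟩
  rintro y ⟨x, hx, hxy⟩
  induction hxy with
  | refl => exact hX hx
  | tail _ hs ih =>
    obtain ⟨o, h2, h3⟩ := hs
    exact saturated_saturation _ _ _ _ _ ih o _ h2 fun a ha => h1 (h3 a ha)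

/-- When no value was added, the contributor states are saturated. -/
theorem saturated_of_closed {q : Fin L} {X : Set (Fin C)} {B : Set (Fin D)}
    (hB : roundValues I q X ⊆ B)
    (hX : ∀ x ∈ X, ∀ y, (I.contributor.restrict B).Edge x y → y ∈ X) :
    Saturated I.leader I.contributor q X :=
  fun x hx o x' ho hr => hX x hx x' ⟨o, ho, fun a ha => hB (hr a ha)⟩

theorem ncard_le_fin {n : ℕ} (X : Set (Fin n)) : X.ncard ≤ n := by
  have := Set.ncard_le_ncard (Set.subset_univ X)
  rwa [Set.ncard_univ, Nat.card_eq_fintype_card, Fintype.card_fin] at this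

/-- The number of steps which are still available in the saturation loop: a round which is followed
by another one adds a contributor state and a value. -/
noncomputable def roundBudget (I : LCRInstance L C D) (X : Set (Fin C)) (B : Set (Fin D))
    (changed : ℕ) : ℕ :=
  (C - X.ncard) * (260 * (L * L * D) + 30 * (D * C) + 1) +
  (D - (I.contributor.writable X).ncard) * (50 * (C * C)) +
  (D - B.ncard) * (13 * (C * C)) +
  if changed = 0 then 0 else 260 * (L * L * D) + 30 * (D * C) + 1 + 50 * (C * C)

/-- The budget pays for a round and for the rounds to come. -/
theorem roundBudget_step {q : Fin L} {X : Set (Fin C)} {B : Set (Fin D)} {c c' : ℕ} (hc : c ≠ 0)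
    (hc' : c' = 0 ↔ I.contributor.writable (roundReached I q X B) ⊆ I.contributor.writable X) :
    260 * (L * L * D) + 30 * (D * C) + 50 * (C * C) +
        13 * (C * C) * (roundValues I q X \ B).ncard + 1 +
      roundBudget I (roundReached I q X B) (B ∪ roundValues I q X) c' ≤ roundBudget I X B c := by
  simp only [roundBudget]
  set X' := roundReached I q X B
  generalize hα : 260 * (L * L * D) + 30 * (D * C) + 1 = α
  generalize hβ : 50 * (C * C) = β
  generalize hγ : 13 * (C * C) = γ
  have hXX : X ⊆ X' := subset_roundReached q X B
  have hWW := I.contributor.writable_mono hXX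
  have hB : (B ∪ roundValues I q X).ncard = B.ncard + (roundValues I q X \ B).ncard := by
    rw [← Set.ncard_union_eq Set.disjoint_sdiff_right, Set.union_sdiff_self]
  have hB' := ncard_le_fin (B ∪ roundValues I q X)
  have e1 : (D - B.ncard) * γ =
      (D - (B ∪ roundValues I q X).ncard) * γ + γ * (roundValues I q X \ B).ncard := by
    rw [mul_comm γ, ← add_mul]
    congr 1
    omega
  have x1 := Set.ncard_le_ncard hXX
  have w1 := Set.ncard_le_ncard hWW
  have x2 := ncard_le_fin X'
  have w2 := ncard_le_fin (I.contributor.writable X')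
  rw [if_neg hc, e1]
  by_cases hch : c' = 0
  · rw [if_pos hch]
    have e2 : (C - X'.ncard) * α ≤ (C - X.ncard) * α := Nat.mul_le_mul_right _ (by omega)
    have e3 : (D - (I.contributor.writable X').ncard) * β ≤
      (D - (I.contributor.writable X).ncard) * β := Nat.mul_le_mul_right _ (by omega)
    omega
  · rw [if_neg hch]
    have hne : ¬ I.contributor.writable X' ⊆ I.contributor.writable X := fun h => hch (hc'.2 h)
    have x3 : X.ncard < X'.ncard := Set.ncard_lt_ncard
      (hXX.ssubset_of_not_subset fun h => hne (I.contributor.writable_mono h))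
    have w3 : (I.contributor.writable X).ncard < (I.contributor.writable X').ncard :=
      Set.ncard_lt_ncard (hWW.ssubset_of_not_subset hne)
    have e2 : (C - X'.ncard) * α + α ≤ (C - X.ncard) * α := by
      rw [← Nat.succ_mul]
      exact Nat.mul_le_mul_right _ (by omega)
    have e3 : (D - (I.contributor.writable X').ncard) * β + β ≤
        (D - (I.contributor.writable X).ncard) * β := by
      rw [← Nat.succ_mul]
      exact Nat.mul_le_mul_right _ (by omega)
    omega

/-- The loop is left when a round adds no value that contributors can write. Then the contributor states
are the saturation. -/
theorem saturate_spec {σ : State} {q : Fin L} {X₀ : Set (Fin C)} (hT : Tables I rep σ)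
    (hq : σ.reg 14 = q) (hX : IsSet (σ.arr 20) X₀) :
    Exec saturate σ (1000 * (L * L * D * (C * C))) fun τ =>
      IsSet (τ.arr 20) (saturation I.leader I.contributor q X₀) ∧
      IsRel (τ.arr 25) (I.leader.restrict (I.contributor.writable
        (saturation I.leader I.contributor q X₀))).Edge ∧
      IsSet (τ.arr 29) ((I.leader.restrict (I.contributor.writable
        (saturation I.leader I.contributor q X₀))).sccOf q) := by
  obtain ⟨hL, hC, hD⟩ := hT.pos
  have hT₀ : Tables I rep ((Prog.const 20 0).exec σ) := hT.exec rfl (by decide) (by decide)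
  refine (Exec.straight_seq rfl (Exec.bind (copySeg_spec (dst := 24) (src := 8) (n := 9)
    (N := C * C) hT₀.r9 hT₀.r6 (by norm_num) (by norm_num))
    (T' := 6 * D + 4 + (6 * D + 4 + (30 * (D * C) + (1 + (roundBudget I X₀ ∅ 1 + 1))))) ?_)).mono
    ?_ fun _ _ h => h
  · intro τ₁ hF₁ h₁
    have hT₁ := hT₀.frame hF₁ (by decide) (by decide)
    refine Exec.bind (setZero_spec (dst := 22) (n := 2) hT₁.r2 hT₁.r6 hT₁.zero (by norm_num)
      (by norm_num)) ?_
    intro τ₂ hF₂ h₂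
    have hT₂ := hT₁.frame hF₂ (by decide) (by decide)
    refine Exec.bind (setZero_spec (dst := 21) (n := 2) hT₂.r2 hT₂.r6 hT₂.zero (by norm_num)
      (by norm_num)) ?_
    intro τ₃ hF₃ h₃
    have hT₃ := hT₂.frame hF₃ (by decide) (by decide)
    have hX₃ : IsSet (τ₃.arr 20) X₀ := by
      rw [hF₃.arr 20 (by decide), hF₂.arr 20 (by decide), hF₁.arr 20 (by decide)]
      exact hX
    refine Exec.bind (collectWrites_spec (A := ∅) hT₃.toInputs hX₃ hT₃.writes
      (fun a => by simp [h₃ a a.2])) ?_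
    rintro τ₄ hF₄ ⟨h₄, -⟩
    have hT₄ := hT₃.frame hF₄ (by decide) (by decide)
    have hT₅ : Tables I rep ((Prog.const 16 1).exec τ₄) := hT₄.exec rfl (by decide) (by decide)
    set sat := saturation I.leader I.contributor q X₀ with hsat
    refine Exec.straight_seq rfl ((Exec.loop (fun b τ => ∃ X B, RoundState I rep q X B τ ∧
      X₀ ⊆ X ∧ X ⊆ sat ∧ B ⊆ roundValues I q sat ∧
      (τ.reg 16 = 0 → Saturated I.leader I.contributor q X ∧
        IsRel (τ.arr 25) (I.leader.restrict (I.contributor.writable X)).Edge ∧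
        IsSet (τ.arr 29) ((I.leader.restrict (I.contributor.writable X)).sccOf q)) ∧
      roundBudget I X B (τ.reg 16) ≤ b) ?_ ?_).mono le_rfl ?_)
    · classical
      rintro b τ - ⟨X, B, hR, hX1, hX2, hB, -, hb⟩ hne
      refine ⟨b - (260 * (L * L * D) + 30 * (D * C) + 50 * (C * C) +
        13 * (C * C) * (roundValues I q X \ B).ncard + 1), _, ?_, (round_spec hR).mono le_rfl ?_⟩
      · have := roundBudget_step (I := I) (q := q) (X := X) (B := B) (c' := if
          I.contributor.writable (roundReached I q X B) ⊆ I.contributor.writable X then 0 else 1)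
          hne (by split_ifs with h <;> simp [h])
        omega
      · intro υ _ ⟨u1, u2, u3, u4⟩
        have hstep := roundBudget_step (I := I) (q := q) hne u2
        obtain ⟨hB', hX'⟩ := roundReached_subset hX2 hB
        refine ⟨_, _, u1, hX1.trans (subset_roundReached q X B), hX', hB', fun h0 => ?_, by omega⟩
        have hW : I.contributor.writable (roundReached I q X B) = I.contributor.writable X :=
          (u2.1 h0).antisymm (I.contributor.writable_mono (subset_roundReached q X B))
        rw [hW]
        refine ⟨saturated_of_closed (B := B ∪ roundValues I q X) ?_ ?_, u3, u4⟩
        · unfold roundValues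
          rw [hW]
          exact Set.subset_union_right
        · rintro x ⟨z, hz, hzx⟩ y hxy
          exact ⟨z, hz, hzx.tail hxy⟩
    · refine ⟨X₀, ∅, ⟨hT₅, ?_, ?_, ?_, ?_, ?_⟩, subset_rfl, subset_saturation _ _ _ _,
        Set.empty_subset _, fun h => ?_, le_of_eq ?_⟩
      · rw [← hq, show ((Prog.const 16 1).exec τ₄).reg 14 = τ₄.reg 14 from rfl,
          hF₄.reg 14 (by decide), hF₃.reg 14 (by decide), hF₂.reg 14 (by decide),
          hF₁.reg 14 (by decide)]
        rfl
      · rw [show ((Prog.const 16 1).exec τ₄).arr 20 = τ₄.arr 20 from rfl, hF₄.arr 20 (by decide)]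
        exact hX₃
      · rwa [Set.empty_union] at h₄
      · rw [show ((Prog.const 16 1).exec τ₄).arr 22 = τ₄.arr 22 from rfl, hF₄.arr 22 (by decide),
          hF₃.arr 22 (by decide)]
        exact fun a => by simp [h₂ a a.2]
      · rw [show ((Prog.const 16 1).exec τ₄).arr 24 = τ₄.arr 24 from rfl, hF₄.arr 24 (by decide),
          hF₃.arr 24 (by decide), hF₂.arr 24 (by decide)]
        intro x y
        rw [h₁ _ (pair_lt x.2 y.2)]
        simpa [Prog.exec, State.setReg] using hT₀.freeC x y
      · simp [Prog.exec, State.setReg] at h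
      · simp [Prog.exec, State.setReg]
    · rintro τ - ⟨h0, b, X, B, hR, hX1, hX2, -, hfin, -⟩
      obtain ⟨f1, f2, f3⟩ := hfin h0
      have hXs : X = sat := hX2.antisymm fun x hx => hx X ⟨hX1, f1⟩
      rw [← hXs]
      exact ⟨hR.reached, f2, f3⟩
  · set U := L * L * D * (C * C) with hU
    have m1 : C * (L * L * D) ≤ U := by
      rw [show U = C * (L * L * D) * C by rw [hU]; ring]
      exact Nat.le_mul_of_pos_right _ hC
    have m2 : C * (D * C) ≤ U := by
      rw [show U = C * (D * C) * (L * L) by rw [hU]; ring]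
      exact Nat.le_mul_of_pos_right _ (Nat.mul_pos hL hL)
    have m3 : L * L * D ≤ C * (L * L * D) := Nat.le_mul_of_pos_left _ hC
    have m4 : D * C ≤ C * (D * C) := Nat.le_mul_of_pos_left _ hC
    have m5 : D ≤ D * C := Nat.le_mul_of_pos_right _ hC
    have m6 : D * (C * C) = C * (D * C) := by ring
    have m7 : C * C ≤ D * (C * C) := Nat.le_mul_of_pos_left _ hD
    have m8 : C ≤ C * C := Nat.le_mul_self C
    have n1 : (C - X₀.ncard) * (260 * (L * L * D) + 30 * (D * C) + 1) ≤
        C * (260 * (L * L * D) + 30 * (D * C) + 1) := Nat.mul_le_mul_right _ (by omega)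
    have n2 : (D - (I.contributor.writable X₀).ncard) * (50 * (C * C)) ≤
        D * (50 * (C * C)) := Nat.mul_le_mul_right _ (by omega)
    have n3 : (D - (∅ : Set (Fin D)).ncard) * (13 * (C * C)) ≤
        D * (13 * (C * C)) := Nat.mul_le_mul_right _ (by omega)
    simp only [roundBudget, Prog.size, if_neg one_ne_zero]
    have n4 : C * (260 * (L * L * D) + 30 * (D * C) + 1) =
        260 * (C * (L * L * D)) + 30 * (C * (D * C)) + C := by ring
    have n5 : D * (50 * (C * C)) = 50 * (D * (C * C)) := by ring
    have n6 : D * (13 * (C * C)) = 13 * (D * (C * C)) := by ring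
    omega

end RAM

namespace RAM

variable {L C D : ℕ} {I : LCRInstance L C D} {rep : Fin L → Fin L}

/-! ### Pending nodes -/

/-- A list of nodes is stored in three arrays, the head of the list last. -/
def Stored (q v X : ℕ → ℕ) : List (SearchNode (Fin D) (Fin L) (Fin C)) → Prop
  | [] => True
  | nd :: l => q l.length = nd.state ∧ v l.length = valueCode nd.value ∧
      (∀ x : Fin C, X (l.length * C + x) ≠ 0 ↔ x ∈ nd.contributors) ∧ Stored q v X l

theorem Stored.congr {q v X q' v' X' : ℕ → ℕ} {l : List (SearchNode (Fin D) (Fin L) (Fin C))}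
    (h : Stored q v X l) (hq : ∀ i < l.length, q' i = q i) (hv : ∀ i < l.length, v' i = v i)
    (hX : ∀ i < l.length * C, X' i = X i) : Stored q' v' X' l := by
  induction l with
  | nil => trivial
  | cons nd l ih =>
    obtain ⟨h1, h2, h3, h4⟩ := h
    rw [List.length_cons] at hq hv hX
    have hlt : ∀ i, i < C → l.length * C + i < (l.length + 1) * C := fun i hi => by
      rw [add_mul, one_mul]
      omega
    refine ⟨by rw [hq _ (by omega), h1], by rw [hv _ (by omega), h2], fun x => ?_,
      ih h4 (fun i hi => hq i (by omega)) (fun i hi => hv i (by omega)) fun i hi => hX i ?_⟩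
    · rw [hX _ (hlt x x.2)]
      exact h3 x
    · rw [add_mul, one_mul]
      omega

/-- The list of the nodes that have to be processed: arrays `11` to `13` hold the states, values and
contributor sets, register `11` the length of the list and register `12` its multiple by `C`. -/
structure Pending (l : List (SearchNode (Fin D) (Fin L) (Fin C))) (σ : State) : Prop where
  length : σ.reg 11 = l.length
  offset : σ.reg 12 = l.length * C
  stored : Stored (σ.arr 11) (σ.arr 12) (σ.arr 13) l

theorem Pending.frame {l : List (SearchNode (Fin D) (Fin L) (Fin C))} {σ τ : State} {p : Prog}
    (h : Pending l σ) (hF : Frame p σ τ) (hr : ∀ x ∈ p.regs, 13 ≤ x)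
    (ha : ∀ k ∈ p.arrs, k < 11 ∨ 14 ≤ k) : Pending l τ := by
  have f : ∀ k, 11 ≤ k → k < 14 → τ.arr k = σ.arr k := fun k hk hk' => hF.arr k fun hm => by
    have := ha k hm
    omega
  refine ⟨?_, ?_, ?_⟩
  · rw [hF.reg 11 fun hm => by have := hr 11 hm; omega]
    exact h.length
  · rw [hF.reg 12 fun hm => by have := hr 12 hm; omega]
    exact h.offset
  · rw [f 11 (by norm_num) (by norm_num), f 12 (by norm_num) (by norm_num),
      f 13 (by norm_num) (by norm_num)]
    exact h.stored

/-- Remove the last node: its state, value and contributors are copied to registers `14` and `15`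
and array `20`. -/
def pop : Prog :=
  .sub 11 11 6 ⨟ .sub 12 12 1 ⨟ .load 14 11 11 ⨟ .load 15 12 11 ⨟ .add 20 12 7 ⨟ copySeg 20 13 1

theorem pop_spec {σ : State} {nd : SearchNode (Fin D) (Fin L) (Fin C)}
    {l : List (SearchNode (Fin D) (Fin L) (Fin C))} (hT : Tables I rep σ)
    (h : Pending (nd :: l) σ) :
    Exec pop σ (6 * C + 8) fun τ => Pending l τ ∧ τ.reg 14 = nd.state ∧
      τ.reg 15 = valueCode nd.value ∧ IsSet (τ.arr 20) nd.contributors := by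
  obtain ⟨h1, h2, h3, h4, h5, h6⟩ := h
  rw [List.length_cons] at h1 h2
  refine (Exec.straight_seq rfl (Exec.straight_seq rfl (Exec.straight_seq rfl
    (Exec.straight_seq rfl (Exec.straight_seq rfl ((copySeg_spec (N := C) ?_ ?_ (by norm_num)
    (by norm_num)).mono le_rfl fun τ hF hτ => ?_)))))).mono (by simp only [Prog.size]; omega)
    fun _ _ h => h
  · simp [Prog.exec, State.setReg, hT.r1]
  · simp [Prog.exec, State.setReg, hT.r6]
  · have e : (l.length + 1) * C - C = l.length * C := by rw [add_mul, one_mul]; omega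
    refine ⟨⟨?_, ?_, ?_⟩, ?_, ?_, fun x => ?_⟩
    · rw [hF.reg 11 (by decide)]
      simp [Prog.exec, State.setReg, h1, hT.r6]
    · rw [hF.reg 12 (by decide)]
      simp [Prog.exec, State.setReg, h2, hT.r1, e]
    · rw [hF.arr 11 (by decide), hF.arr 12 (by decide), hF.arr 13 (by decide)]
      simpa [Prog.exec, State.setReg] using h6
    · rw [hF.reg 14 (by decide)]
      simp [Prog.exec, State.setReg, h1, hT.r6, h3]
    · rw [hF.reg 15 (by decide)]
      simp [Prog.exec, State.setReg, h1, hT.r6, h4]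
    · rw [hτ x x.2, ← h5 x]
      simp [Prog.exec, State.setReg, h2, hT.r1, hT.r7, e]

/-! ### Transitions that leave the component -/

/-- Array `31` becomes the set of the representatives of the states that are entered when the
component in array `29` is left by a move in the matrix in array `32`. -/
def crossings : Prog :=
  setZero 31 0 ⨟ .const 60 0 ⨟
  forN 50 0 (
    .load 52 29 50 ⨟
    forN 54 0 (
      .cond 52 (.load 56 29 54 ⨟ .cond 56 skip (
        .load 57 32 60 ⨟ .cond 57 (.load 58 10 54 ⨟ .store 31 58 6) skip)) skip ⨟
      .add 60 60 6))

theorem crossings_row_spec {σ : State} {T S : Set (Fin L)} {R : Fin L → Fin L → Prop}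
    (hT : Tables I rep σ) (hset : IsSet (σ.arr 29) T) (hR : IsRel (σ.arr 32) R)
    (hS : IsSet (σ.arr 31) S) (p : Fin L) (h52 : σ.reg 52 ≠ 0 ↔ p ∈ T) (h60 : σ.reg 60 = p * L) :
    Exec (forN 54 0 (
      .cond 52 (.load 56 29 54 ⨟ .cond 56 skip (
        .load 57 32 60 ⨟ .cond 57 (.load 58 10 54 ⨟ .store 31 58 6) skip)) skip ⨟
      .add 60 60 6)) σ (11 * L + 3) fun τ => τ.reg 60 = p * L + L ∧
      IsSet (τ.arr 31) (S ∪ {s | p ∈ T ∧ ∃ p' ∉ T, R p p' ∧ rep p' = s}) := by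
  refine (Exec.forN (N := L) (c := 8) (fun k τ => τ.reg 60 = p * L + k ∧
    IsSet (τ.arr 31) (S ∪ {s | p ∈ T ∧ ∃ p' ∉ T, (p' : ℕ) < k ∧ R p p' ∧ rep p' = s}))
    hT.r0 hT.r6 (by decide) (by simpa [State.setReg, h60] using hS) ?_).mono (by omega)
    fun τ _ h => ⟨h.1, by simpa using h.2⟩
  intro k τ hk hF hi ⟨g1, g2⟩
  have hTτ : Tables I rep τ := hT.frame hF (by decide) (by decide)
  have e29 : τ.arr 29 = σ.arr 29 := hF.arr 29 (by decide)
  have e32 : τ.arr 32 = σ.arr 32 := hF.arr 32 (by decide)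
  have e52 : τ.reg 52 = σ.reg 52 := hF.reg 52 (by decide)
  set p₀ : Fin L := ⟨k, hk⟩ with hp₀
  have hlt : (S ∪ {s | p ∈ T ∧ ∃ p' ∉ T, (p' : ℕ) < k + 1 ∧ R p p' ∧ rep p' = s}) =
      (S ∪ {s | p ∈ T ∧ ∃ p' ∉ T, (p' : ℕ) < k ∧ R p p' ∧ rep p' = s}) ∪
        {s | p ∈ T ∧ p₀ ∉ T ∧ R p p₀ ∧ rep p₀ = s} := by
    ext s
    simp only [Set.mem_union, Set.mem_ofPred_eq]
    constructor
    · rintro (h | ⟨h1, y, h2, h3, h4⟩)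
      · exact Or.inl (Or.inl h)
      · rcases Nat.lt_succ_iff_lt_or_eq.1 h3 with h | h
        · exact Or.inl (Or.inr ⟨h1, y, h2, h, h4⟩)
        · obtain rfl : y = p₀ := Fin.ext h
          exact Or.inr ⟨h1, h2, h4⟩
    · rintro ((h | ⟨h1, y, h2, h3, h4⟩) | ⟨h1, h2, h3⟩)
      · exact Or.inl h
      · exact Or.inr ⟨h1, y, h2, by omega, h4⟩
      · exact Or.inr ⟨h1, p₀, h2, Nat.lt_succ_self k, h3⟩
  have f1 : σ.arr 29 k ≠ 0 ↔ p₀ ∈ T := hset p₀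
  have f2 : σ.arr 32 (p * L + k) ≠ 0 ↔ R p p₀ := hR p p₀
  have f3 : τ.arr 10 k = rep p₀ := hTτ.rep p₀
  rw [hlt]
  refine Exec.straight rfl ?_
  have keep : ¬ (p ∈ T ∧ p₀ ∉ T ∧ R p p₀) → IsSet (τ.arr 31)
      ((S ∪ {s | p ∈ T ∧ ∃ p' ∉ T, (p' : ℕ) < k ∧ R p p' ∧ rep p' = s}) ∪
        {s | p ∈ T ∧ p₀ ∉ T ∧ R p p₀ ∧ rep p₀ = s}) := by
    intro hn
    rwa [show {s | p ∈ T ∧ p₀ ∉ T ∧ R p p₀ ∧ rep p₀ = s} = ∅ from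
      Set.eq_empty_of_forall_notMem fun s hs => hn ⟨hs.1, hs.2.1, hs.2.2.1⟩, Set.union_empty]
  by_cases a1 : σ.reg 52 = 0
  · simp only [Prog.exec, State.setReg, skip, Function.update_apply, Nat.reduceEqDiff, if_true,
      if_false, e52, a1, g1, hTτ.r6]
    exact ⟨by omega, keep fun h => h52.2 h.1 a1⟩
  by_cases a2 : σ.arr 29 k = 0
  · by_cases a3 : σ.arr 32 (p * L + k) = 0
    · simp only [Prog.exec, State.setReg, skip, Function.update_apply, Nat.reduceEqDiff, if_true,
        if_false, e52, a1, g1, hTτ.r6, e29, hi, a2, e32, a3]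
      exact ⟨by omega, keep fun h => f2.2 h.2.2 a3⟩
    · simp only [Prog.exec, State.setReg, State.setArr, Function.update_apply, Nat.reduceEqDiff,
        if_true, if_false, e52, a1, g1, hTτ.r6, e29, hi, a2, e32, a3, f3]
      refine ⟨by omega, fun s => ?_⟩
      have b1 : p ∈ T := h52.1 a1
      have b2 : p₀ ∉ T := fun h => f1.2 h a2
      have b3 : R p p₀ := f2.1 a3
      rw [Function.update_apply]
      split_ifs with h
      · exact ⟨fun _ => Or.inr ⟨b1, b2, b3, (Fin.ext h).symm⟩, fun _ => one_ne_zero⟩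
      · rw [g2 s]
        refine ⟨Or.inl, ?_⟩
        rintro (h' | ⟨-, -, -, rfl⟩)
        · exact h'
        · exact absurd rfl h
  · simp only [Prog.exec, State.setReg, skip, Function.update_apply, Nat.reduceEqDiff, if_true,
      if_false, e52, a1, g1, hTτ.r6, e29, hi, a2]
    exact ⟨by omega, keep fun h => h.2.1 (f1.1 a2)⟩

theorem crossings_spec {σ : State} {T : Set (Fin L)} {R : Fin L → Fin L → Prop}
    (hT : Tables I rep σ) (hset : IsSet (σ.arr 29) T) (hR : IsRel (σ.arr 32) R) :
    Exec crossings σ (40 * (L * L)) fun τ =>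
      IsSet (τ.arr 31) {s | ∃ p ∈ T, ∃ p' ∉ T, R p p' ∧ rep p' = s} := by
  have hL := hT.pos.1
  refine (Exec.bind (setZero_spec (dst := 31) (n := 0) hT.r0 hT.r6 hT.zero (by norm_num)
    (by norm_num)) (T' := 1 + (L * (11 * L + 4 + 3) + 3)) ?_).mono
    (by nlinarith [Nat.le_mul_self L]) fun _ _ h => h
  intro τ hF hτ
  have hT₁ : Tables I rep ((Prog.const 60 0).exec τ) :=
    (hT.frame hF (by decide) (by decide)).exec rfl (by decide) (by decide)
  refine Exec.straight_seq rfl ((Exec.forN (N := L) (c := 11 * L + 4) (fun k υ =>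
    υ.reg 60 = k * L ∧ IsSet (υ.arr 31)
      {s | ∃ p ∈ T, (p : ℕ) < k ∧ ∃ p' ∉ T, R p p' ∧ rep p' = s}) hT₁.r0 hT₁.r6 (by decide)
    ⟨by simp [Prog.exec, State.setReg], fun s => by simp [Prog.exec, State.setReg, hτ s s.2]⟩
    ?_).mono le_rfl fun υ _ h => by simpa using h.2)
  intro k υ hk hυF hi ⟨g1, g2⟩
  have hT₂ : Tables I rep ((Prog.load 52 29 50).exec υ) :=
    (hT₁.frame hυF (by decide) (by decide)).exec rfl (by decide) (by decide)
  have e29 : υ.arr 29 = σ.arr 29 := by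
    rw [hυF.arr 29 (by decide)]
    exact hF.arr 29 (by decide)
  have e32 : υ.arr 32 = σ.arr 32 := by
    rw [hυF.arr 32 (by decide)]
    exact hF.arr 32 (by decide)
  refine (Exec.straight_seq rfl ((crossings_row_spec (T := T) (R := R) hT₂
    (e29.symm ▸ hset : IsSet (υ.arr 29) T) (e32.symm ▸ hR : IsRel (υ.arr 32) R) g2 ⟨k, hk⟩
    ?_ ?_).mono le_rfl fun ρ _ ⟨r1, r2⟩ => ⟨?_, ?_⟩)).mono
    (by simp only [Prog.size]; omega) fun _ _ h => h
  · simpa [Prog.exec, State.setReg, hi, e29] using hset ⟨k, hk⟩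
  · simpa [Prog.exec, State.setReg] using g1
  · simp only [State.setReg, Function.update_apply, Nat.reduceEqDiff, if_false, r1]
    ring
  · intro s
    refine (r2 s).trans ?_
    simp only [Set.mem_union, Set.mem_ofPred_eq]
    constructor
    · rintro (⟨p, h1, h2, h3⟩ | ⟨h1, h2⟩)
      · exact ⟨p, h1, by omega, h3⟩
      · exact ⟨_, h1, Nat.lt_succ_self k, h2⟩
    · rintro ⟨p, h1, h2, h3⟩
      rcases Nat.lt_succ_iff_lt_or_eq.1 h2 with h | h
      · exact Or.inl ⟨p, h1, h, h3⟩
      · obtain rfl : p = ⟨k, hk⟩ := Fin.ext h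
        exact Or.inr ⟨h1, h3⟩

/-- Add pending nodes for all states in array `31`, with the value in register `15` and the
contributor states in array `20`. -/
def push : Prog :=
  forN 50 0 (
    .load 52 31 50 ⨟
    .cond 52 (
      .store 11 11 50 ⨟ .store 12 11 15 ⨟
      forN 54 1 (.add 56 12 54 ⨟ .load 57 20 54 ⨟ .store 13 56 57) ⨟
      .add 11 11 6 ⨟ .add 12 12 1) skip)

/-- The body of the loop adds a single node. -/
theorem push_node_spec {σ : State} {X : Set (Fin C)} {v : Option (Fin D)} {s : Fin L}
    {l : List (SearchNode (Fin D) (Fin L) (Fin C))} (hT : Tables I rep σ)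
    (hX : IsSet (σ.arr 20) X) (hv : σ.reg 15 = valueCode v) (hs : σ.reg 50 = s)
    (hl : Pending l σ) :
    Exec (.store 11 11 50 ⨟ .store 12 11 15 ⨟
      forN 54 1 (.add 56 12 54 ⨟ .load 57 20 54 ⨟ .store 13 56 57) ⨟
      .add 11 11 6 ⨟ .add 12 12 1) σ (6 * C + 7) fun τ => Pending (⟨s, v, X⟩ :: l) τ := by
  obtain ⟨h1, h2, h3⟩ := hl
  refine (Exec.straight_seq rfl (Exec.straight_seq rfl (Exec.bind (Exec.forN (N := C) (c := 3)
    (fun k τ => (∀ i < k, τ.arr 13 (l.length * C + i) = σ.arr 20 i) ∧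
      ∀ i < l.length * C, τ.arr 13 i = σ.arr 13 i) ?_ ?_ (by decide) ⟨by simp, fun i hi => ?_⟩ ?_)
      (T' := 2) ?_))).mono (by simp only [Prog.size]; omega) fun _ _ h => h
  · simp [Prog.exec, State.setArr, hT.r1]
  · simp [Prog.exec, State.setArr, hT.r6]
  · simp [Prog.exec, State.setArr, State.setReg]
  · intro k τ hk hF hi ⟨g1, g2⟩
    have e20 : τ.arr 20 = σ.arr 20 := hF.arr 20 (by decide)
    have e12 : τ.reg 12 = l.length * C := (hF.reg 12 (by decide)).trans h2
    refine Exec.straight rfl ?_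
    simp only [Prog.exec, State.setReg, State.setArr, Function.update_apply, Nat.reduceEqDiff,
      if_true, if_false, e20, e12, hi]
    refine ⟨fun i hi => ?_, fun i hi => ?_⟩
    · rcases Nat.lt_succ_iff_lt_or_eq.1 hi with h | rfl
      · rw [if_neg (by omega), g1 i h]
      · simp
    · rw [if_neg (by omega), g2 i hi]
  · intro τ hF ⟨g1, g2⟩
    have e11 : τ.arr 11 = Function.update (σ.arr 11) l.length s := by
      rw [hF.arr 11 (by decide)]
      simp [Prog.exec, State.setArr, h1, hs]
    have e12 : τ.arr 12 = Function.update (σ.arr 12) l.length (valueCode v) := by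
      rw [hF.arr 12 (by decide)]
      simp [Prog.exec, State.setArr, h1, hv]
    have e1 : τ.reg 1 = C := (hF.reg 1 (by decide)).trans hT.r1
    have e6 : τ.reg 6 = 1 := (hF.reg 6 (by decide)).trans hT.r6
    have r11 : τ.reg 11 = l.length := (hF.reg 11 (by decide)).trans h1
    have r12 : τ.reg 12 = l.length * C := (hF.reg 12 (by decide)).trans h2
    refine Exec.straight rfl ⟨?_, ?_, ?_, ?_, ?_, ?_⟩
    · simp [Prog.exec, State.setReg, r11, e6]
    · simp [Prog.exec, State.setReg, r12, e1, add_mul]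
    · simp [Prog.exec, State.setReg, e11]
    · simp [Prog.exec, State.setReg, e12]
    · intro x
      change τ.arr 13 _ ≠ 0 ↔ _
      rw [g1 x x.2]
      exact hX x
    · refine h3.congr (fun i hi => ?_) (fun i hi => ?_) g2
      · simp [Prog.exec, State.setReg, e11, hi.ne]
      · simp [Prog.exec, State.setReg, e12, hi.ne]

theorem push_spec {σ : State} {X : Set (Fin C)} {S : Set (Fin L)} {v : Option (Fin D)}
    {l : List (SearchNode (Fin D) (Fin L) (Fin C))} (hT : Tables I rep σ)
    (hX : IsSet (σ.arr 20) X) (hS : IsSet (σ.arr 31) S) (hv : σ.reg 15 = valueCode v)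
    (hl : Pending l σ) :
    Exec push σ (30 * (L * C)) fun τ =>
      ∃ cs : List (SearchNode (Fin D) (Fin L) (Fin C)), cs.Nodup ∧
        (∀ nd, nd ∈ cs ↔ nd.state ∈ S ∧ nd.value = v ∧ nd.contributors = X) ∧
        Pending (cs ++ l) τ := by
  obtain ⟨hL, hC, -⟩ := hT.pos
  refine (Exec.forN (N := L) (c := 6 * C + 9) (fun k τ =>
    ∃ cs : List (SearchNode (Fin D) (Fin L) (Fin C)), cs.Nodup ∧
      (∀ nd, nd ∈ cs ↔ (nd.state : ℕ) < k ∧ nd.state ∈ S ∧ nd.value = v ∧ nd.contributors = X) ∧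
      Pending (cs ++ l) τ) hT.r0 hT.r6 (by decide) ⟨[], List.nodup_nil, by simp, ?_⟩ ?_).mono ?_ ?_
  · exact ⟨by simpa [State.setReg] using hl.length, by simpa [State.setReg] using hl.offset,
      hl.stored⟩
  · intro k τ hk hF hi ⟨cs, h1, h2, h3⟩
    set τ' := (Prog.load 52 31 50).exec τ with hτ'
    have hT' : Tables I rep τ' :=
      (hT.frame hF (by decide) (by decide)).exec rfl (by decide) (by decide)
    have e52 : τ'.reg 52 = σ.arr 31 k := by
      simp [hτ', Prog.exec, State.setReg, hi, hF.arr 31 (by decide)]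
    have e31 : σ.arr 31 k ≠ 0 ↔ (⟨k, hk⟩ : Fin L) ∈ S := hS ⟨k, hk⟩
    have hp : Pending (cs ++ l) τ' :=
      ⟨by simpa [hτ', Prog.exec, State.setReg] using h3.length,
        by simpa [hτ', Prog.exec, State.setReg] using h3.offset, h3.stored⟩
    have upd : ∀ {ls : List (SearchNode (Fin D) (Fin L) (Fin C))} {υ : State} {a b : ℕ},
        Pending ls υ → Pending ls ((υ.setReg 50 a).setReg 51 b) := fun h =>
      ⟨by simpa [State.setReg] using h.length, by simpa [State.setReg] using h.offset, h.stored⟩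
    refine (Exec.straight_seq rfl (Exec.cond (T := 6 * C + 7) (fun h => ?_) fun h => ?_)).mono
      (by simp only [Prog.size]; omega) fun _ _ h => h
    · refine (push_node_spec (X := X) (v := v) (s := ⟨k, hk⟩) hT' ?_ ?_ ?_ hp).mono le_rfl
        fun υ _ hυ => ⟨⟨⟨k, hk⟩, v, X⟩ :: cs, ?_, fun nd => ?_, upd hυ⟩
      · change IsSet (τ.arr 20) X
        rw [hF.arr 20 (by decide)]
        exact hX
      · simpa [hτ', Prog.exec, State.setReg, hF.reg 15 (by decide)] using hv
      · simp [hτ', Prog.exec, State.setReg, hi]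
      · refine List.nodup_cons.2 ⟨fun hmem => ?_, h1⟩
        exact absurd ((h2 _).1 hmem).1 (lt_irrefl k)
      · rw [List.mem_cons, h2]
        constructor
        · rintro (rfl | ⟨a, b⟩)
          · exact ⟨Nat.lt_succ_self k, e31.1 (e52 ▸ h), rfl, rfl⟩
          · exact ⟨by omega, b⟩
        · rintro ⟨a, b, c, d⟩
          rcases Nat.lt_succ_iff_lt_or_eq.1 a with h' | h'
          · exact Or.inr ⟨h', b, c, d⟩
          · left
            cases nd
            simp only [SearchNode.mk.injEq]
            exact ⟨Fin.ext h', c, d⟩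
    · refine (Exec.straight (p := skip) rfl ⟨cs, h1, fun nd => ?_, upd ?_⟩).mono
        (by simp only [skip, Prog.size]; omega) fun _ _ h => h
      · rw [h2]
        refine ⟨fun ⟨a, b⟩ => ⟨by omega, b⟩, fun ⟨a, b⟩ => ⟨?_, b⟩⟩
        rcases Nat.lt_succ_iff_lt_or_eq.1 a with h' | h'
        · exact h'
        · have : nd.state = ⟨k, hk⟩ := Fin.ext h'
          exact absurd (e52 ▸ h) (e31.2 (this ▸ b.1))
      · exact ⟨by simpa [skip, Prog.exec, State.setReg] using h3.length,
          by simpa [skip, Prog.exec, State.setReg] using h3.offset, hp.stored⟩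
  · nlinarith [Nat.mul_le_mul hL hC, Nat.le_mul_of_pos_right L hC]
  · rintro τ - ⟨cs, h1, h2, h3⟩
    exact ⟨cs, h1, fun nd => by simp [h2], h3⟩

end RAM

namespace RAM

variable {L C D : ℕ} {I : LCRInstance L C D} {rep : Fin L → Fin L}

/-! ### Processing a node -/

/-- Add the nodes that are reached by leaving the component in array `29` by a move in array `32`. -/
def pushCrossings : Prog := crossings ⨟ push

theorem pushCrossings_spec {σ : State} {T : Set (Fin L)} {R : Fin L → Fin L → Prop}
    {X : Set (Fin C)} {v : Option (Fin D)} {l : List (SearchNode (Fin D) (Fin L) (Fin C))}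
    (hT : Tables I rep σ) (hset : IsSet (σ.arr 29) T) (hR : IsRel (σ.arr 32) R)
    (hX : IsSet (σ.arr 20) X) (hv : σ.reg 15 = valueCode v) (hl : Pending l σ) :
    Exec pushCrossings σ (70 * (L * L * C)) fun τ =>
      ∃ cs : List (SearchNode (Fin D) (Fin L) (Fin C)), cs.Nodup ∧
        (∀ nd, nd ∈ cs ↔ (∃ p ∈ T, ∃ p' ∉ T, R p p' ∧ nd.state = rep p') ∧ nd.value = v ∧
          nd.contributors = X) ∧ Pending (cs ++ l) τ := by
  obtain ⟨hL, hC, -⟩ := hT.pos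
  refine (Exec.bind (crossings_spec hT hset hR) (T' := 30 * (L * C)) ?_).mono ?_
    fun _ _ h => h
  · intro τ hF hτ
    refine (push_spec (X := X) (v := v) (hT.frame hF (by decide) (by decide)) (by rwa [hF.arr 20 (by decide)]) hτ
      (by rwa [hF.reg 15 (by decide)]) (hl.frame hF (by decide) (by decide))).mono le_rfl
      fun υ _ ⟨cs, h1, h2, h3⟩ => ⟨cs, h1, fun nd => ?_, h3⟩
    simp [h2, eq_comm]
  · have := Nat.le_mul_of_pos_right (L * L) hC
    have := Nat.mul_le_mul_right C (Nat.le_mul_self L)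
    omega

/-- Register `13` is set if the component in array `29` contains an unsafe state. -/
def checkBad : Prog :=
  forN 22 0 (.load 24 29 22 ⨟ .cond 24 (.load 25 0 22 ⨟ .cond 25 (.const 13 1) skip) skip)

theorem checkBad_spec {σ : State} {T : Set (Fin L)} (hT : Tables I rep σ)
    (hset : IsSet (σ.arr 29) T) :
    Exec checkBad σ (9 * L + 3) fun τ => τ.reg 13 ≠ 0 ↔ σ.reg 13 ≠ 0 ∨ ∃ p ∈ T, p ∈ I.bad := by
  refine (Exec.forN (N := L) (c := 5) (fun k τ => τ.reg 13 ≠ 0 ↔ σ.reg 13 ≠ 0 ∨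
    ∃ p ∈ T, (p : ℕ) < k ∧ p ∈ I.bad) hT.r0 hT.r6 (by decide) (by simp [State.setReg]) ?_).mono
    (by omega) fun τ _ h => by simpa using h
  intro k τ hk hF hi g
  set p₀ : Fin L := ⟨k, hk⟩ with hp₀
  have f1 : τ.arr 29 k ≠ 0 ↔ p₀ ∈ T := by
    rw [hF.arr 29 (by decide)]
    exact hset p₀
  have f2 : τ.arr 0 k ≠ 0 ↔ p₀ ∈ I.bad := (hT.frame hF (by decide) (by decide)).bad p₀
  have hlt : (∃ p ∈ T, (p : ℕ) < k + 1 ∧ p ∈ I.bad) ↔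
      (∃ p ∈ T, (p : ℕ) < k ∧ p ∈ I.bad) ∨ (p₀ ∈ T ∧ p₀ ∈ I.bad) := by
    constructor
    · rintro ⟨p, h1, h2, h3⟩
      rcases Nat.lt_succ_iff_lt_or_eq.1 h2 with h | h
      · exact Or.inl ⟨p, h1, h, h3⟩
      · obtain rfl : p = p₀ := Fin.ext h
        exact Or.inr ⟨h1, h3⟩
    · rintro (⟨p, h1, h2, h3⟩ | ⟨h1, h2⟩)
      · exact ⟨p, h1, by omega, h3⟩
      · exact ⟨p₀, h1, Nat.lt_succ_self k, h2⟩
  rw [hlt, ← or_assoc, ← g]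
  refine Exec.straight rfl ?_
  by_cases a1 : τ.arr 29 k = 0
  · have : p₀ ∉ T := fun h => f1.2 h a1
    simp [Prog.exec, State.setReg, skip, hi, a1, this]
  · by_cases a2 : τ.arr 0 k = 0
    · have : p₀ ∉ I.bad := fun h => f2.2 h a2
      simp [Prog.exec, State.setReg, skip, hi, a1, a2, this]
    · simp [Prog.exec, State.setReg, hi, a1, a2, f1.1 a1, f2.1 a2]

/-- Add the children of the node that is processed: its contributor states are in array `20`, the
moves of the leader in array `25` and its component in array `29`. -/
def pushChildren : Prog :=
  .const 72 0 ⨟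
  forN 70 2 (
    .add 20 72 7 ⨟ copySeg 32 2 8 ⨟ .add 15 70 7 ⨟ pushCrossings ⨟ .add 72 72 8) ⨟
  .add 15 2 7 ⨟ .const 20 0 ⨟ copySeg 32 25 8 ⨟ pushCrossings

set_option maxRecDepth 8000 in
/-- The children with a value come from the writes of that value, those without a value from all moves in
the adjacency matrix of the leader. They are pairwise distinct, as a node is determined by its
representative and its value. -/
theorem pushChildren_spec {σ : State} {nd : SearchNode (Fin D) (Fin L) (Fin C)}
    {l : List (SearchNode (Fin D) (Fin L) (Fin C))} (hT : Tables I rep σ)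
    (hX : IsSet (σ.arr 20) (nd.reached I.leader I.contributor))
    (hE : IsRel (σ.arr 25) (I.leader.restrict (nd.values I.leader I.contributor)).Edge)
    (hset : IsSet (σ.arr 29) (nd.component I.leader I.contributor)) (hl : Pending l σ) :
    Exec pushChildren σ (200 * (L * L * D * C)) fun τ =>
      ∃ cs : List (SearchNode (Fin D) (Fin L) (Fin C)), cs.Nodup ∧
        (∀ nd', nd' ∈ cs ↔ nd.Child I.leader I.contributor rep nd') ∧ Pending (cs ++ l) τ := by
  obtain ⟨hL, hC, hD⟩ := hT.pos
  set T := nd.component I.leader I.contributor with hTdef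
  set X := nd.reached I.leader I.contributor with hXdef
  have hT₀ : Tables I rep ((Prog.const 72 0).exec σ) := hT.exec rfl (by decide) (by decide)
  have hl₀ : Pending l ((Prog.const 72 0).exec σ) := by
    refine hl.frame (Run.frame (.const σ 72 0)) (by decide) (by decide)
  refine (Exec.straight_seq rfl (Exec.bind (Exec.forN (N := D)
    (c := 6 * (L * L) + 70 * (L * L * C) + 6) (fun k τ => τ.reg 72 = k * (L * L) ∧
      ∃ cs : List (SearchNode (Fin D) (Fin L) (Fin C)), cs.Nodup ∧
      (∀ nd', nd' ∈ cs ↔ ∃ a : Fin D, (a : ℕ) < k ∧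
        (∃ p ∈ T, ∃ p' ∉ T, (p, some (Op.write a), p') ∈ I.leader.trans ∧ nd'.state = rep p') ∧
        nd'.value = some a ∧ nd'.contributors = X) ∧ Pending (cs ++ l) τ)
    hT₀.r2 hT₀.r6 (by decide) ⟨?_, [], List.nodup_nil, by simp, ?_⟩ ?_)
    (T' := 6 * (L * L) + 5 + 70 * (L * L * C)) ?_)).mono ?_ fun _ _ h => h
  · simp [Prog.exec, State.setReg]
  · exact ⟨by simpa [State.setReg] using hl₀.length, by simpa [State.setReg] using hl₀.offset,
      hl₀.stored⟩
  · intro k τ hk hF hi ⟨g1, cs, h1, h2, h3⟩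
    set a₀ : Fin D := ⟨k, hk⟩ with ha₀
    have hTτ : Tables I rep τ := hT₀.frame hF (by decide) (by decide)
    have hTτ' : Tables I rep ((Prog.add 20 72 7).exec τ) :=
      hTτ.exec rfl (by decide) (by decide)
    refine (Exec.straight_seq rfl (Exec.bind (copySeg_spec (dst := 32) (src := 2) (n := 8)
      (N := L * L) hTτ'.r8 hTτ'.r6 (by norm_num) (by norm_num))
      (T' := 1 + (70 * (L * L * C) + 1)) ?_)).mono (by simp only [Prog.size]; omega)
      fun _ _ h => h
    intro υ hυF hυ
    have hTυ : Tables I rep ((Prog.add 15 70 7).exec υ) :=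
      (hTτ'.frame hυF (by decide) (by decide)).exec rfl (by decide) (by decide)
    have u7 : υ.reg 7 = 0 := (hTτ'.frame hυF (by decide) (by decide)).r7
    have hpend : Pending (cs ++ l) ((Prog.add 15 70 7).exec υ) :=
      ((h3.frame (Run.frame (.add τ 20 72 7)) (by decide) (by decide)).frame hυF (by decide)
        (by decide)).frame (Run.frame (.add υ 15 70 7)) (by decide) (by decide)
    refine Exec.straight_seq rfl (Exec.bind (pushCrossings_spec (T := T) (X := X)
      (R := fun p p' => (p, some (Op.write a₀), p') ∈ I.leader.trans) (v := some a₀) hTυ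
      ?_ ?_ ?_ ?_ hpend) (T' := 1) ?_)
    · change IsSet (υ.arr 29) T
      rw [hυF.arr 29 (by decide)]
      change IsSet (τ.arr 29) T
      rw [hF.arr 29 (by decide)]
      exact hset
    · intro x y
      change υ.arr 32 _ ≠ 0 ↔ _
      rw [hυ _ (pair_lt x.2 y.2)]
      have := hTτ.writeL a₀ x y
      simpa [Prog.exec, State.setReg, g1, hTτ.r7, ha₀] using this
    · change IsSet (υ.arr 20) X
      rw [hυF.arr 20 (by decide)]
      change IsSet (τ.arr 20) X
      rw [hF.arr 20 (by decide)]
      exact hX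
    · have e70 : υ.reg 70 = k := by
        rw [hυF.reg 70 (by decide)]
        simpa [Prog.exec, State.setReg] using hi
      simp [Prog.exec, State.setReg, e70, u7, valueCode, ha₀]
    · intro ρ hρF ⟨cs', r1, r2, r3⟩
      have e72 : ρ.reg 72 = k * (L * L) := by
        rw [hρF.reg 72 (by decide)]
        have : υ.reg 72 = τ.reg 72 := by
          rw [hυF.reg 72 (by decide)]
          simp [Prog.exec, State.setReg]
        simpa [Prog.exec, State.setReg, this] using g1
      have e8 : ρ.reg 8 = L * L := (hTυ.frame hρF (by decide) (by decide)).r8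
      refine Exec.straight rfl ⟨?_, cs' ++ cs, List.nodup_append'.2 ⟨r1, h1, ?_⟩,
        fun nd' => ?_, ?_⟩
      · simp only [Prog.exec, State.setReg, Function.update_apply, Nat.reduceEqDiff, if_true,
          if_false, e72, e8]
        ring
      · rw [List.disjoint_left]
        intro x hx hx'
        obtain ⟨a, b1, -, b2, -⟩ := (h2 x).1 hx'
        have b3 := ((r2 x).1 hx).2.1
        rw [b2, Option.some.injEq] at b3
        rw [b3] at b1
        exact lt_irrefl k b1
      · rw [List.mem_append, r2, h2]
        constructor
        · rintro (h | ⟨a, b, h⟩)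
          · exact ⟨a₀, Nat.lt_succ_self k, h⟩
          · exact ⟨a, by omega, h⟩
        · rintro ⟨a, b, h⟩
          rcases Nat.lt_succ_iff_lt_or_eq.1 b with h' | h'
          · exact Or.inr ⟨a, h', h⟩
          · obtain rfl : a = a₀ := Fin.ext h'
            exact Or.inl h
      · rw [List.append_assoc]
        exact ⟨by simpa [Prog.exec, State.setReg] using r3.length,
          by simpa [Prog.exec, State.setReg] using r3.offset, r3.stored⟩
  · rintro τ hF ⟨-, cs, h1, h2, h3⟩
    have hTτ : Tables I rep τ := hT₀.frame hF (by decide) (by decide)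
    have hTτ' : Tables I rep ((Prog.const 20 0).exec ((Prog.add 15 2 7).exec τ)) :=
      (hTτ.exec (p := .add 15 2 7) rfl (by decide) (by decide)).exec rfl (by decide) (by decide)
    refine (Exec.straight_seq rfl (Exec.straight_seq rfl (Exec.bind (copySeg_spec (dst := 32)
      (src := 25) (n := 8) (N := L * L) hTτ'.r8 hTτ'.r6 (by norm_num) (by norm_num))
      (T' := 70 * (L * L * C)) ?_))).mono (by simp only [Prog.size]; omega) fun _ _ h => h
    intro υ hυF hυ
    have hTυ : Tables I rep υ := hTτ'.frame hυF (by decide) (by decide)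
    have hpend : Pending (cs ++ l) υ :=
      ((h3.frame (Run.frame (.add τ 15 2 7)) (by decide) (by decide)).frame
        (Run.frame (.const _ 20 0)) (by decide) (by decide)).frame hυF (by decide) (by decide)
    refine (pushCrossings_spec (T := T) (X := X)
      (R := (I.leader.restrict (nd.values I.leader I.contributor)).Edge) (v := none) hTυ
      ?_ ?_ ?_ ?_ hpend).mono le_rfl ?_
    · rw [hυF.arr 29 (by decide)]
      change IsSet (τ.arr 29) T
      rw [hF.arr 29 (by decide)]
      exact hset
    · intro x y
      rw [hυ _ (pair_lt x.2 y.2)]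
      have : τ.arr 25 = σ.arr 25 := hF.arr 25 (by decide)
      simpa [Prog.exec, State.setReg, this] using hE x y
    · rw [hυF.arr 20 (by decide)]
      change IsSet (τ.arr 20) X
      rw [hF.arr 20 (by decide)]
      exact hX
    · rw [hυF.reg 15 (by decide)]
      simp [Prog.exec, State.setReg, hTτ.r2, hTτ.r7, valueCode]
    · rintro ρ - ⟨cs', r1, r2, r3⟩
      refine ⟨cs' ++ cs, List.nodup_append'.2 ⟨r1, h1, ?_⟩, fun nd' => ?_, ?_⟩
      · rw [List.disjoint_left]
        intro x hx hx'
        obtain ⟨a, -, -, b2, -⟩ := (h2 x).1 hx'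
        have b3 := ((r2 x).1 hx).2.1
        simp [b2] at b3
      · rw [List.mem_append, r2, h2]
        constructor
        · rintro (⟨⟨p, hp, p', hp', h, hs⟩, hv, hX⟩ | ⟨a, -, ⟨p, hp, p', hp', h, hs⟩, hv, hX⟩)
          · exact ⟨p, hp, p', hp', hs, hX, Or.inr ⟨hv, h⟩⟩
          · exact ⟨p, hp, p', hp', hs, hX, Or.inl ⟨a, hv, h⟩⟩
        · rintro ⟨p, hp, p', hp', hs, hX, ⟨a, hv, h⟩ | ⟨hv, h⟩⟩
          · exact Or.inr ⟨a, a.2, ⟨p, hp, p', hp', h, hs⟩, hv, hX⟩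
          · exact Or.inl ⟨⟨p, hp, p', hp', h, hs⟩, hv, hX⟩
      · rwa [List.append_assoc]
  · have m1 : L * L ≤ L * L * C := Nat.le_mul_of_pos_right _ hC
    have m2 : L * L * C ≤ L * L * D * C := by
      rw [mul_right_comm (L * L)]
      exact Nat.le_mul_of_pos_right _ hD
    have m3 : 1 ≤ L * L := Nat.mul_pos hL hL
    have m4 : D * (6 * (L * L) + 70 * (L * L * C) + 6 + 3) ≤ D * (85 * (L * L * C)) :=
      Nat.mul_le_mul_left D (by omega)
    have m5 : D * (85 * (L * L * C)) = 85 * (L * L * D * C) := by ring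
    simp only [Prog.size]
    omega

/-- Take a pending node, check its component and add its children. -/
def processNode : Prog :=
  pop ⨟ readValue ⨟ saturate ⨟ checkBad ⨟ pushChildren

set_option maxRecDepth 8000 in
theorem processNode_spec {σ : State} {nd : SearchNode (Fin D) (Fin L) (Fin C)}
    {l : List (SearchNode (Fin D) (Fin L) (Fin C))} (hT : Tables I rep σ)
    (hl : Pending (nd :: l) σ) :
    Exec processNode σ (1500 * (L * L * D * (C * C))) fun τ =>
      (τ.reg 13 ≠ 0 ↔ σ.reg 13 ≠ 0 ∨ ∃ p ∈ nd.component I.leader I.contributor, p ∈ I.bad) ∧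
      ∃ cs : List (SearchNode (Fin D) (Fin L) (Fin C)), cs.Nodup ∧
        (∀ nd', nd' ∈ cs ↔ nd.Child I.leader I.contributor rep nd') ∧ Pending (cs ++ l) τ := by
  obtain ⟨hL, hC, hD⟩ := hT.pos
  refine (Exec.bind (pop_spec hT hl) (T' := 100 * (D * (C * C)) +
    (1000 * (L * L * D * (C * C)) + (9 * L + 3 + 200 * (L * L * D * C)))) ?_).mono ?_
    fun _ _ h => h
  · intro τ₁ hF₁ ⟨hl₁, hq₁, hv₁, hX₁⟩
    have hT₁ := hT.frame hF₁ (by decide) (by decide)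
    refine Exec.bind (readValue_spec hT₁.toInputs hv₁ hX₁) ?_
    intro τ₂ hF₂ hX₂
    have hT₂ := hT₁.frame hF₂ (by decide) (by decide)
    refine Exec.bind (saturate_spec (q := nd.state) hT₂
      (by rw [hF₂.reg 14 (by decide), hq₁]) hX₂) ?_
    intro τ₃ hF₃ ⟨hX₃, hE₃, hS₃⟩
    have hT₃ := hT₂.frame hF₃ (by decide) (by decide)
    refine Exec.bind (checkBad_spec hT₃ hS₃) ?_
    intro τ₄ hF₄ h₄
    have hT₄ := hT₃.frame hF₄ (by decide) (by decide)
    have hl₄ := ((hl₁.frame hF₂ (by decide) (by decide)).frame hF₃ (by decide) (by decide)).frame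
      hF₄ (by decide) (by decide)
    refine (pushChildren_spec (nd := nd) hT₄ (by rw [hF₄.arr 20 (by decide)]; exact hX₃)
      (by rw [hF₄.arr 25 (by decide)]; exact hE₃) (by rw [hF₄.arr 29 (by decide)]; exact hS₃)
      hl₄).mono le_rfl fun τ₅ hF₅ h₅ => ⟨?_, h₅⟩
    rw [hF₅.reg 13 (by decide), h₄, hF₃.reg 13 (by decide), hF₂.reg 13 (by decide),
      hF₁.reg 13 (by decide)]
    rfl
  · have m0 : 1 ≤ L * L := Nat.mul_pos hL hL
    have m1 : D * (C * C) ≤ L * L * (D * (C * C)) := Nat.le_mul_of_pos_left _ m0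
    have m2 : L * L * D * C ≤ L * L * D * (C * C) := Nat.mul_le_mul_left _ (Nat.le_mul_self C)
    have m3 : L ≤ L * L := Nat.le_mul_self L
    have m4 : L * L ≤ L * L * (D * C) := Nat.le_mul_of_pos_right _ (Nat.mul_pos hD hC)
    have m5 : C ≤ D * (C * C) := (Nat.le_mul_self C).trans (Nat.le_mul_of_pos_left _ hD)
    have m6 : L * L * (D * C) ≤ L * L * D * (C * C) := by
      rw [← mul_assoc]
      exact m2
    have m7 : L * L * (D * (C * C)) = L * L * D * (C * C) := by ring
    omega

/-- Process nodes until none is pending. -/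
def searchLoop : Prog := .loop 11 processNode

set_option maxRecDepth 8000 in
/-- The budget of the loop is the sum of the weights of the pending nodes, each multiplied by the time for
one node. -/
theorem searchLoop_spec {σ : State} {l : List (SearchNode (Fin D) (Fin L) (Fin C))}
    (hrep : ∀ p, rep p ∈ (I.leader.restrict ∅).sccOf p)
    (hrep' : ∀ p, ∀ p' ∈ (I.leader.restrict ∅).sccOf p, rep p' = rep p)
    (hT : Tables I rep σ) (h13 : σ.reg 13 = 0) (hn : l.Nodup)
    (hl : ∀ nd, nd ∈ l ↔ nd.IsRoot I.leader I.contributor I.initValue rep) (hp : Pending l σ) :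
    Exec searchLoop σ (I.leader.witSCC * (1500 * (L * L * D * (C * C)) + 1) + 1) fun τ =>
      (τ.reg 13 ≠ 0 ↔ ∃ nd : SearchNode (Fin D) (Fin L) (Fin C),
        nd.Found I.leader I.contributor I.initValue rep ∧
          ∃ p ∈ nd.component I.leader I.contributor, p ∈ I.bad) := by
  set P : SearchNode (Fin D) (Fin L) (Fin C) → Prop := fun nd =>
    ∃ p ∈ nd.component I.leader I.contributor, p ∈ I.bad with hP
  set w := SearchNode.weight I.leader I.contributor (I.leader.numSCC * (D + 1)) with hw
  set c := 1500 * (L * L * D * (C * C)) + 1 with hc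
  have hfound : ∀ {nd}, nd ∈ l → nd.Found I.leader I.contributor I.initValue rep :=
    fun h => ⟨_, (hl _).1 h, .refl⟩
  have hchild : ∀ (nd : SearchNode (Fin D) (Fin L) (Fin C)) (cs : List _), cs.Nodup →
      (∀ nd' ∈ cs, nd.Child I.leader I.contributor rep nd') → (cs.map w).sum + 1 ≤ w nd :=
    fun nd cs h1 h2 => SearchNode.weight_children hrep hrep' h1 h2
  -- every node that is still to be found lies below a pending one
  refine (Exec.loop (fun b τ => Tables I rep τ ∧
    ∃ l' : List (SearchNode (Fin D) (Fin L) (Fin C)), Pending l' τ ∧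
      (∀ nd ∈ l', nd.Found I.leader I.contributor I.initValue rep) ∧
      ((∃ nd : SearchNode (Fin D) (Fin L) (Fin C),
        nd.Found I.leader I.contributor I.initValue rep ∧ P nd) ↔ τ.reg 13 ≠ 0 ∨
        ∃ nd ∈ l', ∃ nd', Relation.ReflTransGen (SearchNode.Child I.leader I.contributor rep)
          nd nd' ∧ P nd') ∧
      (l'.map w).sum * c ≤ b) ?_ (b := I.leader.witSCC * c)
    ⟨hT, l, hp, fun nd h => hfound h, ?_, ?_⟩).mono le_rfl ?_
  · rintro b τ - ⟨hT', l', h1, h2, h3, h4⟩ hne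
    cases l' with
    | nil => exact absurd h1.length hne
    | cons nd l' =>
      refine ⟨b - c, c - 1, ?_, ?_⟩
      · have h5 := hchild nd [] List.nodup_nil (by simp)
        have h6 : 1 * c ≤ ((nd :: l').map w).sum * c := by
          refine Nat.mul_le_mul_right c ?_
          rw [List.map_cons, List.sum_cons]
          simp only [List.map_nil, List.sum_nil] at h5
          omega
        omega
      · refine (processNode_spec hT' h1).mono (by omega) ?_
        rintro υ hF ⟨u1, cs, u2, u3, u4⟩
        refine ⟨hT'.frame hF (by decide) (by decide), cs ++ l', u4, ?_, ?_, ?_⟩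
        · intro nd' hnd'
          rcases List.mem_append.1 hnd' with h | h
          · obtain ⟨root, r1, r2⟩ := h2 nd List.mem_cons_self
            exact ⟨root, r1, r2.tail ((u3 nd').1 h)⟩
          · exact h2 nd' (List.mem_cons_of_mem _ h)
        · rw [h3, u1, or_assoc]
          refine or_congr_right ?_
          constructor
          · rintro ⟨x, hx, y, hxy, hy⟩
            rcases List.mem_cons.1 hx with rfl | hx
            · rcases Relation.ReflTransGen.cases_head hxy with rfl | ⟨z, hz, hzy⟩
              · exact Or.inl hy
              · exact Or.inr ⟨z, List.mem_append_left _ ((u3 z).2 hz), y, hzy, hy⟩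
            · exact Or.inr ⟨x, List.mem_append_right _ hx, y, hxy, hy⟩
          · rintro (h | ⟨x, hx, y, hxy, hy⟩)
            · exact ⟨nd, List.mem_cons_self, nd, .refl, h⟩
            · rcases List.mem_append.1 hx with hx | hx
              · exact ⟨nd, List.mem_cons_self, y, .head ((u3 x).1 hx) hxy, hy⟩
              · exact ⟨x, List.mem_cons_of_mem _ hx, y, hxy, hy⟩
        · have h5 := hchild nd cs u2 fun x hx => (u3 x).1 hx
          rw [List.map_append, List.sum_append]
          rw [List.map_cons, List.sum_cons] at h4
          have h6 := Nat.mul_le_mul_right c (Nat.add_le_add_right h5 (l'.map w).sum)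
          have h7 : (List.map w cs).sum + 1 + (List.map w l').sum =
            (List.map w cs).sum + (List.map w l').sum + 1 := by omega
          rw [h7, add_mul _ 1, one_mul] at h6
          omega
  · constructor
    · rintro ⟨nd, ⟨root, h1, h2⟩, h3⟩
      exact Or.inr ⟨root, (hl _).2 h1, nd, h2, h3⟩
    · rintro (h | ⟨root, h1, nd, h2, h3⟩)
      · exact absurd h13 h
      · exact ⟨nd, ⟨root, (hl _).1 h1, h2⟩, h3⟩
  · exact Nat.mul_le_mul_right c (SearchNode.weight_roots hT.pos.2.2 hrep' hn
      fun nd h => (hl nd).1 h)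
  · rintro τ - ⟨h0, b, -, l', h1, -, h3, -⟩
    obtain rfl : l' = [] := List.length_eq_zero_iff.1 (h1.length.symm.trans h0)
    rw [h3]
    simp

end RAM

namespace RAM

variable {L C D : ℕ} {I : LCRInstance L C D} {rep : Fin L → Fin L}

/-! ### Preparation -/

/-- Products of the sizes, and the number `1`. -/
def sizes : Prog := .const 6 1 ⨟ mulReg 8 0 0 ⨟ mulReg 9 1 1 ⨟ mulReg 10 2 1

theorem sizes_spec (I : LCRInstance L C D) :
    Exec sizes I.input (30 * (L * L * D * (C * C))) fun τ => Inputs I τ := by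
  have hL : 1 ≤ L := I.leader.init.pos
  have hC : 1 ≤ C := I.contributor.init.pos
  have hD : 1 ≤ D := I.initValue.pos
  refine (Exec.straight_seq rfl (Exec.bind (mulReg_spec (X := L) (Y := L) ?_ ?_ ?_ (by decide))
    (T' := 4 * C + 4 + (4 * C + 4)) ?_)).mono ?_ fun _ _ h => h
  · rfl
  · rfl
  · rfl
  · intro τ₁ hF₁ h₁
    refine Exec.bind (mulReg_spec (X := C) (Y := C) ?_ ?_ ?_ (by decide)) ?_
    · rw [hF₁.reg 1 (by decide)]
      rfl
    · rw [hF₁.reg 1 (by decide)]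
      rfl
    · rw [hF₁.reg 6 (by decide)]
      rfl
    intro τ₂ hF₂ h₂
    refine (mulReg_spec (X := D) (Y := C) ?_ ?_ ?_ (by decide)).mono le_rfl ?_
    · rw [hF₂.reg 2 (by decide), hF₁.reg 2 (by decide)]
      rfl
    · rw [hF₂.reg 1 (by decide), hF₁.reg 1 (by decide)]
      rfl
    · rw [hF₂.reg 6 (by decide), hF₁.reg 6 (by decide)]
      rfl
    intro τ₃ hF₃ h₃
    have hr : ∀ x ∈ [0, 1, 2, 3, 4, 5, 6, 7],
        τ₃.reg x = ((Prog.const 6 1).exec I.input).reg x := by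
      intro x hx
      rw [hF₃.reg x, hF₂.reg x, hF₁.reg x] <;>
      · simp only [List.mem_cons, List.not_mem_nil, or_false] at hx
        simp [mulReg, Prog.regs, forN_regs]
        omega
    have ha : ∀ k, τ₃.arr k = I.input.arr k := by
      intro k
      rw [hF₃.arr k, hF₂.arr k, hF₁.arr k]
      · rfl
      all_goals simp [mulReg, Prog.arrs, forN_arrs]
    constructor
    all_goals
      first
      | rw [ha]
      | rw [hr _ (by decide)]
      | skip
    any_goals rfl
    · rw [hF₃.reg 8 (by decide), hF₂.reg 8 (by decide), h₁]
    · rw [hF₃.reg 9 (by decide), h₂]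
    · exact h₃
    · intro q
      change bit01 _ ≠ 0 ↔ _
      rw [bit01_ne_zero]
      exact ⟨fun ⟨q', h, h'⟩ => Fin.ext h ▸ h', fun h => ⟨q, rfl, h⟩⟩
    · exact isRel_epsTable _
    · exact isTable_opTable _ _
    · exact isTable_opTable _ _
    · exact isRel_epsTable _
    · exact isTable_opTable _ _
    · exact isTable_opTable _ _
    · exact fun i => rfl
  · set U := L * L * D * (C * C) with hU
    have h1 : L ≤ U := by
      rw [show U = L * (L * D * (C * C)) by rw [hU]; ring]
      exact Nat.le_mul_of_pos_right _ (by positivity)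
    have h2 : C ≤ U := by
      rw [show U = C * (L * L * D * C) by rw [hU]; ring]
      exact Nat.le_mul_of_pos_right _ (by positivity)
    simp only [Prog.size]
    omega

/-- The matrix `dst` becomes the union of the internal moves in the matrix `eps` and of all writes
in the table `wr`. The size of a matrix is in register `nn`. -/
def freeMoves (dst eps wr nn : ℕ) : Prog :=
  .const 20 0 ⨟ copySeg dst eps nn ⨟ addSel dst wr nn 15

theorem freeMoves_spec {dst eps wr nn N : ℕ} {σ : State} {P : Thread (Fin D) (Fin N)}
    (hI : Inputs I σ) (hN : 1 ≤ N) (hnn : σ.reg nn = N * N)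
    (hd : nn < 20 ∧ dst ≠ eps ∧ dst ≠ wr ∧ dst ≠ 15 ∧ 7 ≤ dst ∧ dst ≠ 14)
    (heps : IsRel (σ.arr eps) fun x y => (x, none, y) ∈ P.trans)
    (hwr : IsTable (σ.arr wr) fun a x y => (x, some (Op.write a), y) ∈ P.trans)
    (h15 : IsSet (σ.arr 15) (Set.univ : Set (Fin D))) :
    Exec (freeMoves dst eps wr nn) σ (40 * (D * (N * N))) fun τ =>
      IsRel (τ.arr dst) (P.restrict ∅).Edge := by
  obtain ⟨d1, d2, d3, d4, d5, d6⟩ := hd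
  have hD := hI.pos.2.2
  have hI₀ : Inputs I ((Prog.const 20 0).exec σ) := hI.exec rfl (by decide) (by decide)
  have hnn₀ : ((Prog.const 20 0).exec σ).reg nn = N * N := by
    simp [Prog.exec, State.setReg, hnn, show nn ≠ 20 by omega]
  refine (Exec.straight_seq rfl (Exec.bind (copySeg_spec (dst := dst) (src := eps) (n := nn)
    (N := N * N) hnn₀ hI₀.r6 d1 d2) (T' := 25 * (D * (N * N))) ?_)).mono ?_ fun _ _ h => h
  · intro τ hF hτ
    have ha : ∀ k, k ≠ dst → τ.arr k = σ.arr k := fun k hk =>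
      hF.arr k (by simp [copySeg, forN_arrs, Prog.arrs, hk])
    have hIτ : Inputs I τ := hI₀.frame hF (by simp [copySeg, forN_regs, Prog.regs])
      (by simp [copySeg, forN_arrs, Prog.arrs, d5, d6])
    refine (addSel_spec (R := fun x y => (x, none, y) ∈ P.trans) hIτ hN ?_ ⟨d1, d3, d4⟩ ?_
      (by rw [ha wr d3.symm]; exact hwr) (by rw [ha 15 d4.symm]; exact h15)).mono le_rfl ?_
    · rw [hF.reg nn (by simp [copySeg, forN_regs, Prog.regs]; omega), hnn₀]
    · intro x y
      rw [hτ _ (pair_lt x.2 y.2)]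
      simpa [Prog.exec, State.setReg] using heps x y
    · intro υ _ hυ x y
      refine (hυ x y).trans ?_
      constructor
      · rintro (h | ⟨a, -, h⟩)
        · exact ⟨_, h, by simp⟩
        · exact ⟨_, h, by simp⟩
      · rintro ⟨o, h, h'⟩
        match o, h, h' with
        | none, h, _ => exact Or.inl h
        | some (Op.write a), h, _ => exact Or.inr ⟨a, trivial, h⟩
        | some (Op.read a), h, h' => exact absurd (h' a rfl) (Set.notMem_empty a)
  · have := Nat.le_mul_of_pos_left (N * N) hD
    have := Nat.mul_pos hN hN
    simp only [Prog.size]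
    omega

/-- Array `9` tells which value can be written by contributors in which state. -/
def writeTable : Prog :=
  .const 33 0 ⨟
  forN 50 10 (.const 52 0 ⨟
    forN 54 1 (.load 56 5 33 ⨟ .add 52 52 56 ⨟ .add 33 33 6) ⨟ .store 9 50 52)

theorem writeTable_spec {σ : State} (hI : Inputs I σ) :
    Exec writeTable σ (20 * (D * (C * C))) fun τ => IsWriteTable I.contributor (τ.arr 9) := by
  obtain ⟨hL, hC, hD⟩ := hI.pos
  have hI₀ : Inputs I ((Prog.const 33 0).exec σ) := hI.exec rfl (by decide) (by decide)
  refine (Exec.straight_seq rfl ((Exec.forN (N := D * C) (c := 6 * C + 5) (fun k τ =>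
    τ.reg 33 = k * C ∧ ∀ i < k, (τ.arr 9 i ≠ 0 ↔ ∃ y < C, σ.arr 5 (i * C + y) ≠ 0))
    hI₀.r10 hI₀.r6 (by decide) ⟨by simp [Prog.exec, State.setReg], by simp⟩ ?_).mono le_rfl
    fun τ _ h a x => ?_)).mono ?_ fun _ _ h => h
  · intro k τ hk hF hi ⟨g1, g2⟩
    have hIτ : Inputs I ((Prog.const 52 0).exec τ) :=
      (hI₀.frame hF (by decide) (by decide)).exec rfl (by decide) (by decide)
    have e5 : τ.arr 5 = σ.arr 5 := hF.arr 5 (by decide)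
    refine (Exec.straight_seq rfl (Exec.bind (Exec.forN (N := C) (c := 3) (fun j υ =>
      υ.reg 33 = k * C + j ∧ (υ.reg 52 ≠ 0 ↔ ∃ y < j, σ.arr 5 (k * C + y) ≠ 0))
      hIτ.r1 hIτ.r6 (by decide) ⟨?_, ?_⟩ ?_) (T' := 1) ?_)).mono
      (by simp only [Prog.size]; omega) fun _ _ h => h
    · simpa [Prog.exec, State.setReg] using g1
    · simp [Prog.exec, State.setReg]
    · intro j υ hj hυF hυi ⟨u1, u2⟩
      have f5 : υ.arr 5 = σ.arr 5 := (hυF.arr 5 (by decide)).trans e5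
      have f6 : υ.reg 6 = 1 := (hIτ.frame hυF (by decide) (by decide)).r6
      refine Exec.straight rfl ?_
      simp only [Prog.exec, State.setReg, Function.update_apply, Nat.reduceEqDiff, if_true,
        if_false, u1, f5, f6]
      refine ⟨by omega, ?_⟩
      rw [Ne, Nat.add_eq_zero_iff, not_and_or, ← Ne, ← Ne, u2]
      constructor
      · rintro (⟨y, h1, h2⟩ | h)
        · exact ⟨y, by omega, h2⟩
        · exact ⟨j, by omega, h⟩
      · rintro ⟨y, h1, h2⟩
        rcases Nat.lt_succ_iff_lt_or_eq.1 h1 with h | rfl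
        · exact Or.inl ⟨y, h, h2⟩
        · exact Or.inr h2
    · intro υ hυF ⟨u1, u2⟩
      have e50 : υ.reg 50 = k := by
        rw [hυF.reg 50 (by decide)]
        simp [Prog.exec, State.setReg, hi]
      have e9 : υ.arr 9 = τ.arr 9 := hυF.arr 9 (by decide)
      refine Exec.straight rfl ?_
      simp only [Prog.exec, State.setReg, State.setArr, Function.update_apply, Nat.reduceEqDiff,
        if_true, if_false, u1, e50, e9]
      refine ⟨by ring, fun i hi => ?_⟩
      rcases Nat.lt_succ_iff_lt_or_eq.1 hi with h | rfl
      · rw [if_neg (by omega)]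
        exact g2 i h
      · rw [if_pos rfl]
        exact u2
  · have hlt : (a : ℕ) * C + x < D * C := by
      have := Nat.mul_le_mul_right C a.2
      rw [Nat.succ_mul] at this
      omega
    rw [h.2 _ hlt]
    have e : ∀ y : Fin C, σ.arr 5 ((a * C + x) * C + y) ≠ 0 ↔
        (x, some (Op.write a), y) ∈ I.contributor.trans := fun y => by
      have h := hI.writeC a x y
      rwa [show (a * (C * C) + (x * C + y) : ℕ) = (a * C + x) * C + y by ring] at h
    exact ⟨fun ⟨y, h1, h2⟩ => ⟨⟨y, h1⟩, (e ⟨y, h1⟩).1 h2⟩, fun ⟨y, h⟩ => ⟨y, y.2, (e y).2 h⟩⟩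
  · have h1 : D * C ≤ D * (C * C) := Nat.mul_le_mul_left D (Nat.le_mul_self C)
    have h2 : 1 ≤ D * C := Nat.mul_pos hD hC
    simp only [Prog.size]
    have h3 : D * C * (6 * C + 5 + 3) = 6 * (D * (C * C)) + 8 * (D * C) := by ring
    omega

/-- The tables in arrays `7` to `9`. -/
def moveTables : Prog :=
  forN 22 2 (.store 15 22 6) ⨟ freeMoves 7 1 2 8 ⨟ freeMoves 8 4 5 9 ⨟ writeTable

theorem moveTables_spec {σ : State} (hI : Inputs I σ) :
    Exec moveTables σ (120 * (L * L * D * (C * C))) fun τ =>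
      IsRel (τ.arr 7) (I.leader.restrict ∅).Edge ∧
      IsRel (τ.arr 8) (I.contributor.restrict ∅).Edge ∧
      IsWriteTable I.contributor (τ.arr 9) := by
  obtain ⟨hL, hC, hD⟩ := hI.pos
  refine (Exec.bind (Exec.forN (N := D) (c := 1) (fun k τ => ∀ i < k, τ.arr 15 i ≠ 0) hI.r2 hI.r6
    (by decide) (by simp) ?_) (T' := 40 * (D * (L * L)) + (40 * (D * (C * C)) +
      20 * (D * (C * C)))) ?_).mono ?_ fun _ _ h => h
  · intro k τ hk hF hi g
    refine Exec.straight rfl fun i hlt => ?_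
    have e6 : τ.reg 6 = 1 := (hI.frame hF (by decide) (by decide)).r6
    simp only [Prog.exec, State.setReg, State.setArr, Function.update_apply, if_true, hi, e6]
    split_ifs with h
    · exact one_ne_zero
    · exact g i (by omega)
  · intro τ₁ hF₁ h₁
    have hI₁ := hI.frame hF₁ (by decide) (by decide)
    have hU₁ : IsSet (τ₁.arr 15) (Set.univ : Set (Fin D)) := fun a => by simp [h₁ a a.2]
    refine Exec.bind (freeMoves_spec (P := I.leader) hI₁ hL hI₁.r8 (by decide) hI₁.epsL
      hI₁.writeL hU₁) ?_
    intro τ₂ hF₂ h₂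
    have hI₂ := hI₁.frame hF₂ (by decide) (by decide)
    refine Exec.bind (freeMoves_spec (P := I.contributor) hI₂ hC hI₂.r9 (by decide) hI₂.epsC
      hI₂.writeC (by rw [hF₂.arr 15 (by decide)]; exact hU₁)) ?_
    intro τ₃ hF₃ h₃
    have hI₃ := hI₂.frame hF₃ (by decide) (by decide)
    refine (writeTable_spec hI₃).mono le_rfl fun τ₄ hF₄ h₄ => ⟨?_, ?_, h₄⟩
    · rw [hF₄.arr 7 (by decide), hF₃.arr 7 (by decide)]
      exact h₂
    · rw [hF₄.arr 8 (by decide)]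
      exact h₃
  · set U := L * L * D * (C * C) with hU
    have h1 : D * (L * L) ≤ U := by
      rw [show U = D * (L * L) * (C * C) by rw [hU]; ring]
      exact Nat.le_mul_of_pos_right _ (by positivity)
    have h2 : D * (C * C) ≤ U := by
      rw [show U = D * (C * C) * (L * L) by rw [hU]; ring]
      exact Nat.le_mul_of_pos_right _ (by positivity)
    have h3 : D ≤ D * (L * L) := Nat.le_mul_of_pos_right _ (by positivity)
    omega

end RAM

/-- The least element of the component of a state without reads serves as the representative. -/
theorem Thread.exists_representative {D L : ℕ} (P : Thread (Fin D) (Fin L)) :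
    ∃ rep : Fin L → Fin L, (∀ p, rep p ∈ (P.restrict ∅).sccOf p) ∧
      (∀ p, ∀ p' ∈ (P.restrict ∅).sccOf p, rep p' = rep p) ∧ ∀ p, rep p ≤ p := by
  have hne : ∀ p, ((P.restrict ∅).sccOf p).Nonempty := fun p => ⟨p, mem_sccOf_self _ p⟩
  have h1 : ∀ p, wellFounded_lt.min _ (hne p) ∈ (P.restrict ∅).sccOf p :=
    fun p => WellFounded.min_mem _ _ _
  have h2 : ∀ p, ∀ p' ∈ (P.restrict ∅).sccOf p, wellFounded_lt.min _ (hne p) ≤ p' :=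
    fun p p' h => not_lt.1 (WellFounded.not_lt_min _ _ h)
  refine ⟨fun p => wellFounded_lt.min _ (hne p), h1, fun p p' h => le_antisymm ?_ ?_,
    fun p => h2 p p (mem_sccOf_self _ p)⟩
  · exact h2 _ _ (mem_sccOf_trans (mem_sccOf_symm h) (h1 p))
  · exact h2 _ _ (mem_sccOf_trans h (h1 p'))

namespace RAM

variable {L C D : ℕ} {I : LCRInstance L C D} {rep : Fin L → Fin L}

/-! ### Representatives and roots -/

/-- Array `10` becomes the table of the representatives. Array `33` marks the states that have one.
A component is computed only for the first of its states. -/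
def representatives : Prog :=
  setZero 21 2 ⨟ setZero 33 0 ⨟
  forN 74 0 (
    .load 76 33 74 ⨟
    .cond 76 skip (
      .add 14 74 7 ⨟ leaderComponent ⨟
      forN 50 0 (.load 52 29 50 ⨟ .cond 52 (.store 10 50 74 ⨟ .store 33 50 6) skip)))

/-- The states of the component get the state in register `74` as representative. -/
theorem markComponent_spec {σ : State} {T : Set (Fin L)} {k : ℕ} (hI : Inputs I σ)
    (hset : IsSet (σ.arr 29) T) (hk : σ.reg 74 = k) :
    Exec (forN 50 0 (.load 52 29 50 ⨟ .cond 52 (.store 10 50 74 ⨟ .store 33 50 6) skip)) σ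
      (7 * L + 3) fun τ => ∀ p : Fin L, (p ∈ T → τ.arr 10 p = k ∧ τ.arr 33 p ≠ 0) ∧
        (p ∉ T → τ.arr 10 p = σ.arr 10 p ∧ τ.arr 33 p = σ.arr 33 p) := by
  refine (Exec.forN (N := L) (c := 4) (fun j τ => ∀ p : Fin L,
    (p ∈ T ∧ (p : ℕ) < j → τ.arr 10 p = k ∧ τ.arr 33 p ≠ 0) ∧
    (¬ (p ∈ T ∧ (p : ℕ) < j) → τ.arr 10 p = σ.arr 10 p ∧ τ.arr 33 p = σ.arr 33 p))
    hI.r0 hI.r6 (by decide) (by simp [State.setReg]) ?_).mono (by omega)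
    fun τ _ h p => by simpa using h p
  intro j τ hj hF hi g
  have e6 : τ.reg 6 = 1 := (hI.frame hF (by decide) (by decide)).r6
  have e74 : τ.reg 74 = k := (hF.reg 74 (by decide)).trans hk
  have e29 : τ.arr 29 = σ.arr 29 := hF.arr 29 (by decide)
  have f : σ.arr 29 j ≠ 0 ↔ (⟨j, hj⟩ : Fin L) ∈ T := hset ⟨j, hj⟩
  refine Exec.straight rfl fun p => ?_
  by_cases hjT : σ.arr 29 j = 0
  · have hn : (⟨j, hj⟩ : Fin L) ∉ T := fun h => f.2 h hjT
    have hlt : p ∈ T ∧ (p : ℕ) < j + 1 ↔ p ∈ T ∧ (p : ℕ) < j := by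
      refine ⟨fun ⟨a, b⟩ => ⟨a, ?_⟩, fun ⟨a, b⟩ => ⟨a, by omega⟩⟩
      rcases Nat.lt_succ_iff_lt_or_eq.1 b with h | h
      · exact h
      · obtain rfl : p = ⟨j, hj⟩ := Fin.ext h
        exact absurd a hn
    rw [hlt]
    simpa [Prog.exec, State.setReg, skip, hi, e29, hjT] using g p
  · have hm : (⟨j, hj⟩ : Fin L) ∈ T := f.1 hjT
    simp only [Prog.exec, State.setReg, State.setArr, Function.update_apply, Nat.reduceEqDiff,
      if_true, if_false, hi, e29, hjT, e74, e6]
    by_cases hp : (p : ℕ) = j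
    · obtain rfl : p = ⟨j, hj⟩ := Fin.ext hp
      simp [hm]
    · rw [if_neg hp, if_neg hp]
      have hlt : p ∈ T ∧ (p : ℕ) < j + 1 ↔ p ∈ T ∧ (p : ℕ) < j :=
        and_congr_right fun _ => by omega
      rw [hlt]
      exact g p

set_option maxRecDepth 8000 in
/-- A state is treated if and only if it is its own representative, that is, once for every component, so
the expensive computation takes place `s` times. -/
theorem representatives_spec {σ : State} (hI : Inputs I σ)
    (hfree : IsRel (σ.arr 7) (I.leader.restrict ∅).Edge)
    (hrep : ∀ p, rep p ∈ (I.leader.restrict ∅).sccOf p)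
    (hrep' : ∀ p, ∀ p' ∈ (I.leader.restrict ∅).sccOf p, rep p' = rep p)
    (hle : ∀ p, rep p ≤ p) :
    Exec representatives σ (I.leader.numSCC * (250 * (L * L * D)) + 20 * D + 20 * L + 20)
      fun τ => ∀ p : Fin L, τ.arr 10 p = rep p := by
  obtain ⟨hL, hC, hD⟩ := hI.pos
  set K := 200 * (L * L * D) + 7 * L + 10 with hK
  have hcomp : ∀ {p q : Fin L}, rep q = q →
      (p ∈ (I.leader.restrict ∅).sccOf q ↔ rep p = q) := by
    intro p q hq
    refine ⟨fun h => by rw [hrep' q p h, hq], fun h => ?_⟩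
    have := hrep p
    rw [h] at this
    exact Thread.mem_sccOf_symm this
  refine (Exec.bind (setZero_spec (dst := 21) (n := 2) hI.r2 hI.r6 hI.zero (by norm_num)
    (by norm_num)) (T' := 6 * L + 4 + (I.leader.numSCC * K + 10 * L + 3 * L + 3)) ?_).mono ?_
    fun _ _ h => h
  · intro τ₁ hF₁ h₁
    have hI₁ := hI.frame hF₁ (by decide) (by decide)
    refine Exec.bind (setZero_spec (dst := 33) (n := 0) hI₁.r0 hI₁.r6 hI₁.zero (by norm_num)
      (by norm_num)) ?_
    intro τ₂ hF₂ h₂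
    have hI₂ := hI₁.frame hF₂ (by decide) (by decide)
    have h21 : ∀ i < D, τ₂.arr 21 i = 0 := fun i hi => by
      rw [hF₂.arr 21 (by decide)]
      exact h₁ i hi
    have h7 : τ₂.arr 7 = σ.arr 7 := by
      rw [hF₂.arr 7 (by decide), hF₁.arr 7 (by decide)]
    refine (Exec.forN_budget (N := L) (b := I.leader.numSCC * K + 10 * L) (fun k b τ =>
      (∀ p : Fin L, (τ.arr 33 p ≠ 0 ↔ (rep p : ℕ) < k) ∧ ((rep p : ℕ) < k → τ.arr 10 p = rep p)) ∧
      {q : Fin L | rep q = q ∧ k ≤ (q : ℕ)}.ncard * K + 10 * (L - k) ≤ b)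
      hI₂.r0 hI₂.r6 (by decide) ⟨?_, ?_⟩ ?_).mono le_rfl ?_
    · exact fun p => by simp [State.setReg, h₂ p p.2]
    · have : {q : Fin L | rep q = q ∧ 0 ≤ (q : ℕ)} ⊆ Set.range rep := fun q h => ⟨q, h.1⟩
      have := (Set.ncard_le_ncard this).trans (SearchNode.ncard_range_rep_le hrep')
      have := Nat.mul_le_mul_right K this
      omega
    · intro k b τ hk hF hi ⟨g1, g2⟩
      set q₀ : Fin L := ⟨k, hk⟩ with hq₀
      have hIτ : Inputs I ((Prog.load 76 33 74).exec τ) :=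
        (hI₂.frame hF (by decide) (by decide)).exec rfl (by decide) (by decide)
      have e76 : ((Prog.load 76 33 74).exec τ).reg 76 = τ.arr 33 k := by
        simp [Prog.exec, State.setReg, hi]
      have f : τ.arr 33 k ≠ 0 ↔ (rep q₀ : ℕ) < k := (g1 q₀).1
      have hqk : (rep q₀ : ℕ) ≤ k := hle q₀
      have hstep : {q : Fin L | rep q = q ∧ k + 1 ≤ (q : ℕ)} ⊆
          {q : Fin L | rep q = q ∧ k ≤ (q : ℕ)} := fun q h => ⟨h.1, by have := h.2; omega⟩
      by_cases hnew : rep q₀ = q₀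
      · have hcard : {q : Fin L | rep q = q ∧ k + 1 ≤ (q : ℕ)}.ncard <
            {q : Fin L | rep q = q ∧ k ≤ (q : ℕ)}.ncard := by
          refine Set.ncard_lt_ncard (hstep.ssubset_of_not_subset fun h => ?_)
          have : k + 1 ≤ k := (h ⟨hnew, le_rfl⟩ : rep q₀ = q₀ ∧ k + 1 ≤ (q₀ : ℕ)).2
          omega
        have hmul := Nat.mul_le_mul_right K hcard
        rw [Nat.succ_mul] at hmul
        refine ⟨b - K, K, by omega, ?_⟩
        refine (Exec.straight_seq rfl (Exec.cond (T := 200 * (L * L * D) + 7 * L + 4)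
          (fun h => ?_) fun h => ?_)).mono (by simp only [Prog.size]; omega) fun _ _ h => h
        · rw [e76, f, hnew] at h
          exact absurd h (lt_irrefl k)
        · have hI₃ : Inputs I ((Prog.add 14 74 7).exec ((Prog.load 76 33 74).exec τ)) :=
            hIτ.exec rfl (by decide) (by decide)
          refine (Exec.straight_seq rfl (Exec.bind (leaderComponent_spec (A := ∅) (q := q₀) hI₃
            ?_ ?_ ?_) (T' := 7 * L + 3) ?_)).mono (by simp only [Prog.size]; omega)
            fun _ _ h => h
          · change IsRel (τ.arr 7) _
            rw [hF.arr 7 (by decide), h7]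
            exact hfree
          · have : τ.reg 7 = 0 := (hI₂.frame hF (by decide) (by decide)).r7
            simp [Prog.exec, State.setReg, hi, this, hq₀]
          · intro a
            change τ.arr 21 a ≠ 0 ↔ _
            rw [hF.arr 21 (by decide)]
            simp [h21 a a.2]
          · rintro υ hυF ⟨-, u⟩
            have hIυ := hI₃.frame hυF (by decide) (by decide)
            refine (markComponent_spec (k := k) hIυ u ?_).mono le_rfl fun ρ _ hρ => ⟨?_, ?_⟩
            · rw [hυF.reg 74 (by decide)]
              simp [Prog.exec, State.setReg, hi]
            · intro p
              have e10 : υ.arr 10 = τ.arr 10 := hυF.arr 10 (by decide)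
              have e33 : υ.arr 33 = τ.arr 33 := hυF.arr 33 (by decide)
              change (ρ.arr 33 p ≠ 0 ↔ _) ∧ (_ → ρ.arr 10 p = _)
              by_cases hp : rep p = q₀
              · obtain ⟨r1, r2⟩ := (hρ p).1 ((hcomp hnew).2 hp)
                have hlt : (rep p : ℕ) < k + 1 := by rw [hp]; exact Nat.lt_succ_self k
                exact ⟨⟨fun _ => hlt, fun _ => r2⟩, fun _ => by rw [r1, hp]⟩
              · obtain ⟨r1, r2⟩ := (hρ p).2 fun h => hp ((hcomp hnew).1 h)
                have hlt : (rep p : ℕ) < k + 1 ↔ (rep p : ℕ) < k := by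
                  have : (rep p : ℕ) ≠ k := fun h => hp (Fin.ext h)
                  omega
                rw [r1, r2, e10, e33, hlt]
                exact g1 p
            · omega
      · have hlt : (rep q₀ : ℕ) < k := lt_of_le_of_ne hqk fun h => hnew (Fin.ext h)
        have hmul := Nat.mul_le_mul_right K (Set.ncard_le_ncard hstep)
        refine ⟨b - 10, 10, by omega, ?_⟩
        refine (Exec.straight_seq rfl (Exec.cond (T := 1) (fun h => ?_) fun h => ?_)).mono
          (by simp only [Prog.size]; omega) fun _ _ h => h
        · refine Exec.straight (p := skip) rfl ⟨fun p => ?_, by omega⟩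
          have hne : (rep p : ℕ) ≠ k := fun h => by
            have h' : rep p = q₀ := Fin.ext h
            have := hrep' p (rep p) (hrep p)
            rw [h'] at this
            exact hnew this
          have : (rep p : ℕ) < k + 1 ↔ (rep p : ℕ) < k := by omega
          rw [this]
          exact g1 p
        · exact absurd (e76 ▸ h) (f.2 hlt)
    · rintro τ - ⟨b, g, -⟩ p
      exact (g p).2 (rep p).2
  · have h1 : L ≤ L * L * D := (Nat.le_mul_self L).trans (Nat.le_mul_of_pos_right _ hD)
    have h2 : K ≤ 250 * (L * L * D) := by omega
    have h3 := Nat.mul_le_mul_left I.leader.numSCC h2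
    omega

end RAM

namespace RAM

variable {L C D : ℕ} {I : LCRInstance L C D} {rep : Fin L → Fin L}

/-- Array `31` becomes the set of the representatives of the states which the leader reaches with
internal moves and reads of the initial value. -/
def findRoots : Prog :=
  .const 20 0 ⨟ copySeg 25 1 8 ⨟ mulReg 20 8 3 ⨟ addSeg 25 3 8 ⨟ searchFrom 25 27 4 0 ⨟
  setZero 31 0 ⨟
  forN 50 0 (.load 52 27 50 ⨟ .cond 52 (.load 58 10 50 ⨟ .store 31 58 6) skip)

theorem findRoots_spec {σ : State} (hT : Tables I rep σ) :
    Exec findRoots σ (120 * (L * L * D)) fun τ => IsSet (τ.arr 31)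
      {s | ∃ p, Relation.ReflTransGen (I.leader.ReadStep {I.initValue}) I.leader.init p ∧
        rep p = s} := by
  obtain ⟨hL, hC, hD⟩ := hT.pos
  have hT₀ : Tables I rep ((Prog.const 20 0).exec σ) := hT.exec rfl (by decide) (by decide)
  refine (Exec.straight_seq rfl (Exec.bind (copySeg_spec (dst := 25) (src := 1) (n := 8)
    (N := L * L) hT₀.r8 hT₀.r6 (by norm_num) (by norm_num))
    (T' := 4 * I.initValue + 4 + (8 * (L * L) + 3 + (65 * (L * L) + (6 * L + 4 +
      (L * (4 + 3) + 3))))) ?_)).mono ?_ fun _ _ h => h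
  · intro τ₁ hF₁ h₁
    have hT₁ := hT₀.frame hF₁ (by decide) (by decide)
    refine Exec.bind (mulReg_spec (X := L * L) (Y := I.initValue) hT₁.r8 hT₁.r3 hT₁.r6
      (by decide)) ?_
    intro τ₂ hF₂ h₂
    have hT₂ := hT₁.frame hF₂ (by decide) (by decide)
    refine Exec.bind (addSeg_spec (dst := 25) (src := 3) (n := 8) (N := L * L) hT₂.r8 hT₂.r6
      (by norm_num) (by norm_num)) ?_
    intro τ₃ hF₃ h₃
    have hT₃ := hT₂.frame hF₃ (by decide) (by decide)
    have hR₃ : IsRel (τ₃.arr 25) (I.leader.ReadStep {I.initValue}) := by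
      intro x y
      have e1 : τ₁.arr 25 (x * L + y) ≠ 0 ↔ (x, none, y) ∈ I.leader.trans := by
        rw [h₁ _ (pair_lt x.2 y.2)]
        simpa [Prog.exec, State.setReg] using hT₀.epsL x y
      have e2 := hT₂.readL I.initValue x y
      rw [h₃ _ (pair_lt x.2 y.2), h₂, mul_comm (L * L), hF₂.arr 25 (by decide), Ne,
        Nat.add_eq_zero_iff, not_and_or, ← Ne, ← Ne, e1, e2]
      simp [Thread.ReadStep]
    refine Exec.bind (searchFrom_spec (q := I.leader.init) hT₃.r0 hT₃.r6 hT₃.r7 hT₃.zero hT₃.r4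
      (by norm_num) hR₃) ?_
    intro τ₄ hF₄ h₄
    have hT₄ := hT₃.frame hF₄ (by decide) (by decide)
    refine Exec.bind (setZero_spec (dst := 31) (n := 0) hT₄.r0 hT₄.r6 hT₄.zero (by norm_num)
      (by norm_num)) ?_
    intro τ₅ hF₅ h₅
    have hT₅ := hT₄.frame hF₅ (by decide) (by decide)
    have h27 : τ₅.arr 27 = τ₄.arr 27 := hF₅.arr 27 (by decide)
    set S := {y | Relation.ReflTransGen (I.leader.ReadStep {I.initValue}) I.leader.init y} with hS
    refine (Exec.forN (N := L) (c := 4) (fun k τ => IsSet (τ.arr 31)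
      {s | ∃ p ∈ S, (p : ℕ) < k ∧ rep p = s}) hT₅.r0 hT₅.r6 (by decide) ?_ ?_).mono le_rfl
      fun τ _ h => ?_
    · exact fun s => by simp [State.setReg, h₅ s s.2]
    · intro k τ hk hF hi g
      have hTτ := hT₅.frame hF (by decide) (by decide)
      set p₀ : Fin L := ⟨k, hk⟩ with hp₀
      have e27 : τ.arr 27 k ≠ 0 ↔ p₀ ∈ S := by
        rw [hF.arr 27 (by decide), h27]
        exact h₄ p₀
      have e10 : τ.arr 10 k = rep p₀ := hTτ.rep p₀
      have hlt : ∀ s, (∃ p ∈ S, (p : ℕ) < k + 1 ∧ rep p = s) ↔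
          (∃ p ∈ S, (p : ℕ) < k ∧ rep p = s) ∨ (p₀ ∈ S ∧ rep p₀ = s) := by
        intro s
        constructor
        · rintro ⟨p, h1, h2, h3⟩
          rcases Nat.lt_succ_iff_lt_or_eq.1 h2 with h | h
          · exact Or.inl ⟨p, h1, h, h3⟩
          · obtain rfl : p = p₀ := Fin.ext h
            exact Or.inr ⟨h1, h3⟩
        · rintro (⟨p, h1, h2, h3⟩ | ⟨h1, h2⟩)
          · exact ⟨p, h1, by omega, h3⟩
          · exact ⟨p₀, h1, Nat.lt_succ_self k, h2⟩
      refine Exec.straight rfl fun s => ?_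
      have gs := g s
      rw [Set.mem_ofPred_eq] at gs ⊢
      rw [hlt, ← gs]
      by_cases h : τ.arr 27 k = 0
      · have : p₀ ∉ S := fun hm => e27.2 hm h
        simp [Prog.exec, State.setReg, skip, hi, h, this]
      · simp only [Prog.exec, State.setReg, State.setArr, Function.update_apply,
          Nat.reduceEqDiff, if_true, if_false, hi, h, e10, hTτ.r6]
        split_ifs with hs
        · exact ⟨fun _ => Or.inr ⟨e27.1 h, (Fin.ext hs).symm⟩, fun _ => one_ne_zero⟩
        · refine ⟨Or.inl, ?_⟩
          rintro (h' | ⟨-, rfl⟩)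
          · exact h'
          · exact absurd rfl hs
    · intro s
      rw [h s]
      simp [hS]
  · have h1 : L * L ≤ L * L * D := Nat.le_mul_of_pos_right _ hD
    have h2 : D ≤ L * L * D := Nat.le_mul_of_pos_left _ (Nat.mul_pos hL hL)
    have h3 : L ≤ L * L := Nat.le_mul_self L
    have h4 := I.initValue.2
    simp only [Prog.size]
    omega

/-- The search starts with the nodes for the states in array `31`. -/
def pushRoots : Prog :=
  setZero 20 1 ⨟ .store 20 5 6 ⨟ .const 11 0 ⨟ .const 12 0 ⨟ .const 13 0 ⨟ .add 15 3 7 ⨟ push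

theorem pushRoots_spec {σ : State} (hT : Tables I rep σ) (hS : IsSet (σ.arr 31)
      {s | ∃ p, Relation.ReflTransGen (I.leader.ReadStep {I.initValue}) I.leader.init p ∧
        rep p = s}) :
    Exec pushRoots σ (50 * (L * C)) fun τ => τ.reg 13 = 0 ∧
      ∃ l : List (SearchNode (Fin D) (Fin L) (Fin C)), l.Nodup ∧
        (∀ nd, nd ∈ l ↔ nd.IsRoot I.leader I.contributor I.initValue rep) ∧ Pending l τ := by
  obtain ⟨hL, hC, hD⟩ := hT.pos
  refine (Exec.bind (setZero_spec (dst := 20) (n := 1) hT.r1 hT.r6 hT.zero (by norm_num)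
    (by norm_num)) (T' := 5 + 30 * (L * C)) ?_).mono ?_ fun _ _ h => h
  · intro τ hF hτ
    have hTτ := hT.frame hF (by decide) (by decide)
    set υ := (Prog.add 15 3 7).exec ((Prog.const 13 0).exec ((Prog.const 12 0).exec
      ((Prog.const 11 0).exec ((Prog.store 20 5 6).exec τ)))) with hυ
    have hTυ : Tables I rep υ := (((((hTτ.exec (p := .store 20 5 6) rfl (by decide)
      (by decide)).exec (p := .const 11 0) rfl (by decide) (by decide)).exec (p := .const 12 0) rfl
      (by decide) (by decide)).exec (p := .const 13 0) rfl (by decide) (by decide)).exec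
      (p := .add 15 3 7) rfl (by decide) (by decide))
    refine (Exec.straight_seq rfl (Exec.straight_seq rfl (Exec.straight_seq rfl
      (Exec.straight_seq rfl (Exec.straight_seq rfl ((push_spec (X := {I.contributor.init})
      (S := {s | ∃ p, Relation.ReflTransGen (I.leader.ReadStep {I.initValue}) I.leader.init p ∧
        rep p = s}) (v := some I.initValue) (l := []) (σ := υ) hTυ ?_ ?_ ?_ ?_).mono le_rfl
      fun ρ hρF ⟨cs, h1, h2, h3⟩ => ⟨?_, cs, h1, fun nd => ?_, ?_⟩)))))).mono
      (by simp only [Prog.size]; omega) fun _ _ h => h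
    · exact isSet_singleton hτ hTτ.r5 hTτ.r6
    · change IsSet (τ.arr 31) _
      rw [hF.arr 31 (by decide)]
      exact hS
    · simp [hυ, Prog.exec, State.setReg, State.setArr, hTτ.r3, hTτ.r7, valueCode]
    · exact ⟨by simp [hυ, Prog.exec, State.setReg], by simp [hυ, Prog.exec, State.setReg],
        trivial⟩
    · rw [hρF.reg 13 (by decide)]
      simp [hυ, Prog.exec, State.setReg]
    · rw [h2]
      constructor
      · rintro ⟨⟨p, hp, hs⟩, hv, hX⟩
        exact ⟨p, hp, hs.symm, hv, hX⟩
      · rintro ⟨p, hp, hs, hv, hX⟩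
        exact ⟨⟨p, hp, hs.symm⟩, hv, hX⟩
    · rwa [List.append_nil] at h3
  · have h1 : C ≤ L * C := Nat.le_mul_of_pos_left _ hL
    omega

/-! ### The algorithm -/

/-- The program for leader contributor reachability. -/
def solver : Prog :=
  sizes ⨟ moveTables ⨟ representatives ⨟ findRoots ⨟ pushRoots ⨟ searchLoop ⨟
  .const 0 0 ⨟ .cond 13 (.const 0 1) skip

set_option maxRecDepth 8000 in
theorem solver_spec (I : LCRInstance L C D) (hown : I.leader.OwnReadsReplaceable) :
    Exec solver I.input (3000 * (I.leader.witSCC * (L * L * D * (C * C)))) fun τ =>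
      τ.reg 0 = bit01 I.Reachable := by
  obtain ⟨rep, hrep, hrep', hle⟩ := I.leader.exists_representative
  have hL : 1 ≤ L := I.leader.init.pos
  have hC : 1 ≤ C := I.contributor.init.pos
  have hD : 1 ≤ D := I.initValue.pos
  refine (Exec.bind (sizes_spec I) (T' := 120 * (L * L * D * (C * C)) +
    (I.leader.numSCC * (250 * (L * L * D)) + 20 * D + 20 * L + 20 + (120 * (L * L * D) +
    (50 * (L * C) + (I.leader.witSCC * (1500 * (L * L * D * (C * C)) + 1) + 1 + 3))))) ?_).mono ?_
    fun _ _ h => h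
  · intro τ₁ hF₁ hI₁
    refine Exec.bind (moveTables_spec hI₁) ?_
    intro τ₂ hF₂ ⟨a7, a8, a9⟩
    have hI₂ := hI₁.frame hF₂ (by decide) (by decide)
    refine Exec.bind (representatives_spec hI₂ a7 hrep hrep' hle) ?_
    intro τ₃ hF₃ a10
    have hT₃ : Tables I rep τ₃ := by
      refine ⟨hI₂.frame hF₃ (by decide) (by decide), ?_, ?_, ?_, a10⟩
      · rwa [hF₃.arr 7 (by decide)]
      · rwa [hF₃.arr 8 (by decide)]
      · rwa [hF₃.arr 9 (by decide)]
    refine Exec.bind (findRoots_spec hT₃) ?_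
    intro τ₄ hF₄ h₄
    have hT₄ := hT₃.frame hF₄ (by decide) (by decide)
    refine Exec.bind (pushRoots_spec hT₄ h₄) ?_
    intro τ₅ hF₅ ⟨h13, l, hn, hl, hp⟩
    have hT₅ := hT₄.frame hF₅ (by decide) (by decide)
    refine Exec.bind (searchLoop_spec hrep hrep' hT₅ h13 hn hl hp) ?_
    intro τ₆ hF₆ h₆
    rw [← I.reachable_iff hown hrep] at h₆
    refine Exec.straight rfl ?_
    by_cases h : τ₆.reg 13 = 0
    · have : ¬ I.Reachable := fun hr => h₆.2 hr h
      simp [Prog.exec, State.setReg, skip, h, bit01, this]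
    · simp [Prog.exec, State.setReg, h, bit01, h₆.1 h]
  · have hd := I.leader.straightLineDepth_pos
    have hwit : I.leader.numSCC ≤ I.leader.witSCC := by
      refine le_trans (Nat.le_mul_of_pos_right _ ?_) (I.leader.geometric_sum_le_witSCC hD hd)
      refine Finset.sum_pos' (fun _ _ => Nat.zero_le _) ⟨0, Finset.mem_range.2 hd, ?_⟩
      simp
    have hwit' := I.leader.numSCC_pos.trans hwit
    set w := I.leader.witSCC with hw
    set U := L * L * D * (C * C) with hU
    have hUw : U ≤ w * U := Nat.le_mul_of_pos_left _ hwit'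
    have hU1 : 1 ≤ U := by
      have : 0 < U := by positivity
      exact this
    have hww : w ≤ w * U := Nat.le_mul_of_pos_right _ hU1
    have h1 : L * L * D ≤ U := Nat.le_mul_of_pos_right _ (by positivity)
    have h2 : D ≤ L * L * D := Nat.le_mul_of_pos_left _ (by positivity)
    have h3 : L ≤ L * L * D := (Nat.le_mul_self L).trans (Nat.le_mul_of_pos_right _ hD)
    have h4 : L * C ≤ U := by
      rw [show U = L * C * (L * D * C) by rw [hU]; ring]
      exact Nat.le_mul_of_pos_right _ (by positivity)
    have h5 : I.leader.numSCC * (250 * (L * L * D)) ≤ w * (250 * U) :=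
      Nat.mul_le_mul hwit (by omega)
    have h6 : w * (250 * U) = 250 * (w * U) := by ring
    have h7 : w * (1500 * U + 1) = 1500 * (w * U) + w := by ring
    omega

end RAM

theorem mainTheorem2 :
    (∀ (L C D : ℕ) (I : LCRInstance L C D),
      I.leader.witSCC ≤ (I.leader.numSCC * (D + 1)) ^ I.leader.straightLineDepth * D ^ D *
        2 ^ (D + I.leader.straightLineDepth)) ∧
    ∃ (p : RAM.Prog) (K : ℕ), ∀ (L C D : ℕ) (I : LCRInstance L C D),
      I.leader.OwnReadsReplaceable →
        ∃ (σ : RAM.State) (t : ℕ), RAM.Run p I.input σ t ∧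
          σ.reg 0 = bit01 I.Reachable ∧
          t ≤ K * (I.leader.witSCC * validSCC L D C I.leader.straightLineDepth) := by
  constructor
  · intro L C D I
    exact (I.leader.sccCandidates_finite_and_ncard_le I.initValue.pos
      I.leader.straightLineDepth_pos).2
  · refine ⟨RAM.solver, 3000, fun L C D I hown => ?_⟩
    obtain ⟨σ, t, hrun, ht, hσ⟩ := RAM.solver_spec I hown
    refine ⟨σ, t, hrun, hσ, ht.trans ?_⟩
    refine Nat.mul_le_mul_left _ (Nat.mul_le_mul_left _ ?_)
    have hd : 1 ≤ I.leader.straightLineDepth ^ 2 := Nat.one_le_pow _ _ I.leader.straightLineDepth_pos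
    rw [validSCC, show L * L * D * (C * C) = L ^ 2 * D * C ^ 2 by ring]
    exact Nat.le_mul_of_pos_right _ hd
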